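/- Let $n\ge 2$, and let $(N^n,g_N)$ be a closed (compact, connected, without boundary) Riemannian manifold of constant sectional curvature $c$. Let $0<\bar r\le\infty$ and let $\lambda:(0,\bar r)\to(0,\infty)$ be smooth with $$\lambda'(r)>0\qquad\text{and}\qquad \frac{\lambda''(r)}{\lambda(r)}+\frac{c-\lambda'(r)^2}{\lambda(r)^2}\ \ge\ 0\qquad\text{for all } r\in(0,\bar r).$$ Let $\overline M^{\,n+1}=[0,\bar r)\times_\lambda N$ be the warped product with metric $\bar g=dr^2+\lambda(r)^2g_N$; that is, $\overline M$ is a smooth Riemannian manifold without boundary that is either $(0,\bar r)\times N$ with this metric, or this together with the single point $r=0$ into which the fibre collapses when $\lambda(0)=0$ and the metric extends smoothly there (the vector field $\lambda\partial_r$ being $0$ at that point). Let $\Gamma\subset\mathbb R^n$ be an open, convex cone with vertex at the origin, symmetric under permutations of the coordinates, and containing the positive cone $\{\kappa:\kappa_i>0\text{ for all }i\}$. Let $f$ be a real function on $\Gamma$ such that (i) $f$ is smooth and symmetric; (ii) $f>0$ on $\Gamma$ and $f(1,\dots,1)=1$; (iii) $\partial f/\partial\kappa_i>0$ on $\Gamma$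 for every $i$; (iv) $f(s\kappa)=sf(\kappa)$ for all $s>0$ and $\kappa\in\Gamma$; (v) on $\Gamma$, $$\sum_{i=1}^n\frac{\partial f}{\partial\kappa_i}\ge 1,\qquad \sum_{i=1}^n\frac{\partial f}{\partial\kappa_i}\kappa_i^2\ge f^2,\qquad f-\frac{\partial f}{\partial\kappa_i}\kappa_i\ge 0\ \text{ for every } i .$$ Let $X:M^n\to\overline M^{\,n+1}$ be a closed (compact, connected, without boundary), smoothly immersed hypersurface with smooth unit normal field $\nu$, and let $\kappa=(\kappa_1,\dots,\kappa_n)$ be its principal curvatures, i.e. the eigenvalues of the shape operator $v\mapsto\bar\nabla_v\nu$. Suppose that $\kappa(x)\in\Gamma$ for every $x\in M$ and that, for a constant $\alpha>0$, with $F=f(\kappa)$, $$F^{-\alpha}=\bar g(\lambda\partial_r,\nu)\qquad\text{on } M.$$ Then $M$ is a slice: there is $r_0\in(0,\bar r)$ with $X(M)=\{r_0\}\times N$. -/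

import Mathlib

open Set Filter Topology
open scoped Manifold ContDiff

noncomputable section

section RiemannianGeometry

variable {E : Type*} [NormedAddCommGroup E] [NormedSpace ℝ E]
  {F : Type*} [NormedAddCommGroup F] [NormedSpace ℝ F]
  {P : Type*} [TopologicalSpace P] [ChartedSpace E P] [IsManifold 𝓘(ℝ, E) ∞ P]
  {M : Type*} [TopologicalSpace M] [ChartedSpace F M] [IsManifold 𝓘(ℝ, F) ∞ M]

/-- Smooth Riemannian metrics on the manifold `P` (without boundary, modelled on `E`). -/
abbrev RiemMetric (E : Type*) [NormedAddCommGroup E] [NormedSpace ℝ E]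
    (P : Type*) [TopologicalSpace P] [ChartedSpace E P] [IsManifold 𝓘(ℝ, E) ∞ P] :=
  Bundle.ContMDiffRiemannianMetric 𝓘(ℝ, E) ∞ E (fun x : P => TangentSpace 𝓘(ℝ, E) x)

/-- The metric `g` in the preferred chart `φ` at `p`: for `y` in the target of `φ`, this is the
bilinear form `(v, w) ↦ g (d(φ⁻¹)_y v, d(φ⁻¹)_y w)` on `E`. -/
def metricInChart (g : RiemMetric E P) (p : P) (y : E) : E →L[ℝ] E →L[ℝ] ℝ :=
  let B : E →L[ℝ] E →L[ℝ] ℝ := g.inner ((extChartAt 𝓘(ℝ, E) p).symm y)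
  let A : E →L[ℝ] E := mfderiv 𝓘(ℝ, E) 𝓘(ℝ, E) (extChartAt 𝓘(ℝ, E) p).symm y
  B.bilinearComp A A

/-- Christoffel symbols of the first kind in the chart at `p`:
`z ↦ (∂_v G(w, z) + ∂_w G(v, z) - ∂_z G(v, w)) / 2`, with `G` the metric in the chart. -/
def christoffelLower (g : RiemMetric E P) (p : P) (y v w : E) : E →L[ℝ] ℝ :=
  let D : E →L[ℝ] E →L[ℝ] E →L[ℝ] ℝ := fderiv ℝ (metricInChart g p) y
  (1 / 2 : ℝ) • (D v w + D w v - (D.flip v).flip w)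

/-- Christoffel symbols of the second kind (Levi-Civita connection) in the chart at `p`:
`Γ(v, w)` is the vector with `G(Γ(v, w), z) = christoffelLower g p y v w z` for all `z`. -/
def christoffel (g : RiemMetric E P) (p : P) (y v w : E) : E :=
  (metricInChart g p y).inverse (christoffelLower g p y v w)

/-- The Riemann curvature tensor `R(u, v) w = ∇_u ∇_v w - ∇_v ∇_u w - ∇_[u,v] w` in the chart
at `p`. -/
def curvatureInChart (g : RiemMetric E P) (p : P) (y u v w : E) : E :=
  fderiv ℝ (fun z => christoffel g p z v w) y u - fderiv ℝ (fun z => christoffel g p z u w) y v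
    + christoffel g p y u (christoffel g p y v w) - christoffel g p y v (christoffel g p y u w)

/-- The sectional curvature at `p` of the plane spanned by the tangent vectors whose coordinates
in the chart at `p` are the linearly independent vectors `u` and `v`. -/
def sectionalCurvature (g : RiemMetric E P) (p : P) (u v : E) : ℝ :=
  let y : E := extChartAt 𝓘(ℝ, E) p p
  let G := metricInChart g p y
  G (curvatureInChart g p y u v v) u / (G u u * G v v - G u v ^ 2)

/-- `(P, g)` has constant sectional curvature `c`. -/
def HasConstantSectionalCurvature (g : RiemMetric E P) (c : ℝ) : Prop :=
  ∀ (p : P) (u v : E), LinearIndependent ℝ ![u, v] → sectionalCurvature g p u v = c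

/-- `X : M → P` is a smooth immersion. -/
structure IsSmoothImmersion (F : Type*) [NormedAddCommGroup F] [NormedSpace ℝ F]
    (E : Type*) [NormedAddCommGroup E] [NormedSpace ℝ E]
    {M : Type*} [TopologicalSpace M] [ChartedSpace F M]
    {P : Type*} [TopologicalSpace P] [ChartedSpace E P] (X : M → P) : Prop where
  smooth : ContMDiff 𝓘(ℝ, F) 𝓘(ℝ, E) ∞ X
  injective_mfderiv : ∀ x : M, Function.Injective (mfderiv 𝓘(ℝ, F) 𝓘(ℝ, E) X x)

/-- `ν` is a smooth unit normal vector field along `X : M → P`. -/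
structure IsUnitNormal (F : Type*) [NormedAddCommGroup F] [NormedSpace ℝ F]
    {M : Type*} [TopologicalSpace M] [ChartedSpace F M]
    (g : RiemMetric E P) (X : M → P) (ν : ∀ x : M, TangentSpace 𝓘(ℝ, E) (X x)) : Prop where
  smooth : ContMDiff 𝓘(ℝ, F) 𝓘(ℝ, E).tangent ∞
    (fun x => (⟨X x, ν x⟩ : TangentBundle 𝓘(ℝ, E) P))
  unit : ∀ x : M, g.inner (X x) (ν x) (ν x) = 1
  normal : ∀ (x : M) (v : TangentSpace 𝓘(ℝ, F) x),
    g.inner (X x) (ν x) (mfderiv 𝓘(ℝ, F) 𝓘(ℝ, E) X x v) = 0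

/-- The coordinates, in the chart of `P` at `p`, of a tangent vector at the point `q`. -/
def chartCoord (p q : P) (w : TangentSpace 𝓘(ℝ, E) q) : E :=
  mfderiv 𝓘(ℝ, E) 𝓘(ℝ, E) (extChartAt 𝓘(ℝ, E) p) q w

/-- The Levi-Civita covariant derivative `∇_v ν` at `x` of a vector field `ν` along `X : M → P`,
in coordinates of the chart of `P` at `X x`. -/
def covDerivAlong (g : RiemMetric E P) (X : M → P) (ν : ∀ x : M, TangentSpace 𝓘(ℝ, E) (X x))
    (x : M) (v : TangentSpace 𝓘(ℝ, F) x) : E :=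
  let D : E := mfderiv 𝓘(ℝ, F) 𝓘(ℝ, E) (fun y => chartCoord (X x) (X y) (ν y)) x v
  D + christoffel g (X x) (extChartAt 𝓘(ℝ, E) (X x) (X x))
    (chartCoord (X x) (X x) (mfderiv 𝓘(ℝ, F) 𝓘(ℝ, E) X x v)) (chartCoord (X x) (X x) (ν x))

/-- The first fundamental form `g(dX v, dX w)` of `X : M → P` at `x`. -/
def firstFundForm (g : RiemMetric E P) (X : M → P) (x : M) (v w : TangentSpace 𝓘(ℝ, F) x) : ℝ :=
  g.inner (X x) (mfderiv 𝓘(ℝ, F) 𝓘(ℝ, E) X x v) (mfderiv 𝓘(ℝ, F) 𝓘(ℝ, E) X x w)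

/-- The second fundamental form `h(v, w) = g(∇_v ν, dX w)` of `X : M → P` at `x` with respect to
the unit normal `ν` (positive on round spheres with the outward normal). -/
def secondFundForm (g : RiemMetric E P) (X : M → P) (ν : ∀ x : M, TangentSpace 𝓘(ℝ, E) (X x))
    (x : M) (v w : TangentSpace 𝓘(ℝ, F) x) : ℝ :=
  metricInChart g (X x) (extChartAt 𝓘(ℝ, E) (X x) (X x)) (covDerivAlong g X ν x v)
    (chartCoord (X x) (X x) (mfderiv 𝓘(ℝ, F) 𝓘(ℝ, E) X x w))

/-- `k = (k_1, …, k_n)` are the principal curvatures of the hypersurface `X : M → P` at `x` with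
respect to the unit normal `ν`, i.e. the eigenvalues of the shape operator, with multiplicity and
in some order: in some orthonormal basis of the tangent space at `x`, the second fundamental form
is the diagonal matrix with entries `k_1, …, k_n`. -/
def IsPrincipalCurvatures {n : ℕ} {M : Type*} [TopologicalSpace M]
    [ChartedSpace (EuclideanSpace ℝ (Fin n)) M] [IsManifold (𝓡 n) ∞ M]
    (g : RiemMetric E P) (X : M → P) (ν : ∀ x : M, TangentSpace 𝓘(ℝ, E) (X x))
    (x : M) (k : Fin n → ℝ) : Prop :=
  ∃ e : Fin n → TangentSpace (𝓡 n) x, ∀ i j : Fin n,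
    firstFundForm g X x (e i) (e j) = (if i = j then 1 else 0) ∧
    secondFundForm g X ν x (e i) (e j) = (if i = j then k i else 0)

end RiemannianGeometry

section WarpedProduct

variable {n : ℕ}
  {N : Type*} [TopologicalSpace N] [ChartedSpace (EuclideanSpace ℝ (Fin n)) N]
  [IsManifold (𝓡 n) ∞ N]
  {Q : Type*} [TopologicalSpace Q] [ChartedSpace (EuclideanSpace ℝ (Fin (n + 1))) Q]
  [IsManifold (𝓡 (n + 1)) ∞ Q]

/-- The open interval `(0, rbar)`, where `rbar` may be `∞`. -/
def radialInterval (rbar : EReal) : Set ℝ := {r : ℝ | 0 < r ∧ (r : EReal) < rbar}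

/-- `(Q, gQ)` is the warped product `[0, rbar) ×_lam N` with metric `dr² + lam(r)² gN`, through the
polar coordinates `ψ`. The map `ψ` is a diffeomorphism, isometric for the warped product metric,
from `(0, rbar) × N` onto an open subset of `Q`. It is allowed, but not required, that `Q` contains
in addition the point into which the fibre over `r = 0` collapses when `lam(0) = 0` (such as the
origin of Euclidean space for `lam(r) = r` and `N` the unit sphere). -/
structure IsWarpedProduct (gN : RiemMetric (EuclideanSpace ℝ (Fin n)) N)
    (gQ : RiemMetric (EuclideanSpace ℝ (Fin (n + 1))) Q) (rbar : EReal) (lam : ℝ → ℝ)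
    (ψ : OpenPartialHomeomorph (ℝ × N) Q) : Prop where
  source_eq : ψ.source = radialInterval rbar ×ˢ (univ : Set N)
  smooth : ContMDiffOn (𝓘(ℝ, ℝ).prod (𝓡 n)) (𝓡 (n + 1)) ∞ ψ ψ.source
  smooth_symm : ContMDiffOn (𝓡 (n + 1)) (𝓘(ℝ, ℝ).prod (𝓡 n)) ∞ ψ.symm ψ.target
  isometric : ∀ p ∈ ψ.source, ∀ (a b : ℝ) (v w : TangentSpace (𝓡 n) p.2),
    gQ.inner (ψ p) (mfderiv (𝓘(ℝ, ℝ).prod (𝓡 n)) (𝓡 (n + 1)) ψ p (a, v))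
        (mfderiv (𝓘(ℝ, ℝ).prod (𝓡 n)) (𝓡 (n + 1)) ψ p (b, w))
      = a * b + lam p.1 ^ 2 * gN.inner p.2 v w
  apex : ∀ y : Q, y ∉ ψ.target →
    Tendsto lam (𝓝[>] 0) (𝓝 0) ∧ Tendsto ψ (comap Prod.fst (𝓝[>] (0 : ℝ))) (𝓝 y)

open Classical in
/-- The conformal vector field `lam(r) ∂_r` on the warped product; it vanishes at the point
`r = 0` where the fibre collapses, if `Q` contains that point. -/
def radialField (lam : ℝ → ℝ) (ψ : OpenPartialHomeomorph (ℝ × N) Q) (y : Q) :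
    TangentSpace (𝓡 (n + 1)) y :=
  if y ∈ ψ.target then
    lam (ψ.symm y).1 •
      (mfderiv (𝓘(ℝ, ℝ).prod (𝓡 n)) (𝓡 (n + 1)) ψ (ψ.symm y) ((1 : ℝ), 0) :
        EuclideanSpace ℝ (Fin (n + 1)))
  else (0 : EuclideanSpace ℝ (Fin (n + 1)))

end WarpedProduct

section CurvatureFunctions

variable {n : ℕ}

/-- `Γ` is an open, convex, symmetric cone in `ℝⁿ` with vertex at the origin which contains the
positive cone. -/
structure IsAdmissibleCone (Γ : Set (Fin n → ℝ)) : Prop where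
  isOpen : IsOpen Γ
  convex : Convex ℝ Γ
  smul_mem : ∀ s : ℝ, 0 < s → ∀ k ∈ Γ, s • k ∈ Γ
  perm_mem : ∀ σ : Equiv.Perm (Fin n), ∀ k ∈ Γ, k ∘ σ ∈ Γ
  pos_subset : {k : Fin n → ℝ | ∀ i, 0 < k i} ⊆ Γ

/-- The partial derivative `∂f/∂κ_i` at `k`. -/
def partialDeriv (f : (Fin n → ℝ) → ℝ) (i : Fin n) (k : Fin n → ℝ) : ℝ :=
  fderiv ℝ f k (Pi.single i 1)

/-- The structure conditions on the curvature function `f` on the cone `Γ`. -/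
structure IsCurvatureFunction (Γ : Set (Fin n → ℝ)) (f : (Fin n → ℝ) → ℝ) : Prop where
  smooth : ContDiffOn ℝ ∞ f Γ
  symmetric : ∀ σ : Equiv.Perm (Fin n), ∀ k ∈ Γ, f (k ∘ σ) = f k
  pos : ∀ k ∈ Γ, 0 < f k
  normalized : f (fun _ => 1) = 1
  strictly_increasing : ∀ k ∈ Γ, ∀ i, 0 < partialDeriv f i k
  homogeneous : ∀ s : ℝ, 0 < s → ∀ k ∈ Γ, f (s • k) = s * f k
  one_le_sum : ∀ k ∈ Γ, 1 ≤ ∑ i, partialDeriv f i k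
  sq_le_sum : ∀ k ∈ Γ, f k ^ 2 ≤ ∑ i, partialDeriv f i k * k i ^ 2
  partial_mul_le : ∀ k ∈ Γ, ∀ i, 0 ≤ f k - partialDeriv f i k * k i

end CurvatureFunctions

end

/-!
# Self-similar hypersurfaces of warped products are slices

Let `u = g(lam ∂_r, ν)` be the support function and let `Φ` be a primitive of `lam`, so that the
gradient of `Φ(r)` is the closed conformal field `lam ∂_r`. The equation reads `u = F ^ (-α)`. The
function
`w = u ^ (1 + 1 / α) / (1 + 1 / α) - Φ(r)`
on the hypersurface is shown to be constant, by applying the strong minimum principle to the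
operator `∑ i, ∂f/∂κ_i ∇²(e i, e i)`, where `e` is a principal frame.

In a principal direction `dw(e i) = (κ i / F - 1) dΦ(e i)`. The Gauss and Codazzi equations express
the second derivatives of `u` and `Φ`, and the derivative of the second fundamental form that they
contain is the derivative of `F`, hence of `u`. What remains is
`∑ f_i ∇²w(e i, e i) ≤ lam' (1 - ∑ f_i) + (α u)⁻¹ ∑ κ_i dΦ(e i)² (f_i κ_i / F - 1)`:
the ambient curvature contributes a nonpositive term by the hypothesis on `lam`
(`IsWarpedHypersurface.curvature_nonpos`), and `∑ f_i κ_i² ≥ F²` disposes of a further one. The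
first summand is nonpositive. The terms of the second one with `κ_i ≥ 0` are nonpositive because
`f_i κ_i ≤ F`; for `κ_i < 0` one has `|dΦ(e i)| ≤ |dw(e i)|`, so such a term is bounded by a multiple
of the differential of `w` (`IsWarpedHypersurface.sum_second_derivative_le`,
`Diagonalizes.sum_le_mul_norm`). Hopf's argument (`strong_minimum_principle`) then applies at a
minimum of `w`, and `w` is constant by connectedness.

When `w` is constant, every `i` has `κ_i = F` or `dΦ(e i) = 0`, and equality in the above forces
`∑ f_i = 1`, and `f_i = 1` whenever `dΦ(e i) ≠ 0`. As `n ≥ 2` and all `f_i` are positive, `dΦ = 0`, so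
the radius is constant (`IsSelfSimilarHypersurface.fderiv_radiusInChart`). The projection to the
fibre is then a local diffeomorphism from a compact manifold to a connected one, hence onto
(`IsSelfSimilarHypersurface.surjective_fibre`).

Three points need care. The principal curvatures are an arbitrary, possibly discontinuous, selection,
so `w` is smooth because `u` is, and the derivative of `F` is computed by first order perturbation
theory of the eigenvalues (`Diagonalizes.differentiableAt_comp`). The hypersurface
equations are derived in a moving frame in which the warped metric does not involve `lam`
(`IsHypersurfaceModel.second_derivatives`). The passage from the coordinate definition of the second
fundamental form to that frame uses only its symmetrization, which is natural under changes of
coordinates (`secondFundForm_add_eq`).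
-/

set_option maxSynthPendingDepth 3
set_option linter.unusedSectionVars false

/-! ### The strong minimum principle -/

/-- Second derivative test: at a local minimum the second derivative is positive semidefinite. -/
theorem IsLocalMin.fderiv_fderiv_nonneg {V : Type*} [NormedAddCommGroup V] [NormedSpace ℝ V]
    {w : V → ℝ} {z : V} (h : IsLocalMin w z) (hw : ContDiffAt ℝ 2 w z) (e : V) :
    0 ≤ fderiv ℝ (fderiv ℝ w) z e e := by
  by_contra! hneg
  set γ : ℝ → V := fun t => z + t • e with hγ
  have hγ0 : γ 0 = z := by simp [hγ]
  have hγd : ∀ t, HasDerivAt γ e t := fun t => by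
    simpa [hγ] using ((hasDerivAt_id t).smul_const e).const_add z
  have hγc : Tendsto γ (𝓝 0) (𝓝 z) := by
    have := (hγd 0).continuousAt.tendsto
    rwa [hγ0] at this
  have hev : ∀ᶠ y in 𝓝 z, DifferentiableAt ℝ w y := by
    filter_upwards [hw.eventually (by simp)] with y hy
    exact hy.differentiableAt (by simp)
  have hd1 : deriv (w ∘ γ) =ᶠ[𝓝 0] fun t => fderiv ℝ w (γ t) e := by
    filter_upwards [hγc.eventually hev] with t ht
    exact (ht.hasFDerivAt.comp_hasDerivAt t (hγd t)).deriv
  have hdd : DifferentiableAt ℝ (fderiv ℝ w) z :=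
    (hw.fderiv_right (m := 1) (by norm_num)).differentiableAt (by simp)
  have hd2 : deriv (deriv (w ∘ γ)) 0 = fderiv ℝ (fderiv ℝ w) z e e := by
    rw [hd1.deriv_eq]
    have h1 : HasDerivAt (fun t => fderiv ℝ w (γ t)) (fderiv ℝ (fderiv ℝ w) z e) 0 := by
      have := hdd.hasFDerivAt
      rw [← hγ0] at this
      have h2 := this.comp_hasDerivAt 0 (hγd 0)
      rwa [hγ0] at h2
    have h3 := h1.clm_apply (hasDerivAt_const (0 : ℝ) e)
    simpa using h3.deriv
  have hmin : IsLocalMin (w ∘ γ) 0 := by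
    have : ∀ᶠ t in 𝓝 (0 : ℝ), w z ≤ w (γ t) := hγc.eventually h
    filter_upwards [this] with t ht
    simpa [hγ0] using ht
  have hdz : deriv (w ∘ γ) 0 = 0 := hmin.deriv_eq_zero
  have hcont : ContinuousAt (w ∘ γ) 0 := by
    apply ContinuousAt.comp
    · rw [hγ0]; exact hw.continuousAt
    · exact (hγd 0).continuousAt
  have hmax : IsLocalMax (w ∘ γ) 0 :=
    isLocalMax_of_deriv_deriv_neg (by rw [hd2]; exact hneg) hdz hcont
  -- both a local minimum and a local maximum: locally constant along the line
  have hconst : (w ∘ γ) =ᶠ[𝓝 0] fun _ => (w ∘ γ) 0 := by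
    filter_upwards [hmin, hmax] with t h1 h2
    exact le_antisymm h2 h1
  have : deriv (deriv (w ∘ γ)) 0 = 0 := by
    rw [hconst.deriv.deriv_eq]
    simp
  rw [hd2] at this
  exact hneg.ne this

section Gaussian

variable {V : Type*} [NormedAddCommGroup V] [InnerProductSpace ℝ V]

local notation "⟪" x ", " y "⟫" => inner ℝ x y

theorem hasFDerivAt_exp_neg_mul_norm_sq (A : ℝ) (c z : V) :
    HasFDerivAt (fun y : V => Real.exp (-A * ‖y - c‖ ^ 2))
      ((-2 * A * Real.exp (-A * ‖z - c‖ ^ 2)) • innerSL ℝ (z - c)) z := by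
  have h1 : HasFDerivAt (fun y : V => ‖y - c‖ ^ 2) (2 • innerSL ℝ (z - c)) z := by
    have := ((hasFDerivAt_id (𝕜 := ℝ) z).sub_const c).norm_sq
    simpa using this
  have h2 := (h1.const_mul (-A)).exp
  convert h2 using 1
  ext e
  simp
  ring

theorem fderiv_fderiv_exp_neg_mul_norm_sq (A : ℝ) (c z e : V) :
    fderiv ℝ (fderiv ℝ (fun y : V => Real.exp (-A * ‖y - c‖ ^ 2))) z e e =
      Real.exp (-A * ‖z - c‖ ^ 2) * (4 * A ^ 2 * ⟪z - c, e⟫ ^ 2 - 2 * A * ‖e‖ ^ 2) := by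
  have h : fderiv ℝ (fun y : V => Real.exp (-A * ‖y - c‖ ^ 2)) =
      fun y => (-2 * A * Real.exp (-A * ‖y - c‖ ^ 2)) • innerSL ℝ (y - c) := by
    ext1 y; exact (hasFDerivAt_exp_neg_mul_norm_sq A c y).fderiv
  rw [h]
  have h1 := (hasFDerivAt_exp_neg_mul_norm_sq A c z).const_mul (-2 * A)
  have h2 : HasFDerivAt (fun y : V => innerSL ℝ (y - c)) (innerSL ℝ : V →L[ℝ] V →L[ℝ] ℝ) z := by
    have := (innerSL ℝ : V →L[ℝ] V →L[ℝ] ℝ).hasFDerivAt (x := z - c)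
    exact this.comp z ((hasFDerivAt_id z).sub_const c)
  rw [(h1.fun_smul h2).fderiv]
  have h3 : (innerSL ℝ : V →L[ℝ] V →L[ℝ] ℝ) e e = ‖e‖ ^ 2 := real_inner_self_eq_norm_sq e
  simp [inner_sub_left, h3]
  ring

variable [FiniteDimensional ℝ V]

/-- Hopf's strong minimum principle in local form. The elliptic operator is given at each point by
finitely many weighted directions, which only need uniform bounds. -/
theorem strong_minimum_principle {ι : Type*} [Fintype ι] {w : V → ℝ} {z₀ : V} {R C θ : ℝ}
    (hR : 0 < R) (hθ : 0 < θ) (hw : ∀ z ∈ Metric.ball z₀ R, ContDiffAt ℝ 2 w z)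
    (hpos : ∀ z ∈ Metric.ball z₀ R, 0 ≤ w z) (h0 : w z₀ = 0)
    (hL : ∀ z ∈ Metric.ball z₀ R, ∃ (a : ι → ℝ) (e : ι → V), (∀ i, 0 ≤ a i) ∧
      ∑ i, a i * ‖e i‖ ^ 2 ≤ C ∧ (∀ ξ : V, θ * ‖ξ‖ ^ 2 ≤ ∑ i, a i * ⟪ξ, e i⟫ ^ 2) ∧
      ∑ i, a i * fderiv ℝ (fderiv ℝ w) z (e i) (e i) ≤ C * ‖fderiv ℝ w z‖) :
    ∀ᶠ z in 𝓝 z₀, w z = 0 := by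
  have hC : 0 ≤ C := by
    obtain ⟨a, e, ha, hC, -⟩ := hL z₀ (Metric.mem_ball_self hR)
    exact le_trans (Finset.sum_nonneg fun i _ => mul_nonneg (ha i) (sq_nonneg _)) hC
  have hcont : ContinuousOn w (Metric.ball z₀ R) :=
    fun z hz => (hw z hz).continuousAt.continuousWithinAt
  rw [Metric.eventually_nhds_iff_ball]
  refine ⟨R / 4, by positivity, fun z' hz' => ?_⟩
  by_contra hne
  have hK0 : Metric.closedBall z₀ (R / 2) ⊆ Metric.ball z₀ R :=
    Metric.closedBall_subset_ball (by linarith)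
  -- the zero of `w` nearest to `z'`
  have hZc : IsCompact (Metric.closedBall z₀ (R / 2) ∩ w ⁻¹' {0}) := by
    refine (isCompact_closedBall z₀ (R / 2)).of_isClosed_subset ?_ inter_subset_left
    exact (hcont.mono hK0).preimage_isClosed_of_isClosed Metric.isClosed_closedBall
      isClosed_singleton
  have hz₀Z : z₀ ∈ Metric.closedBall z₀ (R / 2) ∩ w ⁻¹' {0} :=
    ⟨Metric.mem_closedBall_self (by positivity), h0⟩
  obtain ⟨p, hpZ, hpmin⟩ := hZc.exists_isMinOn ⟨z₀, hz₀Z⟩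
    (f := fun z => dist z z') (by fun_prop)
  have hpd : dist p z' < R / 4 :=
    lt_of_le_of_lt (hpmin hz₀Z) (by simpa [dist_comm] using hz')
  have hwp : w p = 0 := hpZ.2
  have hpne : p ≠ z' := by rintro rfl; exact hne hwp
  set d : ℝ := dist p z' / 2 with hd
  have hdpos : 0 < d := by have := dist_pos.2 hpne; positivity
  -- a ball around the midpoint touches the zero set at `p` only
  set c : V := midpoint ℝ p z' with hc
  have hcp : dist p c = d := by
    rw [hc, dist_left_midpoint]; simp [hd]; ring
  have hcz : dist c z' = d := by
    rw [hc, dist_midpoint_right]; simp [hd]; ring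
  have hz'z₀ : dist z' z₀ < R / 4 := hz'
  have htouch : ∀ z, dist z c ≤ d → z ≠ p → w z ≠ 0 := by
    intro z hz hzp hwz
    have h1 : dist z z' ≤ 2 * d := by
      calc dist z z' ≤ dist z c + dist c z' := dist_triangle _ _ _
        _ ≤ 2 * d := by linarith
    have hzZ : z ∈ Metric.closedBall z₀ (R / 2) ∩ w ⁻¹' {0} := by
      refine ⟨?_, hwz⟩
      have := dist_triangle z z' z₀
      simp only [Metric.mem_closedBall]; linarith
    have h2 : dist p z' ≤ dist z z' := hpmin hzZ
    have h3 : dist z z' = 2 * d := le_antisymm h1 (by linarith)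
    have h4 : dist z c = d := by
      have := dist_triangle z c z'; linarith
    apply hzp
    -- equality in the triangle inequality
    have hz2 : c = midpoint ℝ z z' := by
      apply eq_midpoint_of_dist_eq_half
      · rw [h4, h3]; ring
      · rw [hcz, h3]; ring
    rw [hc] at hz2
    have := congrArg (fun x => (2 : ℝ) • x - z') hz2
    simpa [midpoint_eq_smul_add, smul_smul] using this.symm
  have hpz₀ : dist p z₀ ≤ R / 2 := hpZ.1
  have hKsub : Metric.closedBall p (d / 2) ⊆ Metric.ball z₀ R := by
    intro z hz
    have h1 : dist z p ≤ d / 2 := hz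
    have := dist_triangle z p z₀
    simp only [Metric.mem_ball]; linarith
  -- the exponent of the barrier
  obtain ⟨A, hA0, hA⟩ : ∃ A : ℝ, 0 < A ∧ 2 * C + C * (3 * d) < A * (θ * d ^ 2) := by
    refine ⟨(2 * C + C * (3 * d) + 1) / (θ * d ^ 2), by positivity, ?_⟩
    rw [div_mul_cancel₀ _ (by positivity)]; linarith
  set v : V → ℝ := fun y => Real.exp (-A * ‖y - c‖ ^ 2) with hv
  have hvp : v p = Real.exp (-A * d ^ 2) := by
    rw [hv]; simp only; rw [← dist_eq_norm, hcp]
  have hvle : ∀ z, v z ≤ 1 := fun z => by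
    rw [hv]; apply Real.exp_le_one_iff.2; nlinarith [sq_nonneg ‖z - c‖]
  have hvsmooth : ContDiff ℝ 2 v := by
    rw [hv]
    exact Real.contDiff_exp.comp (contDiff_const.mul ((contDiff_id.sub contDiff_const).norm_sq ℝ))
  -- `w` is bounded below on the part of the sphere inside the touching ball
  obtain ⟨m, hm0, hm⟩ : ∃ m : ℝ, 0 < m ∧
      ∀ z ∈ Metric.sphere p (d / 2) ∩ Metric.closedBall c d, m ≤ w z := by
    have hcomp : IsCompact (Metric.sphere p (d / 2) ∩ Metric.closedBall c d) :=
      (isCompact_sphere p (d / 2)).inter_right Metric.isClosed_closedBall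
    rcases (Metric.sphere p (d / 2) ∩ Metric.closedBall c d).eq_empty_or_nonempty with he | hne'
    · exact ⟨1, one_pos, by simp [he]⟩
    · obtain ⟨q, hq, hqm⟩ := hcomp.exists_isMinOn hne' (hcont.mono
        (inter_subset_left.trans (Metric.sphere_subset_closedBall.trans hKsub)))
      refine ⟨w q, ?_, fun z hz => hqm hz⟩
      have hqp : q ≠ p := by
        rintro rfl
        have := hq.1; simp at this; linarith
      exact lt_of_le_of_ne (hpos q (hKsub (Metric.sphere_subset_closedBall hq.1)))
        (htouch q hq.2 hqp).symm
  set ε : ℝ := m / 2 with hε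
  have hε0 : 0 < ε := by positivity
  -- no interior local minimum of `w - ε v`
  have hnomin : ∀ z ∈ Metric.ball p (d / 2), ¬ IsLocalMin (fun y => w y - ε * v y) z := by
    intro z hz hmin
    have hzB := hKsub (Metric.ball_subset_closedBall hz)
    have hwz := hw z hzB
    have hvz : ContDiffAt ℝ 2 v z := hvsmooth.contDiffAt
    have hev : ContDiffAt ℝ 2 (fun y => w y - ε * v y) z := hwz.sub (contDiffAt_const.mul hvz)
    have hfd : ∀ y, DifferentiableAt ℝ w y →
        fderiv ℝ (fun y => w y - ε * v y) y = fderiv ℝ w y - ε • fderiv ℝ v y := by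
      intro y hy
      have hvy : DifferentiableAt ℝ v y := hvsmooth.differentiable (by simp) y
      rw [fderiv_fun_sub hy (hvy.const_mul ε), fderiv_const_mul hvy]
    have h1 : fderiv ℝ w z = ε • fderiv ℝ v z := by
      have := hmin.fderiv_eq_zero
      rw [hfd z (hwz.differentiableAt (by simp))] at this
      exact sub_eq_zero.1 this
    have h2 : ∀ e, ε * fderiv ℝ (fderiv ℝ v) z e e ≤ fderiv ℝ (fderiv ℝ w) z e e := by
      intro e
      have h3 := hmin.fderiv_fderiv_nonneg hev e
      have h4 : fderiv ℝ (fun y => w y - ε * v y) =ᶠ[𝓝 z]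
          fun y => fderiv ℝ w y - ε • fderiv ℝ v y := by
        filter_upwards [hwz.eventually (by simp)] with y hy
        exact hfd y (hy.differentiableAt (by simp))
      have hdw : DifferentiableAt ℝ (fderiv ℝ w) z :=
        (hwz.fderiv_right (m := 1) (by norm_num)).differentiableAt (by simp)
      have hdv : DifferentiableAt ℝ (fderiv ℝ v) z :=
        (hvz.fderiv_right (m := 1) (by norm_num)).differentiableAt (by simp)
      rw [h4.fderiv_eq, (hdw.hasFDerivAt.fun_sub (hdv.hasFDerivAt.fun_const_smul ε)).fderiv] at h3
      simp at h3
      linarith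
    obtain ⟨a, e, ha, haC, hell, hle⟩ := hL z hzB
    have hvpos : 0 < v z := Real.exp_pos _
    have hsum : ε * ∑ i, a i * fderiv ℝ (fderiv ℝ v) z (e i) (e i) ≤ C * (ε * ‖fderiv ℝ v z‖) := by
      calc ε * ∑ i, a i * fderiv ℝ (fderiv ℝ v) z (e i) (e i)
          = ∑ i, a i * (ε * fderiv ℝ (fderiv ℝ v) z (e i) (e i)) := by
            rw [Finset.mul_sum]; exact Finset.sum_congr rfl fun i _ => by ring
        _ ≤ ∑ i, a i * fderiv ℝ (fderiv ℝ w) z (e i) (e i) :=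
            Finset.sum_le_sum fun i _ => mul_le_mul_of_nonneg_left (h2 _) (ha i)
        _ ≤ C * ‖fderiv ℝ w z‖ := hle
        _ = C * (ε * ‖fderiv ℝ v z‖) := by
            rw [h1, norm_smul, Real.norm_of_nonneg hε0.le]
    have hsum' : ∑ i, a i * fderiv ℝ (fderiv ℝ v) z (e i) (e i) ≤ C * ‖fderiv ℝ v z‖ := by
      have : ε * ∑ i, a i * fderiv ℝ (fderiv ℝ v) z (e i) (e i) ≤ ε * (C * ‖fderiv ℝ v z‖) := by
        linarith
      exact le_of_mul_le_mul_left this hε0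
    have hnv : ‖fderiv ℝ v z‖ = 2 * A * v z * ‖z - c‖ := by
      rw [(hasFDerivAt_exp_neg_mul_norm_sq A c z).fderiv, norm_smul, innerSL_apply_norm]
      congr 1
      rw [Real.norm_eq_abs, abs_mul, abs_mul, abs_of_pos hA0, abs_of_pos hvpos]
      norm_num
    have hlow : d / 2 ≤ ‖z - c‖ := by
      rw [← dist_eq_norm]
      have := dist_triangle p z c
      rw [hcp, dist_comm p z] at this
      have : dist z p < d / 2 := hz
      linarith
    have hupp : ‖z - c‖ ≤ 3 * d / 2 := by
      rw [← dist_eq_norm]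
      have := dist_triangle z p c
      rw [hcp] at this
      have : dist z p < d / 2 := hz
      linarith
    have hsv : ∑ i, a i * fderiv ℝ (fderiv ℝ v) z (e i) (e i) =
        v z * (4 * A ^ 2 * ∑ i, a i * ⟪z - c, e i⟫ ^ 2 - 2 * A * ∑ i, a i * ‖e i‖ ^ 2) := by
      rw [Finset.mul_sum, Finset.mul_sum, ← Finset.sum_sub_distrib, Finset.mul_sum]
      refine Finset.sum_congr rfl fun i _ => ?_
      rw [hv, fderiv_fderiv_exp_neg_mul_norm_sq]; ring
    rw [hsv, hnv] at hsum'
    have h5 : θ * (d / 2) ^ 2 ≤ ∑ i, a i * ⟪z - c, e i⟫ ^ 2 :=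
      le_trans (mul_le_mul_of_nonneg_left (pow_le_pow_left₀ (by positivity) hlow 2) hθ.le)
        (hell (z - c))
    have h6 : 4 * A ^ 2 * (θ * (d / 2) ^ 2) - 2 * A * C ≤ C * (2 * A * (3 * d / 2)) := by
      have h7 : v z * (4 * A ^ 2 * (θ * (d / 2) ^ 2) - 2 * A * C) ≤
          v z * (C * (2 * A * (3 * d / 2))) := by
        calc v z * (4 * A ^ 2 * (θ * (d / 2) ^ 2) - 2 * A * C)
            ≤ v z * (4 * A ^ 2 * ∑ i, a i * ⟪z - c, e i⟫ ^ 2 - 2 * A * ∑ i, a i * ‖e i‖ ^ 2) := by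
              gcongr
          _ ≤ C * (2 * A * v z * ‖z - c‖) := hsum'
          _ = v z * (C * (2 * A * ‖z - c‖)) := by ring
          _ ≤ v z * (C * (2 * A * (3 * d / 2))) := by gcongr
      exact le_of_mul_le_mul_left h7 hvpos
    have h8 : A * (A * (θ * d ^ 2)) ≤ A * (2 * C + C * (3 * d)) := by linarith
    have := le_of_mul_le_mul_left h8 hA0
    linarith
  -- minimise `w - ε (v - v p)` over the closed ball around `p`
  obtain ⟨q, hq, hqmin⟩ := (isCompact_closedBall p (d / 2)).exists_isMinOn
    ⟨p, Metric.mem_closedBall_self (by positivity)⟩ (f := fun y => w y - ε * v y)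
    ((hcont.mono hKsub).sub (hvsmooth.continuous.continuousOn.const_smul ε))
  have hlocal : ∀ z ∈ Metric.ball p (d / 2),
      (fun y => w y - ε * v y) z ≤ (fun y => w y - ε * v y) q →
      IsLocalMin (fun y => w y - ε * v y) z := by
    intro z hz hzq
    filter_upwards [Metric.isOpen_ball.mem_nhds hz] with y hy
    exact hzq.trans (hqmin (Metric.ball_subset_closedBall hy))
  have hpball : p ∈ Metric.ball p (d / 2) := Metric.mem_ball_self (by positivity)
  by_cases hqb : q ∈ Metric.ball p (d / 2)
  · exact hnomin q hqb (hlocal q hqb le_rfl)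
  · have hqs : q ∈ Metric.sphere p (d / 2) := by
      simp only [Metric.mem_closedBall, Metric.mem_ball, not_lt, Metric.mem_sphere] at hq hqb ⊢
      exact le_antisymm hq hqb
    refine hnomin p hpball (hlocal p hpball ?_)
    simp only [hwp]
    by_cases hqc : dist q c ≤ d
    · have h1 := hm q ⟨hqs, hqc⟩
      have h2 : ε * v q ≤ ε := by nlinarith [hvle q]
      have h3 : 0 < ε * v p := mul_pos hε0 (Real.exp_pos _)
      linarith
    · push Not at hqc
      have h1 : v q ≤ v p := by
        rw [hvp]
        apply Real.exp_le_exp.2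
        have : d ^ 2 ≤ ‖q - c‖ ^ 2 := by
          rw [← dist_eq_norm]; exact pow_le_pow_left₀ hdpos.le hqc.le 2
        nlinarith
      have h2 := hpos q (hKsub hq)
      nlinarith

end Gaussian

/-! ### Perturbation of the eigenvalues of a pair of bilinear forms -/

section Eigenvalues

variable {V : Type*} [NormedAddCommGroup V] [NormedSpace ℝ V] {n : ℕ}

/-- The frame `e` is orthonormal for `a` and diagonalizes `b`, with diagonal entries `κ`. -/
def Diagonalizes (a b : V →L[ℝ] V →L[ℝ] ℝ) (κ : Fin n → ℝ) (e : Fin n → V) : Prop :=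
  ∀ i j, a (e i) (e j) = (if i = j then 1 else 0) ∧ b (e i) (e j) = (if i = j then κ i else 0)

namespace Diagonalizes

variable {a b a₁ b₁ : V →L[ℝ] V →L[ℝ] ℝ} {κ κ₁ : Fin n → ℝ} {e e₁ : Fin n → V}

theorem linearIndependent (h : Diagonalizes a b κ e) : LinearIndependent ℝ e := by
  rw [Fintype.linearIndependent_iff]
  intro c hc j
  have h1 : a (∑ i, c i • e i) (e j) = 0 := by rw [hc]; simp
  simpa [map_sum, (h _ _).1] using h1

section

variable [FiniteDimensional ℝ V] (hn : Module.finrank ℝ V = n)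
include hn

theorem exists_coeff (h : Diagonalizes a b κ e) (v : V) : ∃ c : Fin n → ℝ, v = ∑ i, c i • e i := by
  have hs : Submodule.span ℝ (Set.range e) = ⊤ :=
    h.linearIndependent.span_eq_top_of_card_eq_finrank' (by simp [hn])
  have hv : v ∈ Submodule.span ℝ (Set.range e) := by rw [hs]; trivial
  obtain ⟨c, hc⟩ := (Submodule.mem_span_range_iff_exists_fun ℝ).1 hv
  exact ⟨c, hc.symm⟩

theorem expand (h : Diagonalizes a b κ e) (v : V) : v = ∑ i, a v (e i) • e i := by
  obtain ⟨c, rfl⟩ := h.exists_coeff hn v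
  simp [map_sum, (h _ _).1]

theorem apply_right (h : Diagonalizes a b κ e) (v : V) (i : Fin n) :
    b v (e i) = κ i * a v (e i) := by
  obtain ⟨c, rfl⟩ := h.exists_coeff hn v
  simp [map_sum, (h _ _).1, (h _ _).2, mul_comm]

theorem apply_left (h : Diagonalizes a b κ e) (v : V) (i : Fin n) :
    b (e i) v = κ i * a (e i) v := by
  obtain ⟨c, rfl⟩ := h.exists_coeff hn v
  simp [map_sum, (h _ _).1, (h _ _).2, mul_comm]

theorem symm (h : Diagonalizes a b κ e) (v : V) (i : Fin n) : a (e i) v = a v (e i) := by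
  obtain ⟨c, rfl⟩ := h.exists_coeff hn v
  simp [map_sum, (h _ _).1]

theorem apply_eq_sum (h : Diagonalizes a b κ e) (v w : V) :
    a v w = ∑ i, a v (e i) * a w (e i) := by
  conv_lhs => rw [h.expand hn w]
  simp [map_sum, mul_comm]

theorem apply_self (h : Diagonalizes a b κ e) (v : V) : a v v = ∑ i, a v (e i) ^ 2 := by
  simp_rw [sq]; exact h.apply_eq_sum hn v v

theorem second_apply_self (h : Diagonalizes a b κ e) (v : V) : b v v = ∑ i, a v (e i) ^ 2 * κ i := by
  conv_lhs => rw [h.expand hn v]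
  rw [map_sum]
  refine Finset.sum_congr rfl fun i _ => ?_
  rw [← h.expand hn v, map_smul, h.apply_right hn, smul_eq_mul]
  ring

/-- Near `a₁`, the norm is controlled by the form itself. -/
theorem exists_norm_sq_le (h : Diagonalizes a₁ b₁ κ₁ e₁) :
    ∃ B > 0, ∃ η > 0, ∀ a : V →L[ℝ] V →L[ℝ] ℝ, ‖a - a₁‖ ≤ η → ∀ v, ‖v‖ ^ 2 ≤ B * a v v := by
  set K : ℝ := ∑ i, ‖e₁ i‖ ^ 2 + 1 with hK
  have hKpos : 0 < K := by positivity
  have h1 : ∀ v, ‖v‖ ^ 2 ≤ K * a₁ v v := by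
    intro v
    have h2 : ‖v‖ ≤ ∑ i, |a₁ v (e₁ i)| * ‖e₁ i‖ := by
      conv_lhs => rw [h.expand hn v]
      refine (norm_sum_le _ _).trans (le_of_eq ?_)
      simp [norm_smul]
    calc ‖v‖ ^ 2 ≤ (∑ i, |a₁ v (e₁ i)| * ‖e₁ i‖) ^ 2 := by gcongr
      _ ≤ (∑ i, |a₁ v (e₁ i)| ^ 2) * ∑ i, ‖e₁ i‖ ^ 2 := Finset.sum_mul_sq_le_sq_mul_sq _ _ _
      _ = a₁ v v * ∑ i, ‖e₁ i‖ ^ 2 := by simp [h.apply_self hn v]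
      _ ≤ K * a₁ v v := by
        rw [mul_comm]
        have : 0 ≤ a₁ v v := by rw [h.apply_self hn v]; positivity
        gcongr
        rw [hK]; linarith
  refine ⟨2 * K, by positivity, 1 / (2 * K), by positivity, fun a ha v => ?_⟩
  have h3 : a₁ v v - a v v ≤ 1 / (2 * K) * ‖v‖ ^ 2 := by
    have := (a - a₁).le_opNorm₂ v v
    rw [Real.norm_eq_abs] at this
    have h4 := neg_le_of_abs_le this
    simp only [sub_apply] at h4
    have h5 : ‖a - a₁‖ * ‖v‖ * ‖v‖ ≤ 1 / (2 * K) * ‖v‖ ^ 2 := by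
      rw [mul_assoc, ← sq]; gcongr
    linarith
  have h4 := h1 v
  have h5 : K * (a₁ v v - a v v) ≤ K * (1 / (2 * K) * ‖v‖ ^ 2) := by gcongr
  have h6 : K * (1 / (2 * K) * ‖v‖ ^ 2) = ‖v‖ ^ 2 / 2 := by field_simp
  linarith

end

end Diagonalizes

/-- A matrix with bounded entries and determinant bounded away from zero has a transversal of
entries bounded away from zero. -/
theorem Matrix.exists_perm_le_abs (W : Matrix (Fin n) (Fin n) ℝ) (hW : ∀ i j, |W i j| ≤ 2)
    (hdet : 1 / 2 ≤ |W.det|) :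
    ∃ σ : Equiv.Perm (Fin n), ∀ i, 1 / (4 * n.factorial * 2 ^ n) ≤ |W i (σ i)| := by
  by_contra! hcon
  set c : ℝ := 1 / (4 * n.factorial * 2 ^ n) with hc
  have hfac : (0 : ℝ) < n.factorial := by exact_mod_cast n.factorial_pos
  have hcpos : 0 < c := by positivity
  have h1 : ∀ σ : Equiv.Perm (Fin n), |∏ i, W i (σ i)| ≤ c * 2 ^ n := by
    intro σ
    obtain ⟨i, hi⟩ := hcon σ
    rw [Finset.abs_prod, ← Finset.mul_prod_erase _ _ (Finset.mem_univ i)]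
    refine mul_le_mul hi.le ?_ (Finset.prod_nonneg fun _ _ => abs_nonneg _) hcpos.le
    calc ∏ j ∈ Finset.univ.erase i, |W j (σ j)| ≤ ∏ j ∈ Finset.univ.erase i, (2 : ℝ) :=
          Finset.prod_le_prod (fun _ _ => abs_nonneg _) fun _ _ => hW _ _
      _ = 2 ^ (n - 1) := by simp
      _ ≤ 2 ^ n := pow_le_pow_right₀ one_le_two (Nat.sub_le _ _)
  have h2 : |W.det| ≤ n.factorial * (c * 2 ^ n) := by
    rw [← Matrix.det_transpose, Matrix.det_apply]
    refine (Finset.abs_sum_le_sum_abs _ _).trans ?_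
    have : ∀ σ ∈ (Finset.univ : Finset (Equiv.Perm (Fin n))),
        |Equiv.Perm.sign σ • ∏ i, W.transpose (σ i) i| ≤ c * 2 ^ n := by
      intro σ _
      rcases Int.units_eq_one_or (Equiv.Perm.sign σ) with h | h <;> simpa [h] using h1 σ
    refine (Finset.sum_le_card_nsmul _ _ _ this).trans (le_of_eq ?_)
    simp [Fintype.card_perm]
  have h3 : n.factorial * (c * 2 ^ n) = 1 / 4 := by
    rw [hc]; field_simp
  rw [h3] at h2
  linarith

set_option maxHeartbeats 1000000 in
/-- First order perturbation theory for a simultaneously diagonalized pair `(a₁, b₁)`: after a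
permutation, the eigenvalues of a nearby pair `(a, b)` are close to those of `(a₁, b₁)`, and weighted
sums whose weights agree on equal eigenvalues are given to first order by the diagonal entries of
`b - κ₁ a`. -/
theorem Diagonalizes.exists_perturbation [FiniteDimensional ℝ V] (hn : Module.finrank ℝ V = n)
    {a₁ b₁ : V →L[ℝ] V →L[ℝ] ℝ} {κ₁ : Fin n → ℝ} {e₁ : Fin n → V}
    (h₁ : Diagonalizes a₁ b₁ κ₁ e₁) (φ : Fin n → ℝ) (hφ : ∀ i j, κ₁ i = κ₁ j → φ i = φ j) :
    ∃ C > 0, ∃ η > 0, ∀ (a b : V →L[ℝ] V →L[ℝ] ℝ) (κ : Fin n → ℝ) (e : Fin n → V),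
      Diagonalizes a b κ e → ‖a - a₁‖ + ‖b - b₁‖ ≤ η → ∃ σ : Equiv.Perm (Fin n),
        (∀ i, |κ (σ i) - κ₁ i| ≤ C * (‖a - a₁‖ + ‖b - b₁‖)) ∧
        |∑ i, φ i * (κ (σ i) - κ₁ i) - ∑ i, φ i * (b (e₁ i) (e₁ i) - κ₁ i * a (e₁ i) (e₁ i))| ≤
          C * (‖a - a₁‖ + ‖b - b₁‖) ^ 2 := by
  obtain ⟨B, hB, η₀, hη₀, hbound⟩ := h₁.exists_norm_sq_le hn
  -- a common bound for all frame vectors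
  obtain ⟨K, hK⟩ : ∃ x : ℝ, x = 1 + B + ∑ i, ‖e₁ i‖ := ⟨_, rfl⟩
  have hK1 : 1 ≤ K := by
    have : 0 ≤ ∑ i, ‖e₁ i‖ := Finset.sum_nonneg fun _ _ => norm_nonneg _
    linarith
  have he₁K : ∀ i, ‖e₁ i‖ ≤ K := fun i => by
    have : ‖e₁ i‖ ≤ ∑ i, ‖e₁ i‖ := Finset.single_le_sum (f := fun i => ‖e₁ i‖)
      (fun _ _ => norm_nonneg _) (Finset.mem_univ i)
    linarith
  -- the frame `e₁` stays nondegenerate for nearby forms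
  obtain ⟨η₁, hη₁, hdet⟩ : ∃ η₁ > 0, ∀ a : V →L[ℝ] V →L[ℝ] ℝ, ‖a - a₁‖ < η₁ →
      1 / 2 < (Matrix.of fun i j => a (e₁ i) (e₁ j)).det := by
    have hc : Continuous fun a : V →L[ℝ] V →L[ℝ] ℝ =>
        (Matrix.of fun i j => a (e₁ i) (e₁ j)).det := by
      apply Continuous.matrix_det
      apply continuous_matrix
      intro i j; simp only [Matrix.of_apply]; fun_prop
    have h1 : (Matrix.of fun i j => a₁ (e₁ i) (e₁ j)) = 1 := by
      ext i j; simp [(h₁ i j).1, Matrix.one_apply]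
    have h2 : ∀ᶠ a in 𝓝 a₁, 1 / 2 < (Matrix.of fun i j => a (e₁ i) (e₁ j)).det := by
      apply hc.continuousAt.eventually_const_lt
      simp only [h1]; norm_num
    obtain ⟨η₁, hη₁, h3⟩ := (Metric.eventually_nhds_iff (α := V →L[ℝ] V →L[ℝ] ℝ)).1 h2
    exact ⟨η₁, hη₁, fun a ha => h3 ((dist_eq_norm (E := V →L[ℝ] V →L[ℝ] ℝ) a a₁).trans_lt ha)⟩
  -- distinct eigenvalues are separated by a gap
  obtain ⟨gap, hgap, hgap'⟩ : ∃ gap > 0, ∀ i j, κ₁ i ≠ κ₁ j → gap ≤ |κ₁ i - κ₁ j| := by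
    by_cases hne : (Finset.univ.filter fun p : Fin n × Fin n => κ₁ p.1 ≠ κ₁ p.2).Nonempty
    · obtain ⟨p, hp, hmin⟩ := Finset.exists_min_image _ (fun p => |κ₁ p.1 - κ₁ p.2|) hne
      refine ⟨|κ₁ p.1 - κ₁ p.2|, abs_pos.2 (sub_ne_zero.2 (Finset.mem_filter.1 hp).2), ?_⟩
      intro i j hij
      exact hmin (i, j) (by simpa using hij)
    · refine ⟨1, one_pos, fun i j hij => (hne ⟨(i, j), by simpa using hij⟩).elim⟩
  obtain ⟨c₀, hc₀⟩ : ∃ x : ℝ, x = 1 / (4 * n.factorial * 2 ^ n) := ⟨_, rfl⟩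
  have hc₀pos : 0 < c₀ := by
    rw [hc₀]
    have : (0 : ℝ) < n.factorial := by exact_mod_cast n.factorial_pos
    positivity
  obtain ⟨C₁, hC₁⟩ : ∃ x : ℝ, x = (1 + ∑ i, |κ₁ i|) * K ^ 2 := ⟨_, rfl⟩
  have hsumκ : 0 ≤ ∑ i, |κ₁ i| := Finset.sum_nonneg fun _ _ => abs_nonneg _
  have hC₁pos : 0 < C₁ := by rw [hC₁]; positivity
  obtain ⟨C₂, hC₂⟩ : ∃ x : ℝ, x = C₁ / c₀ := ⟨_, rfl⟩
  have hC₂pos : 0 < C₂ := by rw [hC₂]; positivity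
  obtain ⟨Φ, hΦ⟩ : ∃ x : ℝ, x = ∑ i, |φ i| := ⟨_, rfl⟩
  have hΦ0 : 0 ≤ Φ := hΦ ▸ Finset.sum_nonneg fun _ _ => abs_nonneg _
  have hφΦ : ∀ i, |φ i| ≤ Φ := fun i => hΦ ▸
    Finset.single_le_sum (f := fun i => |φ i|) (fun _ _ => abs_nonneg _) (Finset.mem_univ i)
  obtain ⟨C₃, hC₃⟩ : ∃ x : ℝ, x = 2 * C₁ / gap := ⟨_, rfl⟩
  have hC₃pos : 0 < C₃ := by rw [hC₃]; positivity
  obtain ⟨C₄, hC₄⟩ : ∃ x : ℝ, x = C₃ * C₁ + C₃ ^ 2 * C₂ := ⟨_, rfl⟩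
  have hC₄0 : 0 ≤ C₄ := by rw [hC₄]; positivity
  obtain ⟨C₅, hC₅⟩ : ∃ x : ℝ, x = n * (K ^ 2 * ((2 * ‖a₁‖ + 1) * K ^ 2)) + K ^ 2 := ⟨_, rfl⟩
  have hC₅pos : 0 < C₅ := by rw [hC₅]; positivity
  refine ⟨C₂ + (n * (n * (Φ * C₄)) + n * (Φ * C₂ * C₅)), by positivity,
    min (min η₀ (η₁ / 2)) (min (1 / K ^ 2) (min 1 (gap / (2 * C₂)))), by positivity, ?_⟩
  intro a b κ e h hδ
  obtain ⟨δ, hδdef⟩ : ∃ x : ℝ, x = ‖a - a₁‖ + ‖b - b₁‖ := ⟨_, rfl⟩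
  rw [← hδdef] at hδ ⊢
  have hδ0 : 0 ≤ δ := by rw [hδdef]; positivity
  simp only [le_min_iff] at hδ
  obtain ⟨⟨hδη₀, hδη₁⟩, hδK, hδ1, hδgap⟩ := hδ
  have haδ : ‖a - a₁‖ ≤ δ := by have := norm_nonneg (b - b₁); linarith
  have hbδ : ‖b - b₁‖ ≤ δ := by have := norm_nonneg (a - a₁); linarith
  have heK : ∀ i, ‖e i‖ ≤ K := by
    intro i
    have h1 := hbound a (haδ.trans hδη₀) (e i)
    rw [(h i i).1, if_pos rfl, mul_one] at h1
    have h2 : B ≤ (1 + B) ^ 2 := by nlinarith [sq_nonneg B]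
    have h3 : ‖e i‖ ≤ 1 + B := abs_le_of_sq_le_sq' (h1.trans h2) (by positivity) |>.2
    have : 0 ≤ ∑ i, ‖e₁ i‖ := Finset.sum_nonneg fun _ _ => norm_nonneg _
    linarith
  have hdiff : ∀ (q : V →L[ℝ] V →L[ℝ] ℝ) (v w : V), ‖q‖ ≤ δ → ‖v‖ ≤ K → ‖w‖ ≤ K →
      |q v w| ≤ δ * K ^ 2 := by
    intro q v w hq hv hw
    calc |q v w| ≤ ‖q‖ * ‖v‖ * ‖w‖ := q.le_opNorm₂ v w
      _ ≤ δ * K * K := by gcongr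
      _ = δ * K ^ 2 := by ring
  -- `W` expresses `e₁` in the frame `e`; its rows are bounded, and `W * Wᵀ` is the Gram matrix of `e₁`
  set W : Matrix (Fin n) (Fin n) ℝ := Matrix.of fun i l => a (e₁ i) (e l) with hW
  have hWapp : ∀ i l, W i l = a (e₁ i) (e l) := fun _ _ => rfl
  have hWrow : ∀ i, ∑ l, W i l ^ 2 = a (e₁ i) (e₁ i) := fun i => (h.apply_self hn (e₁ i)).symm
  have hW2 : ∀ i l, |W i l| ≤ 2 := by
    intro i l
    have h1 : W i l ^ 2 ≤ ∑ l, W i l ^ 2 :=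
      Finset.single_le_sum (f := fun l => W i l ^ 2) (fun _ _ => sq_nonneg _) (Finset.mem_univ l)
    have h2 := le_of_abs_le (hdiff (a - a₁) (e₁ i) (e₁ i) haδ (he₁K i) (he₁K i))
    have h3 : δ * K ^ 2 ≤ 1 := by rwa [le_div_iff₀ (by positivity)] at hδK
    rw [hWrow] at h1
    simp only [sub_apply, (h₁ i i).1, if_true] at h2
    exact abs_le_of_sq_le_sq (by linarith) (by norm_num)
  have hWdet : 1 / 2 ≤ |W.det| := by
    have h1 := hdet a (by linarith)
    have h2 : (Matrix.of fun i j => a (e₁ i) (e₁ j)) = W * W.transpose := by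
      ext i j
      simp only [Matrix.of_apply, Matrix.mul_apply, Matrix.transpose_apply, hWapp]
      exact h.apply_eq_sum hn _ _
    rw [h2, Matrix.det_mul, Matrix.det_transpose, ← abs_mul_abs_self] at h1
    by_contra! hlt
    have := mul_lt_mul'' hlt hlt (abs_nonneg _) (abs_nonneg _)
    linarith
  obtain ⟨σ, hσ⟩ := W.exists_perm_le_abs hW2 hWdet
  rw [← hc₀] at hσ
  -- the off-diagonal estimate
  have hoff : ∀ i l, |W i l| * |κ l - κ₁ i| ≤ C₁ * δ := by
    intro i l
    have h1 : W i l * (κ l - κ₁ i) =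
        (b - b₁) (e₁ i) (e l) - κ₁ i * (a - a₁) (e₁ i) (e l) := by
      simp only [sub_apply, h.apply_right hn, h₁.apply_left hn, hWapp]
      ring
    rw [← abs_mul, h1]
    have h2 := hdiff _ _ _ hbδ (he₁K i) (heK l)
    have h3 := hdiff _ _ _ haδ (he₁K i) (heK l)
    have h4 : |κ₁ i| ≤ ∑ i, |κ₁ i| :=
      Finset.single_le_sum (f := fun i => |κ₁ i|) (fun _ _ => abs_nonneg _) (Finset.mem_univ i)
    calc _ ≤ |(b - b₁) (e₁ i) (e l)| + |κ₁ i * (a - a₁) (e₁ i) (e l)| := abs_sub _ _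
      _ ≤ δ * K ^ 2 + (∑ i, |κ₁ i|) * (δ * K ^ 2) := by rw [abs_mul]; gcongr
      _ = C₁ * δ := by rw [hC₁]; ring
  have hclose : ∀ i, |κ (σ i) - κ₁ i| ≤ C₂ * δ := by
    intro i
    have h1 : c₀ * |κ (σ i) - κ₁ i| ≤ C₁ * δ :=
      le_trans (mul_le_mul_of_nonneg_right (hσ i) (abs_nonneg _)) (hoff i (σ i))
    rw [hC₂, div_mul_eq_mul_div, le_div_iff₀ hc₀pos]; linarith
  -- entries joining different eigenvalues are of first order
  have hWoff : ∀ i l, κ₁ i ≠ κ₁ l → |W i (σ l)| ≤ C₃ * δ := by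
    intro i l hil
    have h1 := hoff i (σ l)
    have h2 : gap / 2 ≤ |κ (σ l) - κ₁ i| := by
      have h3 := hgap' i l hil
      have h4 : C₂ * δ ≤ gap / 2 := by
        rw [le_div_iff₀ (by positivity)] at hδgap; linarith
      have h5 := hclose l
      have h6 : |κ₁ i - κ₁ l| ≤ |κ (σ l) - κ₁ i| + |κ (σ l) - κ₁ l| := by
        rw [abs_sub_comm (κ (σ l)) (κ₁ i)]; exact abs_sub_le _ _ _
      linarith
    have h3 : |W i (σ l)| * (gap / 2) ≤ C₁ * δ :=
      le_trans (mul_le_mul_of_nonneg_left h2 (abs_nonneg _)) h1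
    rw [hC₃, div_mul_eq_mul_div, le_div_iff₀ hgap]; linarith
  -- the columns have unit length up to first order
  have hcol : ∀ l, |∑ i, W i (σ l) ^ 2 - 1| ≤ C₅ * δ := by
    intro l
    have h1 : (1 : ℝ) = ∑ i, a₁ (e₁ i) (e (σ l)) ^ 2 + (a - a₁) (e (σ l)) (e (σ l)) := by
      have h2 := h₁.apply_self hn (e (σ l))
      simp_rw [h₁.symm hn]
      rw [← h2, sub_apply, sub_apply,
        (h (σ l) (σ l)).1]
      simp
    conv_lhs => rw [h1]
    rw [← sub_sub, ← Finset.sum_sub_distrib]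
    have h3 : ∀ i, |W i (σ l) ^ 2 - a₁ (e₁ i) (e (σ l)) ^ 2| ≤
        K ^ 2 * ((2 * ‖a₁‖ + 1) * K ^ 2) * δ := by
      intro i
      have h4 : W i (σ l) ^ 2 - a₁ (e₁ i) (e (σ l)) ^ 2 = (a - a₁) (e₁ i) (e (σ l)) *
          ((a - a₁) (e₁ i) (e (σ l)) + 2 * a₁ (e₁ i) (e (σ l))) := by
        simp only [hWapp, sub_apply]; ring
      have h5 := hdiff _ _ _ haδ (he₁K i) (heK (σ l))
      have h6 : |a₁ (e₁ i) (e (σ l))| ≤ ‖a₁‖ * K * K :=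
        (a₁.le_opNorm₂ _ _).trans (by gcongr; exacts [he₁K i, heK _])
      rw [h4, abs_mul]
      calc _ ≤ δ * K ^ 2 * (|(a - a₁) (e₁ i) (e (σ l))| + |2 * a₁ (e₁ i) (e (σ l))|) := by
            gcongr; exact abs_add_le _ _
        _ ≤ δ * K ^ 2 * (1 * K ^ 2 + 2 * (‖a₁‖ * K * K)) := by
            rw [abs_mul, abs_two]
            gcongr
            exact h5.trans (by gcongr)
        _ = _ := by ring
    calc _ ≤ |∑ i, (W i (σ l) ^ 2 - a₁ (e₁ i) (e (σ l)) ^ 2)| +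
          |(a - a₁) (e (σ l)) (e (σ l))| := abs_sub _ _
      _ ≤ ∑ i : Fin n, K ^ 2 * ((2 * ‖a₁‖ + 1) * K ^ 2) * δ + δ * K ^ 2 := by
          refine add_le_add ((Finset.abs_sum_le_sum_abs _ _).trans
            (Finset.sum_le_sum fun i _ => h3 i)) (hdiff _ _ _ haδ (heK _) (heK _))
      _ = C₅ * δ := by rw [Finset.sum_const]; simp [hC₅]; ring
  refine ⟨σ, fun i => (hclose i).trans ?_, ?_⟩
  · have : 0 ≤ (n * (n * (Φ * C₄)) + n * (Φ * C₂ * C₅)) * δ := by positivity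
    linarith
  have hdiag : ∀ i, b (e₁ i) (e₁ i) - κ₁ i * a (e₁ i) (e₁ i) =
      ∑ l, W i (σ l) ^ 2 * (κ (σ l) - κ₁ i) := by
    intro i
    rw [Equiv.sum_comp σ fun l => W i l ^ 2 * (κ l - κ₁ i), h.second_apply_self hn, ← hWrow,
      Finset.mul_sum, ← Finset.sum_sub_distrib]
    exact Finset.sum_congr rfl fun l _ => by rw [hWapp]; ring
  -- for equal eigenvalues the weights agree and the terms cancel; otherwise two factors are of first
  -- order
  have hterm : ∀ i l, |φ i * (W i (σ l) ^ 2 * (κ (σ l) - κ₁ i)) -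
      φ l * (W i (σ l) ^ 2 * (κ (σ l) - κ₁ l))| ≤ Φ * C₄ * δ ^ 2 := by
    intro i l
    by_cases hil : κ₁ i = κ₁ l
    · rw [hφ i l hil, hil]; simp; positivity
    · have h1 : W i (σ l) ^ 2 * |κ (σ l) - κ₁ i| ≤ C₃ * C₁ * δ ^ 2 := by
        rw [← sq_abs]
        calc |W i (σ l)| ^ 2 * |κ (σ l) - κ₁ i| =
              |W i (σ l)| * (|W i (σ l)| * |κ (σ l) - κ₁ i|) := by ring
          _ ≤ (C₃ * δ) * (C₁ * δ) := by
              exact mul_le_mul (hWoff i l hil) (hoff i (σ l)) (by positivity) (by positivity)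
          _ = _ := by ring
      have h2 : W i (σ l) ^ 2 * |κ (σ l) - κ₁ l| ≤ C₃ ^ 2 * C₂ * δ ^ 2 := by
        rw [← sq_abs]
        calc |W i (σ l)| ^ 2 * |κ (σ l) - κ₁ l| ≤ (C₃ * δ) ^ 2 * (C₂ * 1) := by
              gcongr
              · exact hWoff i l hil
              · exact (hclose l).trans (by gcongr)
          _ = _ := by ring
      calc _ ≤ |φ i * (W i (σ l) ^ 2 * (κ (σ l) - κ₁ i))| +
            |φ l * (W i (σ l) ^ 2 * (κ (σ l) - κ₁ l))| := abs_sub _ _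
        _ = |φ i| * (W i (σ l) ^ 2 * |κ (σ l) - κ₁ i|) +
            |φ l| * (W i (σ l) ^ 2 * |κ (σ l) - κ₁ l|) := by
            simp only [abs_mul, abs_pow, sq_abs]
        _ ≤ Φ * (C₃ * C₁ * δ ^ 2) + Φ * (C₃ ^ 2 * C₂ * δ ^ 2) := by
            gcongr <;> exact hφΦ _
        _ = _ := by rw [hC₄]; ring
  have hkey : ∑ i, φ i * (κ (σ i) - κ₁ i) -
      ∑ i, φ i * (b (e₁ i) (e₁ i) - κ₁ i * a (e₁ i) (e₁ i)) =
      -(∑ i, ∑ l, (φ i * (W i (σ l) ^ 2 * (κ (σ l) - κ₁ i)) -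
        φ l * (W i (σ l) ^ 2 * (κ (σ l) - κ₁ l)))) -
      ∑ l, φ l * (κ (σ l) - κ₁ l) * (∑ i, W i (σ l) ^ 2 - 1) := by
    have h1 : ∑ i, ∑ l, (φ i * (W i (σ l) ^ 2 * (κ (σ l) - κ₁ i)) -
        φ l * (W i (σ l) ^ 2 * (κ (σ l) - κ₁ l))) =
        ∑ i, φ i * (b (e₁ i) (e₁ i) - κ₁ i * a (e₁ i) (e₁ i)) -
        ∑ l, φ l * (κ (σ l) - κ₁ l) * ∑ i, W i (σ l) ^ 2 := by
      simp_rw [Finset.sum_sub_distrib, hdiag, Finset.mul_sum]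
      congr 1
      rw [Finset.sum_comm]
      exact Finset.sum_congr rfl fun l _ => Finset.sum_congr rfl fun i _ => by ring
    have h2 : ∑ l, φ l * (κ (σ l) - κ₁ l) * (∑ i, W i (σ l) ^ 2 - 1) =
        ∑ l, φ l * (κ (σ l) - κ₁ l) * ∑ i, W i (σ l) ^ 2 - ∑ l, φ l * (κ (σ l) - κ₁ l) := by
      rw [← Finset.sum_sub_distrib]
      exact Finset.sum_congr rfl fun l _ => by ring
    rw [h1, h2]; ring
  rw [hkey]
  calc _ ≤ |∑ i, ∑ l, (φ i * (W i (σ l) ^ 2 * (κ (σ l) - κ₁ i)) -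
        φ l * (W i (σ l) ^ 2 * (κ (σ l) - κ₁ l)))| +
        |∑ l, φ l * (κ (σ l) - κ₁ l) * (∑ i, W i (σ l) ^ 2 - 1)| := by
        rw [← abs_neg (∑ i, ∑ l, _)]; exact abs_sub _ _
    _ ≤ ∑ i : Fin n, ∑ l : Fin n, Φ * C₄ * δ ^ 2 + ∑ l : Fin n, Φ * (C₂ * δ) * (C₅ * δ) := by
        refine add_le_add ?_ ?_
        · refine (Finset.abs_sum_le_sum_abs _ _).trans (Finset.sum_le_sum fun i _ => ?_)
          exact (Finset.abs_sum_le_sum_abs _ _).trans (Finset.sum_le_sum fun l _ => hterm i l)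
        · refine (Finset.abs_sum_le_sum_abs _ _).trans (Finset.sum_le_sum fun l _ => ?_)
          rw [abs_mul, abs_mul]
          gcongr
          exacts [hφΦ l, hclose l, hcol l]
    _ = (n * (n * (Φ * C₄)) + n * (Φ * C₂ * C₅)) * δ ^ 2 := by
        simp only [Finset.sum_const, Finset.card_univ, Fintype.card_fin, nsmul_eq_mul]; ring
    _ ≤ _ := by
        have : 0 ≤ C₂ * δ ^ 2 := by positivity
        linarith

/-- The eigenvalues of a continuous pair of forms stay close, up to order, to the eigenvalues at a
point. -/
theorem Diagonalizes.eventually_exists_perm [FiniteDimensional ℝ V] (hn : Module.finrank ℝ V = n)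
    {Z : Type*} [TopologicalSpace Z] {a b : Z → V →L[ℝ] V →L[ℝ] ℝ} {κ : Z → Fin n → ℝ}
    {e : Z → Fin n → V} {z₁ : Z} (h : ∀ᶠ z in 𝓝 z₁, Diagonalizes (a z) (b z) (κ z) (e z))
    (ha : ContinuousAt a z₁) (hb : ContinuousAt b z₁) {S : Set (Fin n → ℝ)}
    (hS : S ∈ 𝓝 (κ z₁)) :
    ∀ᶠ z in 𝓝 z₁, ∃ σ : Equiv.Perm (Fin n), κ z ∘ σ ∈ S := by
  obtain ⟨C, hC, η, hη, hpert⟩ := h.self_of_nhds.exists_perturbation hn (fun _ => 0)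
    fun _ _ _ => rfl
  obtain ⟨ε, hε, hεS⟩ := Metric.mem_nhds_iff.1 hS
  have hδ : Tendsto (fun z => ‖a z - a z₁‖ + ‖b z - b z₁‖) (𝓝 z₁) (𝓝 0) := by
    have h1 := ((ha.tendsto.sub_const (a z₁)).norm).add ((hb.tendsto.sub_const (b z₁)).norm)
    simpa using h1
  filter_upwards [h, hδ.eventually_lt_const hη, hδ.eventually_lt_const (div_pos hε hC)]
    with z hz hz1 hz2
  obtain ⟨σ, hσ, -⟩ := hpert _ _ _ _ hz hz1.le
  refine ⟨σ, hεS ?_⟩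
  rw [Metric.mem_ball, dist_pi_lt_iff hε]
  intro i
  rw [lt_div_iff₀ hC] at hz2
  exact (hσ i).trans_lt (by linarith)

/-- Derivative of a symmetric function of the eigenvalues: to first order, only the diagonal entries
in the eigenframe matter. -/
theorem Diagonalizes.differentiableAt_comp [FiniteDimensional ℝ V] (hn : Module.finrank ℝ V = n)
    {Z : Type*} [NormedAddCommGroup Z] [NormedSpace ℝ Z] {a b : Z → V →L[ℝ] V →L[ℝ] ℝ}
    {κ : Z → Fin n → ℝ} {e : Z → Fin n → V} {z₁ : Z}
    (h : ∀ᶠ z in 𝓝 z₁, Diagonalizes (a z) (b z) (κ z) (e z))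
    (ha : DifferentiableAt ℝ a z₁) (hb : DifferentiableAt ℝ b z₁) {f : (Fin n → ℝ) → ℝ}
    (hf : DifferentiableAt ℝ f (κ z₁))
    (hsymm : ∀ᶠ z in 𝓝 z₁, ∀ σ : Equiv.Perm (Fin n), f (κ z ∘ σ) = f (κ z))
    (hφ : ∀ i j, κ z₁ i = κ z₁ j → partialDeriv f i (κ z₁) = partialDeriv f j (κ z₁)) :
    DifferentiableAt ℝ (fun z => f (κ z)) z₁ ∧ ∀ v, fderiv ℝ (fun z => f (κ z)) z₁ v =
      ∑ i, partialDeriv f i (κ z₁) * (fderiv ℝ b z₁ v (e z₁ i) (e z₁ i) -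
        κ z₁ i * fderiv ℝ a z₁ v (e z₁ i) (e z₁ i)) := by
  have h₁ := h.self_of_nhds
  obtain ⟨C, hC, η, hη, hpert⟩ := h₁.exists_perturbation hn (fun i => partialDeriv f i (κ z₁)) hφ
  set φ : Fin n → ℝ := fun i => partialDeriv f i (κ z₁) with hφdef
  set δ : Z → ℝ := fun z => ‖a z - a z₁‖ + ‖b z - b z₁‖ with hδdef
  have hδO : δ =O[𝓝 z₁] fun z => z - z₁ :=
    (ha.hasFDerivAt.isBigO_sub.norm_left).add (hb.hasFDerivAt.isBigO_sub.norm_left)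
  have hδ0 : Tendsto δ (𝓝 z₁) (𝓝 0) :=
    hδO.trans_tendsto (by simpa using (tendsto_id (α := Z) (x := 𝓝 z₁)).sub_const z₁)
  have hq : HasFDerivAt (fun z => ∑ i, φ i * (b z (e z₁ i) (e z₁ i) -
      κ z₁ i * a z (e z₁ i) (e z₁ i)))
      (∑ i, φ i • (((fderiv ℝ b z₁).flip (e z₁ i)).flip (e z₁ i) -
        κ z₁ i • ((fderiv ℝ a z₁).flip (e z₁ i)).flip (e z₁ i))) z₁ := by
    have hev : ∀ (q : Z → V →L[ℝ] V →L[ℝ] ℝ) (v : V), DifferentiableAt ℝ q z₁ →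
        HasFDerivAt (fun z => q z v v) (((fderiv ℝ q z₁).flip v).flip v) z₁ := by
      intro q v hq
      have h1 := (hq.hasFDerivAt.clm_apply (hasFDerivAt_const v z₁)).clm_apply
        (hasFDerivAt_const v z₁)
      refine h1.congr_fderiv ?_
      ext w; simp
    refine HasFDerivAt.fun_sum fun i _ => ?_
    exact ((hev b _ hb).sub ((hev a _ ha).const_mul _)).const_mul _
  have hmain : HasFDerivAt (fun z => f (κ z))
      (∑ i, φ i • (((fderiv ℝ b z₁).flip (e z₁ i)).flip (e z₁ i) -
        κ z₁ i • ((fderiv ℝ a z₁).flip (e z₁ i)).flip (e z₁ i))) z₁ := by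
    rw [hasFDerivAt_iff_isLittleO] at hq ⊢
    have hq1 : ∑ i, φ i * (b z₁ (e z₁ i) (e z₁ i) - κ z₁ i * a z₁ (e z₁ i) (e z₁ i)) = 0 :=
      Finset.sum_eq_zero fun i _ => by simp [(h₁ i i).1, (h₁ i i).2]
    rw [hq1] at hq
    -- it remains to compare `f ∘ κ` with the diagonal entries
    have hrem : (fun z => f (κ z) - f (κ z₁) - ∑ i, φ i * (b z (e z₁ i) (e z₁ i) -
        κ z₁ i * a z (e z₁ i) (e z₁ i))) =o[𝓝 z₁] fun z => z - z₁ := by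
      rw [Asymptotics.isLittleO_iff]
      intro ε hε
      obtain ⟨M, hM, hδM⟩ := hδO.exists_pos
      rw [Asymptotics.isBigOWith_iff] at hδM
      have hf' := hf.hasFDerivAt
      rw [hasFDerivAt_iff_isLittleO, Asymptotics.isLittleO_iff] at hf'
      have hε1 : 0 < ε / (2 * C * M) := by positivity
      obtain ⟨r, hr, hfr⟩ := Metric.eventually_nhds_iff.1 (hf' hε1)
      filter_upwards [h, hsymm, hδM, hδ0.eventually_lt_const hη,
        hδ0.eventually_lt_const (div_pos hr hC), hδ0.eventually_lt_const hε1] with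
        z hz hzs hzM hzη hzr hzε
      obtain ⟨σ, hσ1, hσ2⟩ := hpert _ _ _ _ hz hzη.le
      have hδz : ‖a z - a z₁‖ + ‖b z - b z₁‖ = δ z := rfl
      rw [hδz] at hσ1 hσ2
      have hδz0 : 0 ≤ δ z := by positivity
      rw [Real.norm_of_nonneg hδz0] at hzM
      have hdist : ‖κ z ∘ σ - κ z₁‖ ≤ C * δ z :=
        (pi_norm_le_iff_of_nonneg (by positivity)).2 fun i => hσ1 i
      have h3 : ‖f (κ z ∘ σ) - f (κ z₁) - fderiv ℝ f (κ z₁) (κ z ∘ σ - κ z₁)‖ ≤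
          ε / (2 * C * M) * ‖κ z ∘ σ - κ z₁‖ := by
        apply hfr
        rw [dist_eq_norm]
        rw [lt_div_iff₀ hC] at hzr
        linarith
      have h4 : fderiv ℝ f (κ z₁) (κ z ∘ σ - κ z₁) = ∑ i, φ i * (κ z (σ i) - κ z₁ i) := by
        conv_lhs => rw [← Finset.univ_sum_single (κ z ∘ σ - κ z₁)]
        rw [map_sum]
        refine Finset.sum_congr rfl fun i _ => ?_
        have : (Pi.single i ((κ z ∘ σ - κ z₁) i) : Fin n → ℝ) =
            ((κ z ∘ σ - κ z₁) i) • Pi.single i (1 : ℝ) := by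
          rw [← Pi.single_smul]; simp
        rw [this, map_smul, smul_eq_mul, mul_comm]
        rfl
      rw [hzs σ, h4, Real.norm_eq_abs] at h3
      rw [Real.norm_eq_abs]
      calc _ ≤ |f (κ z) - f (κ z₁) - ∑ i, φ i * (κ z (σ i) - κ z₁ i)| +
            |∑ i, φ i * (κ z (σ i) - κ z₁ i) - ∑ i, φ i * (b z (e z₁ i) (e z₁ i) -
              κ z₁ i * a z (e z₁ i) (e z₁ i))| := abs_sub_le _ _ _
        _ ≤ ε / (2 * C * M) * (C * δ z) + C * δ z ^ 2 := by
            refine add_le_add (h3.trans ?_) hσ2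
            gcongr
        _ ≤ ε / (2 * C * M) * (C * δ z) + C * (ε / (2 * C * M) * δ z) := by
            rw [sq]; gcongr
        _ = ε / M * δ z := by field_simp; ring
        _ ≤ ε / M * (M * ‖z - z₁‖) := by gcongr
        _ = ε * ‖z - z₁‖ := by field_simp
    refine (hrem.add hq).congr_left fun z => ?_
    ring
  refine ⟨hmain.differentiableAt, fun v => ?_⟩
  rw [hmain.fderiv]
  simp [φ]

end Eigenvalues

/-! ### Symmetric homogeneous functions -/

section CurvatureFunction

variable {n : ℕ} {Γ : Set (Fin n → ℝ)} {f : (Fin n → ℝ) → ℝ}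

theorem IsCurvatureFunction.differentiableAt (hΓ : IsAdmissibleCone Γ)
    (hf : IsCurvatureFunction Γ f) {k : Fin n → ℝ} (hk : k ∈ Γ) : DifferentiableAt ℝ f k :=
  (hf.smooth.contDiffAt (hΓ.isOpen.mem_nhds hk)).differentiableAt (by simp)

theorem IsCurvatureFunction.partialDeriv_comp_perm (hΓ : IsAdmissibleCone Γ)
    (hf : IsCurvatureFunction Γ f) {k : Fin n → ℝ} (hk : k ∈ Γ) (σ : Equiv.Perm (Fin n))
    (i : Fin n) : partialDeriv f i (k ∘ σ) = partialDeriv f (σ i) k := by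
  set P : (Fin n → ℝ) →L[ℝ] (Fin n → ℝ) := (LinearMap.funLeft ℝ ℝ σ).toContinuousLinearMap with hP
  have hPk : ∀ k, P k = k ∘ σ := fun k => rfl
  have h1 : HasFDerivAt (f ∘ P) ((fderiv ℝ f (k ∘ σ)).comp P) k :=
    (hf.differentiableAt hΓ (hΓ.perm_mem σ k hk)).hasFDerivAt.comp k P.hasFDerivAt
  have h2 : f ∘ P =ᶠ[𝓝 k] f := by
    filter_upwards [hΓ.isOpen.mem_nhds hk] with y hy
    exact hf.symmetric σ y hy
  have h3 := h2.fderiv_eq (𝕜 := ℝ)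
  rw [h1.fderiv] at h3
  have h4 : P (Pi.single (σ i) (1 : ℝ)) = Pi.single i (1 : ℝ) := by
    ext j
    rw [hPk]
    simp [Pi.single_apply]
  rw [partialDeriv, partialDeriv, ← h3, ← h4]
  rfl

/-- By symmetry, the partial derivatives agree where the arguments do. -/
theorem IsCurvatureFunction.partialDeriv_eq (hΓ : IsAdmissibleCone Γ)
    (hf : IsCurvatureFunction Γ f) {k : Fin n → ℝ} (hk : k ∈ Γ) (i j : Fin n) (hij : k i = k j) :
    partialDeriv f i k = partialDeriv f j k := by
  have h1 := hf.partialDeriv_comp_perm hΓ hk (Equiv.swap i j) i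
  have h2 : k ∘ Equiv.swap i j = k := by
    ext l
    simp only [Function.comp_apply, Equiv.swap_apply_def]
    split_ifs with h3 h4 <;> simp_all
  rwa [h2, Equiv.swap_apply_left] at h1

/-- Euler's relation for functions homogeneous of degree one. -/
theorem IsCurvatureFunction.sum_partialDeriv_mul (hΓ : IsAdmissibleCone Γ)
    (hf : IsCurvatureFunction Γ f) {k : Fin n → ℝ} (hk : k ∈ Γ) :
    ∑ i, partialDeriv f i k * k i = f k := by
  have h1 : HasDerivAt (fun s : ℝ => f (s • k)) (fderiv ℝ f k k) 1 := by
    have h2 : HasFDerivAt f (fderiv ℝ f k) ((1 : ℝ) • k) := by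
      rw [one_smul]; exact (hf.differentiableAt hΓ hk).hasFDerivAt
    have := h2.comp_hasDerivAt 1 ((hasDerivAt_id (1 : ℝ)).smul_const k)
    rw [one_smul] at this
    exact this
  have h2 : HasDerivAt (fun s : ℝ => f (s • k)) (f k) 1 := by
    have h3 : HasDerivAt (fun s : ℝ => s * f k) (f k) 1 := by
      simpa using (hasDerivAt_id (1 : ℝ)).mul_const (f k)
    refine h3.congr_of_eventuallyEq ?_
    filter_upwards [lt_mem_nhds (show (0 : ℝ) < 1 by norm_num)] with s hs
    exact hf.homogeneous s hs k hk
  rw [h2.unique h1]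
  conv_rhs => enter [2]; rw [← Finset.univ_sum_single k]
  rw [map_sum]
  refine Finset.sum_congr rfl fun i _ => ?_
  have : (Pi.single i (k i) : Fin n → ℝ) = k i • Pi.single i (1 : ℝ) := by
    rw [← Pi.single_smul]; simp
  rw [this, map_smul, smul_eq_mul, mul_comm]
  rfl

end CurvatureFunction

/-! ### Hypersurfaces in a moving frame -/

theorem two_le_infty : (2 : WithTop ℕ∞) ≤ ∞ :=
  WithTop.coe_le_coe.2 (le_top : (2 : ℕ∞) ≤ ⊤)

section MovingFrame

variable {V : Type*} [NormedAddCommGroup V] [NormedSpace ℝ V]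
  {W : Type*} [NormedAddCommGroup W] [NormedSpace ℝ W]

/-- The covariant derivative `∇_v A` of a field `A` along a map into a Riemannian manifold, with
respect to the pulled back connection `1`-form `γ`. -/
noncomputable def covDeriv (γ : V → V →L[ℝ] W →L[ℝ] W) (v : V) (A : V → W) (z : V) : W :=
  fderiv ℝ A z v + γ z v (A z)

/-- The first fundamental form in a moving frame; `g` is the metric in the frame and `θ` the
differential of the immersion. -/
noncomputable def firstForm (g : V → W →L[ℝ] W →L[ℝ] ℝ) (θ : V → V →L[ℝ] W) (z : V) :
    V →L[ℝ] V →L[ℝ] ℝ :=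
  (g z).bilinearComp (θ z) (θ z)

/-- The second fundamental form `(v, w) ↦ g (∇_v ν) (θ w)` in a moving frame. -/
noncomputable def secondForm (g : V → W →L[ℝ] W →L[ℝ] ℝ) (θ : V → V →L[ℝ] W)
    (γ : V → V →L[ℝ] W →L[ℝ] W)
    (ν : V → W) (z : V) : V →L[ℝ] V →L[ℝ] ℝ :=
  (g z).bilinearComp (fderiv ℝ ν z + (γ z).flip (ν z)) (θ z)

/-- The curvature `2`-form of the connection form `γ`. -/
noncomputable def curvatureForm (γ : V → V →L[ℝ] W →L[ℝ] W) (z v w : V) (a : W) : W :=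
  fderiv ℝ γ z v w a - fderiv ℝ γ z w v a + γ z v (γ z w a) - γ z w (γ z v a)

/-- A hypersurface in a Riemannian manifold in a moving frame over the parameter domain `U`: the
metric `g` and the Levi-Civita connection form `γ` along the hypersurface, the differential `θ`, the
unit normal `ν`, and a closed conformal vector field `ξ` with `∇_v ξ = μ v`. -/
structure IsHypersurfaceModel (U : Set V) (g : V → W →L[ℝ] W →L[ℝ] ℝ) (θ : V → V →L[ℝ] W)
    (γ : V → V →L[ℝ] W →L[ℝ] W) (ν ξ : V → W) (μ : V → ℝ) : Prop where
  isOpen : IsOpen U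
  smooth_metric : ContDiffOn ℝ ∞ g U
  smooth_differential : ContDiffOn ℝ ∞ θ U
  smooth_connection : ContDiffOn ℝ ∞ γ U
  smooth_normal : ContDiffOn ℝ ∞ ν U
  smooth_field : ContDiffOn ℝ ∞ ξ U
  symm : ∀ z ∈ U, ∀ a b, g z a b = g z b a
  compat : ∀ z ∈ U, ∀ v a b, fderiv ℝ g z v a b = g z (γ z v a) b + g z a (γ z v b)
  torsion_free : ∀ z ∈ U, ∀ v w,
    fderiv ℝ θ z v w + γ z v (θ z w) = fderiv ℝ θ z w v + γ z w (θ z v)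
  conformal : ∀ z ∈ U, ∀ v, covDeriv γ v ξ z = μ z • θ z v
  unit : ∀ z ∈ U, g z (ν z) (ν z) = 1
  normal : ∀ z ∈ U, ∀ v, g z (ν z) (θ z v) = 0
  span : ∀ z ∈ U, ∀ a, ∃ (T : V) (c : ℝ), a = θ z T + c • ν z

namespace IsHypersurfaceModel

variable {U : Set V} {g : V → W →L[ℝ] W →L[ℝ] ℝ} {θ : V → V →L[ℝ] W}
  {γ : V → V →L[ℝ] W →L[ℝ] W} {ν ξ : V → W} {μ : V → ℝ}

theorem contDiffOn_covDeriv (h : IsHypersurfaceModel U g θ γ ν ξ μ) {A : V → W}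
    (hA : ContDiffOn ℝ ∞ A U) (v : V) : ContDiffOn ℝ ∞ (covDeriv γ v A) U := by
  have h1 : ContDiffOn ℝ ∞ (fun z => fderiv ℝ A z v) U :=
    (hA.fderiv_of_isOpen h.isOpen (by simp)).clm_apply contDiffOn_const
  exact h1.add ((h.smooth_connection.clm_apply contDiffOn_const).clm_apply hA)

theorem contDiffOn_differential_apply (h : IsHypersurfaceModel U g θ γ ν ξ μ) (v : V) :
    ContDiffOn ℝ ∞ (fun z => θ z v) U :=
  h.smooth_differential.clm_apply contDiffOn_const

theorem fderiv_metric_apply (h : IsHypersurfaceModel U g θ γ ν ξ μ) {A B : V → W}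
    (hA : ContDiffOn ℝ ∞ A U) (hB : ContDiffOn ℝ ∞ B U) {z : V} (hz : z ∈ U) (v : V) :
    fderiv ℝ (fun z => g z (A z) (B z)) z v =
      g z (covDeriv γ v A z) (B z) + g z (A z) (covDeriv γ v B z) := by
  have hd : ∀ {X : Type _} [NormedAddCommGroup X] [NormedSpace ℝ X] {F : V → X},
      ContDiffOn ℝ ∞ F U → DifferentiableAt ℝ F z := fun hF =>
    (hF.contDiffAt (h.isOpen.mem_nhds hz)).differentiableAt (by simp)
  rw [(((hd h.smooth_metric).hasFDerivAt.clm_apply (hd hA).hasFDerivAt).clm_apply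
    (hd hB).hasFDerivAt).fderiv]
  simp only [covDeriv, map_add, add_apply, ContinuousLinearMap.comp_apply,
    ContinuousLinearMap.flip_apply, h.compat z hz]
  ring

theorem covDeriv_differential (h : IsHypersurfaceModel U g θ γ ν ξ μ) {z : V} (hz : z ∈ U)
    (v w : V) : covDeriv γ v (fun z => θ z w) z = fderiv ℝ θ z v w + γ z v (θ z w) := by
  have hd : DifferentiableAt ℝ θ z :=
    (h.smooth_differential.contDiffAt (h.isOpen.mem_nhds hz)).differentiableAt (by simp)
  rw [covDeriv, (hd.hasFDerivAt.clm_apply (hasFDerivAt_const w z)).fderiv]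
  simp

theorem covDeriv_differential_symm (h : IsHypersurfaceModel U g θ γ ν ξ μ) {z : V} (hz : z ∈ U)
    (v w : V) : covDeriv γ v (fun z => θ z w) z = covDeriv γ w (fun z => θ z v) z := by
  rw [h.covDeriv_differential hz, h.covDeriv_differential hz, h.torsion_free z hz]

theorem secondForm_apply (z v w : V) :
    secondForm g θ γ ν z v w = g z (covDeriv γ v ν z) (θ z w) := by
  simp [secondForm, covDeriv]

theorem firstForm_apply (z v w : V) : firstForm g θ z v w = g z (θ z v) (θ z w) := rfl

theorem metric_normal_covDeriv_normal (h : IsHypersurfaceModel U g θ γ ν ξ μ) {z : V}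
    (hz : z ∈ U) (v : V) : g z (ν z) (covDeriv γ v ν z) = 0 := by
  have h1 := h.fderiv_metric_apply h.smooth_normal h.smooth_normal hz v
  have h2 : (fun z => g z (ν z) (ν z)) =ᶠ[𝓝 z] fun _ => 1 := by
    filter_upwards [h.isOpen.mem_nhds hz] with y hy using h.unit y hy
  rw [h2.fderiv_eq, h.symm z hz (covDeriv γ v ν z)] at h1
  simp at h1
  linarith

theorem secondForm_eq_neg (h : IsHypersurfaceModel U g θ γ ν ξ μ) {z : V} (hz : z ∈ U)
    (v w : V) : secondForm g θ γ ν z v w = -g z (ν z) (covDeriv γ v (fun z => θ z w) z) := by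
  have h1 := h.fderiv_metric_apply h.smooth_normal (h.contDiffOn_differential_apply w) hz v
  have h2 : (fun z => g z (ν z) (θ z w)) =ᶠ[𝓝 z] fun _ => 0 := by
    filter_upwards [h.isOpen.mem_nhds hz] with y hy using h.normal y hy w
  rw [h2.fderiv_eq] at h1
  simp at h1
  rw [secondForm_apply]
  linarith

theorem secondForm_symm (h : IsHypersurfaceModel U g θ γ ν ξ μ) {z : V} (hz : z ∈ U)
    (v w : V) : secondForm g θ γ ν z v w = secondForm g θ γ ν z w v := by
  rw [h.secondForm_eq_neg hz, h.secondForm_eq_neg hz, h.covDeriv_differential_symm hz]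

/-- The Ricci identity `∇_v ∇_w A - ∇_w ∇_v A = Ω(v, w) A`. -/
theorem covDeriv_covDeriv_sub (h : IsHypersurfaceModel U g θ γ ν ξ μ) {A : V → W}
    (hA : ContDiffOn ℝ ∞ A U) {z : V} (hz : z ∈ U) (v w : V) :
    covDeriv γ v (covDeriv γ w A) z - covDeriv γ w (covDeriv γ v A) z =
      curvatureForm γ z v w (A z) := by
  have hAz : ContDiffAt ℝ ∞ A z := hA.contDiffAt (h.isOpen.mem_nhds hz)
  have hγ : DifferentiableAt ℝ γ z :=
    (h.smooth_connection.contDiffAt (h.isOpen.mem_nhds hz)).differentiableAt (by simp)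
  have hA1 : DifferentiableAt ℝ A z := hAz.differentiableAt (by simp)
  have hA2 : DifferentiableAt ℝ (fderiv ℝ A) z :=
    (hAz.fderiv_right (m := ∞) (by simp)).differentiableAt (by simp)
  have key : ∀ v w, fderiv ℝ (covDeriv γ w A) z v = fderiv ℝ (fderiv ℝ A) z v w +
      fderiv ℝ γ z v w (A z) + γ z w (fderiv ℝ A z v) := by
    intro v w
    have h1 := (hA2.hasFDerivAt.clm_apply (hasFDerivAt_const w z)).add
      ((hγ.hasFDerivAt.clm_apply (hasFDerivAt_const w z)).clm_apply hA1.hasFDerivAt)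
    have h2 : covDeriv γ w A = fun z => fderiv ℝ A z w + γ z w (A z) := rfl
    rw [h2, HasFDerivAt.fderiv (f := fun z => fderiv ℝ A z w + γ z w (A z)) h1]
    simp
    abel
  have hsymm : fderiv ℝ (fderiv ℝ A) z v w = fderiv ℝ (fderiv ℝ A) z w v :=
    (hAz.isSymmSndFDerivAt (by simpa using two_le_infty)).eq v w
  have h3 : ∀ v w, covDeriv γ v (covDeriv γ w A) z =
      fderiv ℝ (covDeriv γ w A) z v + γ z v (fderiv ℝ A z w + γ z w (A z)) := fun _ _ => rfl
  rw [h3, h3, key, key, hsymm]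
  simp only [curvatureForm, map_add]
  abel

theorem fderiv_firstForm (h : IsHypersurfaceModel U g θ γ ν ξ μ) {z : V} (hz : z ∈ U)
    (hI : DifferentiableAt ℝ (firstForm g θ) z) (T v w : V) :
    fderiv ℝ (firstForm g θ) z T v w = g z (covDeriv γ T (fun z => θ z v) z) (θ z w) +
      g z (θ z v) (covDeriv γ T (fun z => θ z w) z) := by
  rw [← h.fderiv_metric_apply (h.contDiffOn_differential_apply v)
    (h.contDiffOn_differential_apply w) hz T]
  have h1 := (hI.hasFDerivAt.clm_apply (hasFDerivAt_const v z)).clm_apply (hasFDerivAt_const w z)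
  have h2 : (fun z => g z (θ z v) (θ z w)) = fun z => firstForm g θ z v w := rfl
  rw [h2, h1.fderiv]
  simp

theorem fderiv_secondForm (h : IsHypersurfaceModel U g θ γ ν ξ μ) {z : V} (hz : z ∈ U)
    (hII : DifferentiableAt ℝ (secondForm g θ γ ν) z) (T v w : V) :
    fderiv ℝ (secondForm g θ γ ν) z T v w =
      g z (covDeriv γ T (covDeriv γ v ν) z) (θ z w) +
      g z (covDeriv γ v ν z) (covDeriv γ T (fun z => θ z w) z) := by
  rw [← h.fderiv_metric_apply (h.contDiffOn_covDeriv h.smooth_normal v)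
    (h.contDiffOn_differential_apply w) hz T]
  have h1 := (hII.hasFDerivAt.clm_apply (hasFDerivAt_const v z)).clm_apply (hasFDerivAt_const w z)
  have h2 : (fun z => g z (covDeriv γ v ν z) (θ z w)) = fun z => secondForm g θ γ ν z v w := by
    ext z; rw [secondForm_apply]
  rw [h2, h1.fderiv]
  simp

/-- The second fundamental form is a Codazzi tensor up to curvature. -/
theorem metric_covDeriv_covDeriv_normal (h : IsHypersurfaceModel U g θ γ ν ξ μ) {z : V}
    (hz : z ∈ U) (hII : DifferentiableAt ℝ (secondForm g θ γ ν) z) (e T : V) :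
    g z (covDeriv γ e (covDeriv γ e ν) z) (θ z T) = fderiv ℝ (secondForm g θ γ ν) z T e e -
      2 * g z (covDeriv γ e ν z) (covDeriv γ T (fun z => θ z e) z) +
      g z (covDeriv γ T ν z) (covDeriv γ e (fun z => θ z e) z) +
      g z (curvatureForm γ z e T (ν z)) (θ z e) := by
  have h1 := h.fderiv_secondForm hz hII e e T
  have h2 := h.fderiv_secondForm hz hII e T e
  have h3 := h.fderiv_secondForm hz hII T e e
  have h4 : fderiv ℝ (secondForm g θ γ ν) z e e T = fderiv ℝ (secondForm g θ γ ν) z e T e := by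
    have h5 : ∀ v w, fderiv ℝ (fun y => secondForm g θ γ ν y v w) z e =
        fderiv ℝ (secondForm g θ γ ν) z e v w := by
      intro v w
      rw [((hII.hasFDerivAt.clm_apply (hasFDerivAt_const v z)).clm_apply
        (hasFDerivAt_const w z)).fderiv]
      simp
    rw [← h5, ← h5]
    congr 1
    apply Filter.EventuallyEq.fderiv_eq
    filter_upwards [h.isOpen.mem_nhds hz] with y hy using h.secondForm_symm hy _ _
  have h5 := h.covDeriv_covDeriv_sub h.smooth_normal hz e T
  rw [h.covDeriv_differential_symm hz e T] at h1
  rw [← h5, map_sub, sub_apply]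
  linarith

/-- The shape operator acts on a principal direction by its principal curvature. -/
theorem metric_covDeriv_normal_eq (h : IsHypersurfaceModel U g θ γ ν ξ μ) {z : V} (hz : z ∈ U)
    {e : V} {κ : ℝ} (hκ : ∀ v, secondForm g θ γ ν z e v = κ * firstForm g θ z e v) (a : W) :
    g z (covDeriv γ e ν z) a = κ * g z (θ z e) a := by
  obtain ⟨T, c, rfl⟩ := h.span z hz a
  have h1 := hκ T
  rw [secondForm_apply, firstForm_apply] at h1
  rw [map_add, map_add, h1, map_smul, map_smul, h.symm z hz _ (ν z),
    h.metric_normal_covDeriv_normal hz, h.symm z hz _ (ν z), h.normal z hz]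
  simp

theorem fderiv_support (h : IsHypersurfaceModel U g θ γ ν ξ μ) {u : V → ℝ}
    (hu : ∀ z ∈ U, u z = g z (ξ z) (ν z)) {z : V} (hz : z ∈ U) (v : V) :
    fderiv ℝ u z v = g z (ξ z) (covDeriv γ v ν z) := by
  have h1 : u =ᶠ[𝓝 z] fun z => g z (ξ z) (ν z) := by
    filter_upwards [h.isOpen.mem_nhds hz] with y hy using hu y hy
  rw [h1.fderiv_eq, h.fderiv_metric_apply h.smooth_field h.smooth_normal hz,
    h.conformal z hz, map_smul, smul_apply, h.symm z hz (θ z v), h.normal z hz]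
  simp

/-- The second derivatives, in a principal direction `e`, of the support function `u` and of the
potential `Ψ` of the conformal field. The vector `S` is the value at `(e, e)` of the Christoffel
symbols of the first fundamental form, and `T` is the tangential part of the conformal field. -/
theorem second_derivatives (h : IsHypersurfaceModel U g θ γ ν ξ μ) {z : V} (hz : z ∈ U)
    (hI : DifferentiableAt ℝ (firstForm g θ) z) (hII : DifferentiableAt ℝ (secondForm g θ γ ν) z)
    {u Ψ : V → ℝ} (hu : ∀ z ∈ U, u z = g z (ξ z) (ν z))
    (hΨ : ∀ z ∈ U, ∀ v, fderiv ℝ Ψ z v = g z (ξ z) (θ z v))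
    (hΨ2 : DifferentiableAt ℝ (fderiv ℝ Ψ) z) (hu2 : DifferentiableAt ℝ (fderiv ℝ u) z)
    {e : V} {κ : ℝ} (he : firstForm g θ z e e = 1)
    (hκ : ∀ v, secondForm g θ γ ν z e v = κ * firstForm g θ z e v)
    {T : V} (hT : ξ z = θ z T + u z • ν z) :
    fderiv ℝ Ψ z e = firstForm g θ z T e ∧ fderiv ℝ u z e = κ * fderiv ℝ Ψ z e ∧
    ∃ S : V, (∀ v, firstForm g θ z S v =
        fderiv ℝ (firstForm g θ) z e e v - fderiv ℝ (firstForm g θ) z v e e / 2) ∧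
      fderiv ℝ (fderiv ℝ Ψ) z e e = μ z - u z * κ + fderiv ℝ Ψ z S ∧
      fderiv ℝ (fderiv ℝ u) z e e = μ z * κ - u z * κ ^ 2 +
        (fderiv ℝ (secondForm g θ γ ν) z T e e - κ * fderiv ℝ (firstForm g θ) z T e e) +
        fderiv ℝ u z S + g z (curvatureForm γ z e T (ν z)) (θ z e) := by
  have hN := h.metric_covDeriv_normal_eq hz hκ
  have hθe := h.contDiffOn_differential_apply e
  have hNe := h.contDiffOn_covDeriv h.smooth_normal e
  have hsecond : ∀ (q : V → ℝ), DifferentiableAt ℝ (fderiv ℝ q) z →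
      fderiv ℝ (fderiv ℝ q) z e e = fderiv ℝ (fun y => fderiv ℝ q y e) z e := by
    intro q hq
    rw [(hq.hasFDerivAt.clm_apply (hasFDerivAt_const e z)).fderiv]
    simp
  have hΨe : ∀ v, fderiv ℝ Ψ z v = firstForm g θ z T v := fun v => by
    rw [hΨ z hz, hT, firstForm_apply]
    simp [h.normal z hz]
  have huv : ∀ v, fderiv ℝ u z v = secondForm g θ γ ν z v T := fun v => by
    rw [h.fderiv_support hu hz, hT, secondForm_apply, h.symm z hz _ (θ z T)]
    simp [h.metric_normal_covDeriv_normal hz]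
  refine ⟨hΨe e, ?_, ?_⟩
  · rw [huv, hκ, hΨe, firstForm_apply, firstForm_apply, h.symm z hz]
  obtain ⟨S, c, hS⟩ := h.span z hz (covDeriv γ e (fun z => θ z e) z)
  -- the normal component of the second derivative of the immersion
  have hc : c = -κ := by
    have h1 := h.secondForm_eq_neg hz e e
    rw [hS, hκ, he] at h1
    simp [h.normal z hz, h.unit z hz] at h1
    linarith
  refine ⟨S, fun v => ?_, ?_, ?_⟩
  · rw [h.fderiv_firstForm hz hI, h.fderiv_firstForm hz hI, hS, h.covDeriv_differential_symm hz e v,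
      h.symm z hz (covDeriv γ v (fun z => θ z e) z), firstForm_apply]
    simp [h.normal z hz]
  · rw [hsecond Ψ hΨ2]
    have h1 : (fun y => fderiv ℝ Ψ y e) =ᶠ[𝓝 z] fun y => g y (ξ y) (θ y e) := by
      filter_upwards [h.isOpen.mem_nhds hz] with y hy using hΨ y hy e
    rw [h1.fderiv_eq, h.fderiv_metric_apply h.smooth_field hθe hz, h.conformal z hz, hS, hΨ z hz,
      map_smul, smul_apply, ← firstForm_apply, he, map_add, map_smul, ← hu z hz, hc]
    simp only [smul_eq_mul]
    ring
  · rw [hsecond u hu2]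
    have h1 : (fun y => fderiv ℝ u y e) =ᶠ[𝓝 z] fun y => g y (ξ y) (covDeriv γ e ν y) := by
      filter_upwards [h.isOpen.mem_nhds hz] with y hy using h.fderiv_support hu hy e
    have h2 : g z (covDeriv γ e ν z) (covDeriv γ e ν z) = κ ^ 2 := by
      have h3 := hκ e
      rw [secondForm_apply, he] at h3
      rw [hN, h.symm z hz, h3]; ring
    -- the normal component of `∇_e ∇_e ν`
    have h4 : g z (ν z) (covDeriv γ e (covDeriv γ e ν) z) = -κ ^ 2 := by
      have h5 := h.fderiv_metric_apply h.smooth_normal hNe hz e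
      have h6 : (fun y => g y (ν y) (covDeriv γ e ν y)) =ᶠ[𝓝 z] fun _ => 0 := by
        filter_upwards [h.isOpen.mem_nhds hz] with y hy using h.metric_normal_covDeriv_normal hy e
      rw [h6.fderiv_eq, h2] at h5
      simp at h5
      linarith
    have h5 := h.metric_covDeriv_covDeriv_normal hz hII e T
    have h6 := h.fderiv_firstForm hz hI T e e
    have h7 : g z (covDeriv γ T ν z) (covDeriv γ e (fun z => θ z e) z) = fderiv ℝ u z S := by
      rw [hS, huv, h.secondForm_symm hz, secondForm_apply, map_add, map_smul, h.symm z hz _ (ν z),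
        h.metric_normal_covDeriv_normal hz]
      simp
    rw [h1.fderiv_eq, h.fderiv_metric_apply h.smooth_field hNe hz, h.conformal z hz]
    have h8 : g z (ξ z) (covDeriv γ e (covDeriv γ e ν) z) =
        g z (covDeriv γ e (covDeriv γ e ν) z) (θ z T) - u z * κ ^ 2 := by
      rw [hT, map_add, add_apply, h.symm z hz (θ z T), map_smul, smul_apply, h4]
      simp; ring
    have h9 : g z (θ z e) (covDeriv γ e ν z) = κ := by
      rw [h.symm z hz, hN, ← firstForm_apply, he, mul_one]
    rw [h8, h5, h7, h6, hN, map_smul, smul_apply, h9,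
      h.symm z hz (covDeriv γ T (fun z => θ z e) z)]
    simp only [smul_eq_mul]
    ring

end IsHypersurfaceModel

end MovingFrame

/-! ### The metric in a chart -/

section Chart

variable {E : Type*} [NormedAddCommGroup E] [NormedSpace ℝ E]
  {P : Type*} [TopologicalSpace P] [ChartedSpace E P] [IsManifold 𝓘(ℝ, E) ∞ P]

theorem contMDiffAt_extChartAt_of_mem {p q : P} (hq : q ∈ (extChartAt 𝓘(ℝ, E) p).source) :
    ContMDiffAt 𝓘(ℝ, E) 𝓘(ℝ, E) ∞ (extChartAt 𝓘(ℝ, E) p) q :=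
  contMDiffAt_extChartAt' (by simpa using hq)

theorem contMDiffAt_extChartAt_symm_of_mem {p : P} {y : E}
    (hy : y ∈ (extChartAt 𝓘(ℝ, E) p).target) :
    ContMDiffAt 𝓘(ℝ, E) 𝓘(ℝ, E) ∞ (extChartAt 𝓘(ℝ, E) p).symm y :=
  (contMDiffOn_extChartAt_symm p).contMDiffAt ((isOpen_extChartAt_target p).mem_nhds hy)

theorem mdifferentiableAt_extChartAt_of_mem {p q : P}
    (hq : q ∈ (extChartAt 𝓘(ℝ, E) p).source) :
    MDifferentiableAt 𝓘(ℝ, E) 𝓘(ℝ, E) (extChartAt 𝓘(ℝ, E) p) q :=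
  (contMDiffAt_extChartAt_of_mem hq).mdifferentiableAt (by simp)

theorem mdifferentiableAt_extChartAt_symm_of_mem {p : P} {y : E}
    (hy : y ∈ (extChartAt 𝓘(ℝ, E) p).target) :
    MDifferentiableAt 𝓘(ℝ, E) 𝓘(ℝ, E) (extChartAt 𝓘(ℝ, E) p).symm y :=
  (contMDiffAt_extChartAt_symm_of_mem hy).mdifferentiableAt (by simp)

theorem mfderiv_extChartAt_mfderiv_symm {p : P} {y : E}
    (hy : y ∈ (extChartAt 𝓘(ℝ, E) p).target) (v : E) :
    mfderiv 𝓘(ℝ, E) 𝓘(ℝ, E) (extChartAt 𝓘(ℝ, E) p) ((extChartAt 𝓘(ℝ, E) p).symm y)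
      (mfderiv 𝓘(ℝ, E) 𝓘(ℝ, E) (extChartAt 𝓘(ℝ, E) p).symm y v) = v := by
  have : IsManifold 𝓘(ℝ, E) 1 P := IsManifold.of_le (n := ∞) (by simp)
  have h := mfderiv_extChartAt_comp_mfderivWithin_extChartAt_symm (I := 𝓘(ℝ, E)) hy
  simp only [modelWithCornersSelf_coe, range_id, mfderivWithin_univ] at h
  exact DFunLike.congr_fun h v

theorem mfderiv_symm_mfderiv_extChartAt {p q : P}
    (hq : q ∈ (extChartAt 𝓘(ℝ, E) p).source) (v : TangentSpace 𝓘(ℝ, E) q) :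
    mfderiv 𝓘(ℝ, E) 𝓘(ℝ, E) (extChartAt 𝓘(ℝ, E) p).symm (extChartAt 𝓘(ℝ, E) p q)
      (mfderiv 𝓘(ℝ, E) 𝓘(ℝ, E) (extChartAt 𝓘(ℝ, E) p) q v) = v := by
  have : IsManifold 𝓘(ℝ, E) 1 P := IsManifold.of_le (n := ∞) (by simp)
  have h := mfderivWithin_extChartAt_symm_comp_mfderiv_extChartAt' (I := 𝓘(ℝ, E)) hq
  simp only [modelWithCornersSelf_coe, range_id, mfderivWithin_univ] at h
  exact DFunLike.congr_fun h v

/-- In the trivialization at `p`, a tangent vector is represented by its coordinates in the chart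
at `p`. -/
theorem trivializationAt_snd_eq_chartCoord {p q : P} (hq : q ∈ (extChartAt 𝓘(ℝ, E) p).source)
    (w : TangentSpace 𝓘(ℝ, E) q) :
    (trivializationAt E (TangentSpace 𝓘(ℝ, E) : P → Type _) p ⟨q, w⟩).2 = chartCoord p q w := by
  have : IsManifold 𝓘(ℝ, E) 1 P := IsManifold.of_le (n := ∞) (by simp)
  have hq' : q ∈ (chartAt E p).source := by simpa using hq
  have h := TangentBundle.continuousLinearMapAt_trivializationAt (𝕜 := ℝ) (I := 𝓘(ℝ, E)) hq'
  have h2 := DFunLike.congr_fun h w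
  refine Eq.trans ?_ h2
  rw [Bundle.Trivialization.continuousLinearMapAt_apply,
    Bundle.Trivialization.linearMapAt_apply, if_pos (by simpa using hq')]

theorem mem_trivializationAt_source {p q : P} (hq : q ∈ (extChartAt 𝓘(ℝ, E) p).source)
    (w : TangentSpace 𝓘(ℝ, E) q) :
    (⟨q, w⟩ : TangentBundle 𝓘(ℝ, E) P) ∈
      (trivializationAt E (TangentSpace 𝓘(ℝ, E) : P → Type _) p).source := by
  rw [Bundle.Trivialization.mem_source]
  simpa using hq

/-- A vector field along a map is smooth if and only if the map and the chart coordinates are. -/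
theorem contMDiffAt_tangentBundle_iff {E' : Type*} [NormedAddCommGroup E'] [NormedSpace ℝ E']
    {M : Type*} [TopologicalSpace M] [ChartedSpace E' M] {p : P} {X : M → P}
    {ν : ∀ x, TangentSpace 𝓘(ℝ, E) (X x)} {x : M} (hx : X x ∈ (extChartAt 𝓘(ℝ, E) p).source) :
    ContMDiffAt 𝓘(ℝ, E') 𝓘(ℝ, E).tangent ∞
      (fun x => (⟨X x, ν x⟩ : TangentBundle 𝓘(ℝ, E) P)) x ↔
    ContMDiffAt 𝓘(ℝ, E') 𝓘(ℝ, E) ∞ X x ∧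
      ContMDiffAt 𝓘(ℝ, E') 𝓘(ℝ, E) ∞ (fun x => chartCoord p (X x) (ν x)) x := by
  refine ((trivializationAt E (TangentSpace 𝓘(ℝ, E) : P → Type _) p).contMDiffAt_iff
    (f := fun x => (⟨X x, ν x⟩ : TangentBundle 𝓘(ℝ, E) P))
    (mem_trivializationAt_source hx _)).trans ?_
  refine and_congr_right fun hX => ?_
  refine Filter.EventuallyEq.contMDiffAt_iff ?_
  filter_upwards [hX.continuousAt.preimage_mem_nhds
    ((isOpen_extChartAt_source p).mem_nhds hx)] with y hy
  exact trivializationAt_snd_eq_chartCoord hy _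

theorem metricInChart_apply (g : RiemMetric E P) (p : P) (y v w : E) :
    metricInChart g p y v w = g.inner ((extChartAt 𝓘(ℝ, E) p).symm y)
      (mfderiv 𝓘(ℝ, E) 𝓘(ℝ, E) (extChartAt 𝓘(ℝ, E) p).symm y v)
      (mfderiv 𝓘(ℝ, E) 𝓘(ℝ, E) (extChartAt 𝓘(ℝ, E) p).symm y w) := rfl

theorem metricInChart_chartCoord (g : RiemMetric E P) {p q : P}
    (hq : q ∈ (extChartAt 𝓘(ℝ, E) p).source) (v w : TangentSpace 𝓘(ℝ, E) q) :
    metricInChart g p (extChartAt 𝓘(ℝ, E) p q) (chartCoord p q v) (chartCoord p q w) =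
      g.inner q v w := by
  rw [metricInChart_apply, chartCoord, chartCoord, mfderiv_symm_mfderiv_extChartAt hq,
    mfderiv_symm_mfderiv_extChartAt hq, (extChartAt 𝓘(ℝ, E) p).left_inv hq]

theorem metricInChart_symm (g : RiemMetric E P) (p : P) (y v w : E) :
    metricInChart g p y v w = metricInChart g p y w v := by
  rw [metricInChart_apply, metricInChart_apply, g.symm]

theorem metricInChart_pos (g : RiemMetric E P) {p : P} {y : E}
    (hy : y ∈ (extChartAt 𝓘(ℝ, E) p).target) {v : E} (hv : v ≠ 0) :
    0 < metricInChart g p y v v := by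
  rw [metricInChart_apply]
  refine g.pos _ _ fun h => hv ?_
  have := mfderiv_extChartAt_mfderiv_symm hy v
  rw [h, map_zero] at this
  exact this.symm

theorem contDiffOn_metricInChart [FiniteDimensional ℝ E] (g : RiemMetric E P) (p : P) :
    ContDiffOn ℝ ∞ (metricInChart g p) (extChartAt 𝓘(ℝ, E) p).target := by
  rw [contDiffOn_clm_apply]
  intro v
  rw [contDiffOn_clm_apply]
  intro w
  have hsec : ∀ v : E, ContMDiffOn 𝓘(ℝ, E) 𝓘(ℝ, E).tangent ∞
      (fun y : E => (⟨(extChartAt 𝓘(ℝ, E) p).symm y,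
        mfderiv 𝓘(ℝ, E) 𝓘(ℝ, E) (extChartAt 𝓘(ℝ, E) p).symm y v⟩ : TangentBundle 𝓘(ℝ, E) P))
      (extChartAt 𝓘(ℝ, E) p).target := by
    intro v y hy
    refine ContMDiffAt.contMDiffWithinAt ?_
    rw [contMDiffAt_tangentBundle_iff (p := p) ((extChartAt 𝓘(ℝ, E) p).map_target hy)]
    refine ⟨contMDiffAt_extChartAt_symm_of_mem hy, ?_⟩
    refine (contMDiffAt_const (c := v)).congr_of_eventuallyEq ?_
    filter_upwards [(isOpen_extChartAt_target (I := 𝓘(ℝ, E)) p).mem_nhds hy] with z hz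
    exact mfderiv_extChartAt_mfderiv_symm hz v
  rw [← contMDiffOn_iff_contDiffOn]
  have hg : ContMDiffOn 𝓘(ℝ, E) (𝓘(ℝ, E).prod 𝓘(ℝ, E →L[ℝ] E →L[ℝ] ℝ)) ∞
      (fun y : E => Bundle.TotalSpace.mk' (E →L[ℝ] E →L[ℝ] ℝ)
        (E := fun x : P => TangentSpace 𝓘(ℝ, E) x →L[ℝ] TangentSpace 𝓘(ℝ, E) x →L[ℝ] ℝ)
        ((extChartAt 𝓘(ℝ, E) p).symm y) (g.inner ((extChartAt 𝓘(ℝ, E) p).symm y)))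
      (extChartAt 𝓘(ℝ, E) p).target :=
    g.contMDiff.comp_contMDiffOn (contMDiffOn_extChartAt_symm p)
  have h := ContMDiffOn.clm_bundle_apply₂ (F₁ := E) (F₂ := E) (F₃ := ℝ)
    (E₁ := fun x : P => TangentSpace 𝓘(ℝ, E) x) (E₂ := fun x : P => TangentSpace 𝓘(ℝ, E) x)
    (E₃ := Bundle.Trivial P ℝ) hg (hsec v) (hsec w)
  intro y hy
  have h2 := h y hy
  rw [Bundle.contMDiffWithinAt_totalSpace] at h2
  exact h2.2

end Chart

/-! ### The Levi-Civita connection and the curvature of a metric on an open set -/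

section LocalMetric

variable {E : Type*} [NormedAddCommGroup E] [NormedSpace ℝ E]

/-- `H` is a smooth Riemannian metric on the open subset `O` of `E`. -/
structure IsLocalMetric (O : Set E) (H : E → E →L[ℝ] E →L[ℝ] ℝ) : Prop where
  isOpen : IsOpen O
  smooth : ContDiffOn ℝ ∞ H O
  symm : ∀ y ∈ O, ∀ v w, H y v w = H y w v
  pos : ∀ y ∈ O, ∀ v, v ≠ 0 → 0 < H y v v

/-- Christoffel symbols of the first kind of the metric `H`. -/
noncomputable def lowerChristoffel (H : E → E →L[ℝ] E →L[ℝ] ℝ) (y v w : E) : E →L[ℝ] ℝ :=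
  (1 / 2 : ℝ) • (fderiv ℝ H y v w + fderiv ℝ H y w v - ((fderiv ℝ H y).flip v).flip w)

theorem lowerChristoffel_apply (H : E → E →L[ℝ] E →L[ℝ] ℝ) (y v w z : E) :
    lowerChristoffel H y v w z =
      (fderiv ℝ H y v w z + fderiv ℝ H y w v z - fderiv ℝ H y z v w) / 2 := by
  simp [lowerChristoffel]; ring

variable [FiniteDimensional ℝ E]

/-- Christoffel symbols of the second kind of the metric `H`, as a bilinear map. -/
noncomputable def leviCivita (H : E → E →L[ℝ] E →L[ℝ] ℝ) (y : E) : E →L[ℝ] E →L[ℝ] E :=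
  LinearMap.toContinuousLinearMap
    ((LinearMap.toContinuousLinearMap : (E →ₗ[ℝ] E) ≃ₗ[ℝ] E →L[ℝ] E).toLinearMap ∘ₗ
      LinearMap.mk₂ ℝ (fun v w => (H y).inverse (lowerChristoffel H y v w))
        (fun v v' w => by
          rw [← map_add]; congr 1; ext z; simp [lowerChristoffel_apply]; ring)
        (fun t v w => by
          rw [← map_smul]; congr 1; ext z; simp [lowerChristoffel_apply]; ring)
        (fun v w w' => by
          rw [← map_add]; congr 1; ext z; simp [lowerChristoffel_apply]; ring)
        (fun t v w => by
          rw [← map_smul]; congr 1; ext z; simp [lowerChristoffel_apply]; ring))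

theorem leviCivita_apply (H : E → E →L[ℝ] E →L[ℝ] ℝ) (y v w : E) :
    leviCivita H y v w = (H y).inverse (lowerChristoffel H y v w) := rfl

namespace IsLocalMetric

variable {O : Set E} {H : E → E →L[ℝ] E →L[ℝ] ℝ}

theorem exists_equiv (h : IsLocalMetric O H) {y : E} (hy : y ∈ O) :
    ∃ e : E ≃L[ℝ] (E →L[ℝ] ℝ), (e : E →L[ℝ] (E →L[ℝ] ℝ)) = H y := by
  have hinj : Function.Injective (H y : E →ₗ[ℝ] (E →L[ℝ] ℝ)) := by
    rw [injective_iff_map_eq_zero]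
    intro v hv
    by_contra hne
    have h1 := h.pos y hy v hne
    have h2 : H y v = 0 := hv
    rw [h2] at h1
    simp at h1
  have hfin : Module.finrank ℝ E = Module.finrank ℝ (E →L[ℝ] ℝ) := by
    rw [← (LinearMap.toContinuousLinearMap : (E →ₗ[ℝ] ℝ) ≃ₗ[ℝ] E →L[ℝ] ℝ).finrank_eq]
    exact (Subspace.dual_finrank_eq (K := ℝ) (V := E)).symm
  refine ⟨(LinearEquiv.ofInjectiveOfFinrankEq _ hinj hfin).toContinuousLinearEquiv, ?_⟩
  ext v w
  rfl

theorem metric_leviCivita (h : IsLocalMetric O H) {y : E} (hy : y ∈ O) (v w z : E) :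
    H y (leviCivita H y v w) z = lowerChristoffel H y v w z := by
  obtain ⟨e, he⟩ := h.exists_equiv hy
  rw [leviCivita_apply, ← he, ContinuousLinearMap.inverse_equiv]
  simp

theorem contDiffAt (h : IsLocalMetric O H) {y : E} (hy : y ∈ O) : ContDiffAt ℝ ∞ H y :=
  h.smooth.contDiffAt (h.isOpen.mem_nhds hy)

theorem fderiv_symm (h : IsLocalMetric O H) {y : E} (hy : y ∈ O) (z v w : E) :
    fderiv ℝ H y z v w = fderiv ℝ H y z w v := by
  have hd : DifferentiableAt ℝ H y := (h.contDiffAt hy).differentiableAt (by simp)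
  have h1 : ∀ v w, fderiv ℝ (fun x => H x v w) y z = fderiv ℝ H y z v w := by
    intro v w
    rw [((hd.hasFDerivAt.clm_apply (hasFDerivAt_const v y)).clm_apply
      (hasFDerivAt_const w y)).fderiv]
    simp
  rw [← h1, ← h1]
  congr 1
  apply Filter.EventuallyEq.fderiv_eq
  filter_upwards [h.isOpen.mem_nhds hy] with x hx using h.symm x hx v w

theorem leviCivita_symm (h : IsLocalMetric O H) {y : E} (hy : y ∈ O) (v w : E) :
    leviCivita H y v w = leviCivita H y w v := by
  rw [leviCivita_apply, leviCivita_apply]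
  congr 1
  ext z
  rw [lowerChristoffel_apply, lowerChristoffel_apply, h.fderiv_symm hy z v w]
  ring

theorem compat (h : IsLocalMetric O H) {y : E} (hy : y ∈ O) (v a b : E) :
    fderiv ℝ H y v a b = H y (leviCivita H y v a) b + H y a (leviCivita H y v b) := by
  rw [h.symm y hy a, h.metric_leviCivita hy, h.metric_leviCivita hy, lowerChristoffel_apply,
    lowerChristoffel_apply, h.fderiv_symm hy b, h.fderiv_symm hy v b a, h.fderiv_symm hy a]
  ring

theorem contDiffOn_leviCivita (h : IsLocalMetric O H) : ContDiffOn ℝ ∞ (leviCivita H) O := by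
  rw [contDiffOn_clm_apply]
  intro v
  rw [contDiffOn_clm_apply]
  intro w y hy
  refine ContDiffAt.contDiffWithinAt ?_
  have hD : ContDiffAt ℝ ∞ (fderiv ℝ H) y := (h.contDiffAt hy).fderiv_right (by simp)
  have hlow : ContDiffAt ℝ ∞ (fun y => lowerChristoffel H y v w) y := by
    have h1 : ContDiffAt ℝ ∞ (fun y => fderiv ℝ H y v w) y :=
      (hD.clm_apply contDiffAt_const).clm_apply contDiffAt_const
    have h2 : ContDiffAt ℝ ∞ (fun y => fderiv ℝ H y w v) y :=
      (hD.clm_apply contDiffAt_const).clm_apply contDiffAt_const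
    have h3 : ContDiffAt ℝ ∞ (fun y => ((fderiv ℝ H y).flip v).flip w) y := by
      have h4 : ContDiffAt ℝ ∞ (fun y => (fderiv ℝ H y).flip) y :=
        (ContinuousLinearMap.flipₗᵢ ℝ E E (E →L[ℝ] ℝ)).contDiff.contDiffAt.comp y hD
      have h5 : ContDiffAt ℝ ∞ (fun y => (fderiv ℝ H y).flip v) y :=
        h4.clm_apply contDiffAt_const
      have h6 : ContDiffAt ℝ ∞ (fun y => ((fderiv ℝ H y).flip v).flip) y :=
        (ContinuousLinearMap.flipₗᵢ ℝ E E ℝ).contDiff.contDiffAt.comp y h5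
      exact h6.clm_apply contDiffAt_const
    exact ((h1.add h2).sub h3).const_smul (1 / 2 : ℝ)
  obtain ⟨e, he⟩ := h.exists_equiv hy
  have hinv : ContDiffAt ℝ ∞ (fun y => (H y).inverse) y := by
    have h1 := contDiffAt_map_inverse (n := ∞) e
    rw [he] at h1
    exact h1.comp y (h.contDiffAt hy)
  exact hinv.clm_apply hlow

theorem differentiableAt_leviCivita (h : IsLocalMetric O H) {y : E} (hy : y ∈ O) :
    DifferentiableAt ℝ (leviCivita H) y :=
  (h.contDiffOn_leviCivita.contDiffAt (h.isOpen.mem_nhds hy)).differentiableAt (by simp)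

/-- The first Bianchi identity. -/
theorem curvatureForm_bianchi (h : IsLocalMetric O H) {y : E} (hy : y ∈ O) (u v w : E) :
    curvatureForm (leviCivita H) y u v w + curvatureForm (leviCivita H) y v w u +
      curvatureForm (leviCivita H) y w u v = 0 := by
  have hd := h.differentiableAt_leviCivita hy
  have h1 : ∀ z v w, fderiv ℝ (leviCivita H) y z v w = fderiv ℝ (leviCivita H) y z w v := by
    intro z v w
    have h2 : ∀ v w, fderiv ℝ (fun x => leviCivita H x v w) y z =
        fderiv ℝ (leviCivita H) y z v w := by
      intro v w
      rw [((hd.hasFDerivAt.clm_apply (hasFDerivAt_const v y)).clm_apply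
        (hasFDerivAt_const w y)).fderiv]
      simp
    rw [← h2, ← h2]
    congr 1
    apply Filter.EventuallyEq.fderiv_eq
    filter_upwards [h.isOpen.mem_nhds hy] with x hx using h.leviCivita_symm hx v w
  simp only [curvatureForm]
  rw [h1 u w v, h1 v u w, h1 w v u, h.leviCivita_symm hy w v, h.leviCivita_symm hy u w,
    h.leviCivita_symm hy v u]
  abel

/-- The curvature is skew-adjoint: differentiate the compatibility of the metric twice and use the
symmetry of second derivatives. -/
theorem metric_curvatureForm_antisymm (h : IsLocalMetric O H) {y : E} (hy : y ∈ O) (u v w z : E) :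
    H y (curvatureForm (leviCivita H) y u v w) z +
      H y w (curvatureForm (leviCivita H) y u v z) = 0 := by
  have hd := h.differentiableAt_leviCivita hy
  have hH := h.contDiffAt hy
  have hH1 : DifferentiableAt ℝ H y := hH.differentiableAt (by simp)
  have hH2 : DifferentiableAt ℝ (fderiv ℝ H) y :=
    (hH.fderiv_right (m := ∞) (by simp)).differentiableAt (by simp)
  have hsymm : fderiv ℝ (fderiv ℝ H) y u v = fderiv ℝ (fderiv ℝ H) y v u :=
    (hH.isSymmSndFDerivAt (by simpa using two_le_infty)).eq u v
  have key : ∀ u v, fderiv ℝ (fderiv ℝ H) y u v w z =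
      H y (leviCivita H y u (leviCivita H y v w)) z +
        H y (leviCivita H y v w) (leviCivita H y u z) +
      H y (fderiv ℝ (leviCivita H) y u v w) z +
      (H y (leviCivita H y u w) (leviCivita H y v z) +
        H y w (leviCivita H y u (leviCivita H y v z)) +
      H y w (fderiv ℝ (leviCivita H) y u v z)) := by
    intro u v
    have h1 : fderiv ℝ (fun x => fderiv ℝ H x v w z) y u = fderiv ℝ (fderiv ℝ H) y u v w z := by
      rw [(((hH2.hasFDerivAt.clm_apply (hasFDerivAt_const v y)).clm_apply
        (hasFDerivAt_const w y)).clm_apply (hasFDerivAt_const z y)).fderiv]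
      simp
    have h2 : (fun x => fderiv ℝ H x v w z) =ᶠ[𝓝 y] fun x =>
        H x (leviCivita H x v w) z + H x w (leviCivita H x v z) := by
      filter_upwards [h.isOpen.mem_nhds hy] with x hx using h.compat hx v w z
    have hΓ : ∀ w, HasFDerivAt (fun x => leviCivita H x v w)
        (((fderiv ℝ (leviCivita H) y).flip v).flip w) y := by
      intro w
      refine ((hd.hasFDerivAt.clm_apply (hasFDerivAt_const v y)).clm_apply
        (hasFDerivAt_const w y)).congr_fderiv ?_
      ext; simp
    rw [← h1, h2.fderiv_eq, HasFDerivAt.fderiv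
      (((hH1.hasFDerivAt.clm_apply (hΓ w)).clm_apply (hasFDerivAt_const z y)).fun_add
      ((hH1.hasFDerivAt.clm_apply (hasFDerivAt_const w y)).clm_apply (hΓ z)))]
    simp [h.compat hy]
    ring
  have h1 := key u v
  have h2 := key v u
  rw [hsymm, h2] at h1
  simp only [curvatureForm, map_add, map_sub, add_apply, sub_apply]
  linarith

theorem curvatureForm_neg (H : E → E →L[ℝ] E →L[ℝ] ℝ) (y u v w : E) :
    curvatureForm (leviCivita H) y u v w = -curvatureForm (leviCivita H) y v u w := by
  simp only [curvatureForm]; abel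

/-- The Jacobi operator `a ↦ R(a, e) e` is self-adjoint. -/
theorem metric_curvatureForm_comm (h : IsLocalMetric O H) {y : E} (hy : y ∈ O) (a e b : E) :
    H y (curvatureForm (leviCivita H) y a e e) b =
      H y (curvatureForm (leviCivita H) y b e e) a := by
  have h1 := congrArg (fun x => H y x e) (h.curvatureForm_bianchi hy a e b)
  have h2 := h.metric_curvatureForm_antisymm hy b a e e
  have h3 := h.metric_curvatureForm_antisymm hy a e b e
  have h4 := h.metric_curvatureForm_antisymm hy b e a e
  simp only [map_add, add_apply, map_zero, zero_apply, curvatureForm_neg H y e b,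
    map_neg, neg_apply] at h1
  rw [h.symm y hy e] at h2
  rw [h.symm y hy b] at h3
  rw [h.symm y hy a] at h4
  linarith

theorem gram_pos (h : IsLocalMetric O H) {y : E} (hy : y ∈ O) {u v : E}
    (huv : LinearIndependent ℝ ![u, v]) : 0 < H y u u * H y v v - H y u v ^ 2 := by
  have hv : v ≠ 0 := huv.ne_zero 1
  have hvv := h.pos y hy v hv
  have hw : H y v v • u - H y u v • v ≠ 0 := by
    intro h0
    have := LinearIndependent.pair_iff.1 huv (H y v v) (-H y u v)
      (by rw [neg_smul, ← sub_eq_add_neg, h0])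
    exact hvv.ne' this.1
  have h1 := h.pos y hy _ hw
  have h2 : H y (H y v v • u - H y u v • v) (H y v v • u - H y u v • v) =
      H y v v * (H y u u * H y v v - H y u v ^ 2) := by
    simp [h.symm y hy v u]; ring
  rw [h2] at h1
  exact (mul_pos_iff_of_pos_left hvv).1 h1

/-- Constant sectional curvature determines the curvature tensor, by polarization. -/
theorem curvatureForm_of_constant (h : IsLocalMetric O H) {y : E} (hy : y ∈ O) {c : ℝ}
    (hc : ∀ u v : E, LinearIndependent ℝ ![u, v] →
      H y (curvatureForm (leviCivita H) y u v v) u / (H y u u * H y v v - H y u v ^ 2) = c)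
    (a e b : E) : H y (curvatureForm (leviCivita H) y a e e) b =
      c * (H y a b * H y e e - H y a e * H y b e) := by
  have hdiag : ∀ u, H y (curvatureForm (leviCivita H) y u e e) u =
      c * (H y u u * H y e e - H y u e ^ 2) := by
    intro u
    by_cases hli : LinearIndependent ℝ ![u, e]
    · exact (div_eq_iff (h.gram_pos hy hli).ne').1 (hc u e hli)
    · -- dependent vectors span no plane, but then both sides vanish
      have hzero : ∀ v t : ℝ, t • u + v • e = 0 → ¬ (t = 0 ∧ v = 0) →
          H y (curvatureForm (leviCivita H) y u e e) u =
            c * (H y u u * H y e e - H y u e ^ 2) := by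
        intro v t htv hne
        by_cases ht : t = 0
        · have hv : v ≠ 0 := fun hv => hne ⟨ht, hv⟩
          have he : e = 0 := by
            rw [ht, zero_smul, zero_add] at htv
            exact (smul_eq_zero.1 htv).resolve_left hv
          subst he
          simp [curvatureForm]
        · have hu : u = (-(v / t)) • e := by
            have h1 : t • u = -(v • e) := eq_neg_of_add_eq_zero_left htv
            have h2 : u = t⁻¹ • (t • u) := by rw [smul_smul, inv_mul_cancel₀ ht, one_smul]
            rw [h2, h1, smul_neg, smul_smul, neg_smul]
            congr 2; field_simp
          have h0 : curvatureForm (leviCivita H) y u e e = 0 := by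
            rw [hu]
            simp [curvatureForm]
          rw [h0, hu]
          simp
          ring_nf
          simp
      rw [LinearIndependent.pair_iff] at hli
      push Not at hli
      obtain ⟨t, v, h1, h2⟩ := hli
      exact hzero v t h1 fun h3 => h2 h3.1 h3.2
  have h1 := hdiag (a + b)
  have h2 := hdiag a
  have h3 := hdiag b
  have h4 := h.metric_curvatureForm_comm hy a e b
  have h5 : curvatureForm (leviCivita H) y (a + b) e e =
      curvatureForm (leviCivita H) y a e e + curvatureForm (leviCivita H) y b e e := by
    simp only [curvatureForm, map_add, add_apply]; abel
  rw [h5] at h1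
  simp only [map_add, add_apply] at h1
  rw [h.symm y hy b a] at h1
  linarith

end IsLocalMetric

end LocalMetric

section Chart

variable {E : Type*} [NormedAddCommGroup E] [NormedSpace ℝ E] [FiniteDimensional ℝ E]
  {P : Type*} [TopologicalSpace P] [ChartedSpace E P] [IsManifold 𝓘(ℝ, E) ∞ P]

theorem isLocalMetric_metricInChart (g : RiemMetric E P) (p : P) :
    IsLocalMetric (extChartAt 𝓘(ℝ, E) p).target (metricInChart g p) where
  isOpen := isOpen_extChartAt_target p
  smooth := contDiffOn_metricInChart g p
  symm y _ := metricInChart_symm g p y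
  pos _ hy _ := metricInChart_pos g hy

theorem christoffel_eq_leviCivita (g : RiemMetric E P) (p : P) (y v w : E) :
    christoffel g p y v w = leviCivita (metricInChart g p) y v w := rfl

theorem curvatureInChart_eq_curvatureForm (g : RiemMetric E P) (p : P) {y : E}
    (hy : y ∈ (extChartAt 𝓘(ℝ, E) p).target) (u v w : E) :
    curvatureInChart g p y u v w = curvatureForm (leviCivita (metricInChart g p)) y u v w := by
  have hd := (isLocalMetric_metricInChart g p).differentiableAt_leviCivita hy
  have h1 : ∀ u v, fderiv ℝ (fun z => christoffel g p z v w) y u =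
      fderiv ℝ (leviCivita (metricInChart g p)) y u v w := by
    intro u v
    have h2 : (fun z => christoffel g p z v w) =
      fun z => leviCivita (metricInChart g p) z v w := rfl
    rw [h2, ((hd.hasFDerivAt.clm_apply (hasFDerivAt_const v y)).clm_apply
        (hasFDerivAt_const w y)).fderiv]
    simp
  rw [curvatureInChart, h1, h1]
  rfl

/-- In the chart at `p` the curvature tensor is only known at the centre of the chart, which is where
sectional curvatures are evaluated. -/
theorem HasConstantSectionalCurvature.curvatureForm_eq {g : RiemMetric E P} {c : ℝ}
    (hc : HasConstantSectionalCurvature g c) (p : P) (a e b : E) :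
    metricInChart g p (extChartAt 𝓘(ℝ, E) p p) (curvatureForm (leviCivita (metricInChart g p))
        (extChartAt 𝓘(ℝ, E) p p) a e e) b =
      c * (metricInChart g p (extChartAt 𝓘(ℝ, E) p p) a b *
          metricInChart g p (extChartAt 𝓘(ℝ, E) p p) e e -
        metricInChart g p (extChartAt 𝓘(ℝ, E) p p) a e *
          metricInChart g p (extChartAt 𝓘(ℝ, E) p p) b e) := by
  refine (isLocalMetric_metricInChart g p).curvatureForm_of_constant (mem_extChartAt_target p) ?_
    a e b
  intro u v huv
  rw [← curvatureInChart_eq_curvatureForm g p (mem_extChartAt_target p)]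
  exact hc p u v huv

end Chart

/-! ### Hypersurfaces in a warped product -/

section Warped

theorem fderiv_apply_const {V X Y : Type*} [NormedAddCommGroup V] [NormedSpace ℝ V]
    [NormedAddCommGroup X] [NormedSpace ℝ X] [NormedAddCommGroup Y] [NormedSpace ℝ Y]
    {A : V → X →L[ℝ] Y} {z : V} (hA : DifferentiableAt ℝ A z) (v : V) (x : X) :
    fderiv ℝ A z v x = fderiv ℝ (fun z => A z x) z v := by
  rw [(hA.hasFDerivAt.clm_apply (hasFDerivAt_const x z)).fderiv]
  simp

theorem fderiv_apply_const₂ {V X Y Z : Type*} [NormedAddCommGroup V] [NormedSpace ℝ V]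
    [NormedAddCommGroup X] [NormedSpace ℝ X] [NormedAddCommGroup Y] [NormedSpace ℝ Y]
    [NormedAddCommGroup Z] [NormedSpace ℝ Z]
    {A : V → X →L[ℝ] Y →L[ℝ] Z} {z : V} (hA : DifferentiableAt ℝ A z) (v : V) (x : X) (y : Y) :
    fderiv ℝ A z v x y = fderiv ℝ (fun z => A z x y) z v := by
  rw [fderiv_apply_const hA, fderiv_apply_const (hA.clm_apply (differentiableAt_const x))]

variable {V : Type*} [NormedAddCommGroup V] [NormedSpace ℝ V]
  {E : Type*} [NormedAddCommGroup E] [NormedSpace ℝ E] [FiniteDimensional ℝ E]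

/-- The metric of the warped product `dr² + lam(r)² H` at a point, in the frame in which a tangent
vector `(a₀, a)` is represented by `(a₀, lam(r) a)`: it no longer involves `lam`. -/
noncomputable def warpedMetric (h : E →L[ℝ] E →L[ℝ] ℝ) : ℝ × E →L[ℝ] ℝ × E →L[ℝ] ℝ :=
  (ContinuousLinearMap.mul ℝ ℝ).bilinearComp (ContinuousLinearMap.fst ℝ ℝ E)
      (ContinuousLinearMap.fst ℝ ℝ E) +
    h.bilinearComp (ContinuousLinearMap.snd ℝ ℝ E) (ContinuousLinearMap.snd ℝ ℝ E)

theorem warpedMetric_apply (h : E →L[ℝ] E →L[ℝ] ℝ) (a b : ℝ × E) :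
    warpedMetric h a b = a.1 * b.1 + h a.2 b.2 := by
  simp [warpedMetric]

/-- The differential of the map `(ρ, y)` in the rescaled frame. -/
noncomputable def warpedDifferential (lam : ℝ → ℝ) (ρ : V → ℝ) (y : V → E) (z : V) :
    V →L[ℝ] ℝ × E :=
  (fderiv ℝ ρ z).prod (lam (ρ z) • fderiv ℝ y z)

theorem warpedDifferential_apply (lam : ℝ → ℝ) (ρ : V → ℝ) (y : V → E) (z v : V) :
    warpedDifferential lam ρ y z v = (fderiv ℝ ρ z v, lam (ρ z) • fderiv ℝ y z v) := rfl

/-- The Levi-Civita connection of the warped product in the rescaled frame, as a bilinear map of the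
`N`-component `b` of the direction and the field `a`; `h` and `Γ` are the metric and the connection
of the fibre, and `m` is the derivative of the warping function. The rescaled frame is parallel in
the radial direction, so the radial component of the direction does not enter. -/
noncomputable def warpedConnection (m : ℝ) (h : E →L[ℝ] E →L[ℝ] ℝ) (Γ : E →L[ℝ] E →L[ℝ] E) :
    E →L[ℝ] ℝ × E →L[ℝ] ℝ × E :=
  LinearMap.toContinuousLinearMap
    ((LinearMap.toContinuousLinearMap : (ℝ × E →ₗ[ℝ] ℝ × E) ≃ₗ[ℝ] _).toLinearMap ∘ₗ
      LinearMap.mk₂ ℝ (fun (b : E) (a : ℝ × E) => (-m * h b a.2, Γ b a.2 + (m * a.1) • b))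
        (fun b b' a => by ext <;> simp <;> [ring; module])
        (fun t b a => by ext <;> simp <;> [ring; module])
        (fun b a a' => by ext <;> simp <;> [ring; module])
        (fun t b a => by ext <;> simp <;> [ring; module]))

/-- The connection form along the map `(ρ, y)` into the warped product. -/
noncomputable def warpedForm (lam : ℝ → ℝ) (H : E → E →L[ℝ] E →L[ℝ] ℝ) (ρ : V → ℝ) (y : V → E)
    (z : V) : V →L[ℝ] ℝ × E →L[ℝ] ℝ × E :=
  (warpedConnection (deriv lam (ρ z)) (H (y z)) (leviCivita H (y z))).comp (fderiv ℝ y z)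

theorem warpedForm_apply (lam : ℝ → ℝ) (H : E → E →L[ℝ] E →L[ℝ] ℝ) (ρ : V → ℝ) (y : V → E)
    (z v : V) (a : ℝ × E) : warpedForm lam H ρ y z v a =
      (-deriv lam (ρ z) * H (y z) (fderiv ℝ y z v) a.2,
        leviCivita H (y z) (fderiv ℝ y z v) a.2 + (deriv lam (ρ z) * a.1) • fderiv ℝ y z v) := rfl

/-- A hypersurface `z ↦ (ρ z, y z)` of the warped product `dr² + lam(r)² H` over `J × O`, with unit
normal `(ν₀, ν₁ / lam)`. -/
structure IsWarpedHypersurface (U : Set V) (J : Set ℝ) (O : Set E)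
    (H : E → E →L[ℝ] E →L[ℝ] ℝ) (lam : ℝ → ℝ) (ρ : V → ℝ) (y : V → E) (ν : V → ℝ × E) : Prop where
  isOpen : IsOpen U
  isOpen_interval : IsOpen J
  metric : IsLocalMetric O H
  smooth_warp : ContDiffOn ℝ ∞ lam J
  warp_pos : ∀ r ∈ J, 0 < lam r
  smooth_radius : ContDiffOn ℝ ∞ ρ U
  smooth_fibre : ContDiffOn ℝ ∞ y U
  smooth_normal : ContDiffOn ℝ ∞ ν U
  mapsTo_radius : MapsTo ρ U J
  mapsTo_fibre : MapsTo y U O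
  injective : ∀ z ∈ U, Function.Injective (warpedDifferential lam ρ y z)
  unit : ∀ z ∈ U, warpedMetric (H (y z)) (ν z) (ν z) = 1
  normal : ∀ z ∈ U, ∀ v, warpedMetric (H (y z)) (ν z) (warpedDifferential lam ρ y z v) = 0

namespace IsWarpedHypersurface

variable {U : Set V} {J : Set ℝ} {O : Set E} {H : E → E →L[ℝ] E →L[ℝ] ℝ} {lam : ℝ → ℝ}
  {ρ : V → ℝ} {y : V → E} {ν : V → ℝ × E}

theorem contDiffOn_deriv_warp (h : IsWarpedHypersurface U J O H lam ρ y ν) :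
    ContDiffOn ℝ ∞ (deriv lam) J :=
  h.smooth_warp.deriv_of_isOpen h.isOpen_interval (by simp)

theorem differentiableAt_of_contDiffOn (h : IsWarpedHypersurface U J O H lam ρ y ν)
    {X : Type*} [NormedAddCommGroup X] [NormedSpace ℝ X] {A : V → X} (hA : ContDiffOn ℝ ∞ A U)
    {z : V} (hz : z ∈ U) : DifferentiableAt ℝ A z :=
  (hA.contDiffAt (h.isOpen.mem_nhds hz)).differentiableAt (by simp)

theorem contDiffOn_fderiv_apply (h : IsWarpedHypersurface U J O H lam ρ y ν)
    {X : Type*} [NormedAddCommGroup X] [NormedSpace ℝ X] {A : V → X} (hA : ContDiffOn ℝ ∞ A U)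
    (v : V) : ContDiffOn ℝ ∞ (fun z => fderiv ℝ A z v) U :=
  (hA.fderiv_of_isOpen h.isOpen (by simp)).clm_apply contDiffOn_const

theorem contDiffOn_metric (h : IsWarpedHypersurface U J O H lam ρ y ν) :
    ContDiffOn ℝ ∞ (fun z => H (y z)) U :=
  h.metric.smooth.comp h.smooth_fibre h.mapsTo_fibre

theorem contDiffOn_leviCivita (h : IsWarpedHypersurface U J O H lam ρ y ν) :
    ContDiffOn ℝ ∞ (fun z => leviCivita H (y z)) U :=
  h.metric.contDiffOn_leviCivita.comp h.smooth_fibre h.mapsTo_fibre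

theorem contDiffOn_warp (h : IsWarpedHypersurface U J O H lam ρ y ν) :
    ContDiffOn ℝ ∞ (fun z => lam (ρ z)) U :=
  h.smooth_warp.comp h.smooth_radius h.mapsTo_radius

theorem contDiffOn_deriv_warp_comp (h : IsWarpedHypersurface U J O H lam ρ y ν) :
    ContDiffOn ℝ ∞ (fun z => deriv lam (ρ z)) U :=
  h.contDiffOn_deriv_warp.comp h.smooth_radius h.mapsTo_radius

theorem contDiffOn_warpedMetric (h : IsWarpedHypersurface U J O H lam ρ y ν) :
    ContDiffOn ℝ ∞ (fun z => warpedMetric (H (y z))) U := by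
  rw [contDiffOn_clm_apply]; intro a
  rw [contDiffOn_clm_apply]; intro b
  simp only [warpedMetric_apply]
  exact contDiffOn_const.add
    ((h.contDiffOn_metric.clm_apply contDiffOn_const).clm_apply contDiffOn_const)

theorem contDiffOn_warpedDifferential [FiniteDimensional ℝ V]
    (h : IsWarpedHypersurface U J O H lam ρ y ν) :
    ContDiffOn ℝ ∞ (warpedDifferential lam ρ y) U := by
  rw [contDiffOn_clm_apply]; intro v
  simp only [warpedDifferential_apply]
  exact (h.contDiffOn_fderiv_apply h.smooth_radius v).prodMk
    (h.contDiffOn_warp.smul (h.contDiffOn_fderiv_apply h.smooth_fibre v))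

theorem contDiffOn_warpedForm [FiniteDimensional ℝ V]
    (h : IsWarpedHypersurface U J O H lam ρ y ν) :
    ContDiffOn ℝ ∞ (warpedForm lam H ρ y) U := by
  rw [contDiffOn_clm_apply]; intro v
  rw [contDiffOn_clm_apply]; intro a
  simp only [warpedForm_apply]
  have hy := h.contDiffOn_fderiv_apply h.smooth_fibre v
  exact (h.contDiffOn_deriv_warp_comp.neg.mul
    ((h.contDiffOn_metric.clm_apply hy).clm_apply contDiffOn_const)).prodMk
    (((h.contDiffOn_leviCivita.clm_apply hy).clm_apply contDiffOn_const).add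
      ((h.contDiffOn_deriv_warp_comp.mul contDiffOn_const).smul hy))

theorem hasFDerivAt_comp_radius (h : IsWarpedHypersurface U J O H lam ρ y ν) {f : ℝ → ℝ}
    (hf : ContDiffOn ℝ ∞ f J) {z : V} (hz : z ∈ U) :
    HasFDerivAt (fun z => f (ρ z)) (deriv f (ρ z) • fderiv ℝ ρ z) z := by
  have h1 : DifferentiableAt ℝ f (ρ z) :=
    (hf.contDiffAt (h.isOpen_interval.mem_nhds (h.mapsTo_radius hz))).differentiableAt (by simp)
  exact h1.hasDerivAt.comp_hasFDerivAt z
    (h.differentiableAt_of_contDiffOn h.smooth_radius hz).hasFDerivAt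

/-- The connection form of the warped product is metric. -/
theorem compat (h : IsWarpedHypersurface U J O H lam ρ y ν) {z : V} (hz : z ∈ U) (v : V)
    (a b : ℝ × E) : fderiv ℝ (fun z => warpedMetric (H (y z))) z v a b =
      warpedMetric (H (y z)) (warpedForm lam H ρ y z v a) b +
        warpedMetric (H (y z)) a (warpedForm lam H ρ y z v b) := by
  rw [fderiv_apply_const₂ (h.differentiableAt_of_contDiffOn h.contDiffOn_warpedMetric hz)]
  have hy := (h.differentiableAt_of_contDiffOn h.smooth_fibre hz).hasFDerivAt
  have hO := h.mapsTo_fibre hz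
  have hH := ((h.metric.contDiffAt hO).differentiableAt (by simp)).hasFDerivAt
  have h1 := (((hH.comp z hy).clm_apply (hasFDerivAt_const a.2 z)).clm_apply
    (hasFDerivAt_const b.2 z)).const_add (a.1 * b.1)
  have h2 : (fun z => warpedMetric (H (y z)) a b) =
      fun z => a.1 * b.1 + (H ∘ y) z a.2 b.2 := by
    ext z; rw [warpedMetric_apply]; rfl
  rw [h2, h1.fderiv]
  simp [warpedMetric_apply, warpedForm_apply, h.metric.compat hO,
    h.metric.symm _ hO _ (fderiv ℝ y z v)]
  ring

theorem fderiv_fderiv_symm (h : IsWarpedHypersurface U J O H lam ρ y ν)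
    {X : Type*} [NormedAddCommGroup X] [NormedSpace ℝ X] {A : V → X} (hA : ContDiffOn ℝ ∞ A U)
    {z : V} (hz : z ∈ U) (v w : V) :
    fderiv ℝ (fun z => fderiv ℝ A z w) z v = fderiv ℝ (fun z => fderiv ℝ A z v) z w := by
  have hA' := hA.contDiffAt (h.isOpen.mem_nhds hz)
  have hd : DifferentiableAt ℝ (fderiv ℝ A) z :=
    (hA'.fderiv_right (m := ∞) (by simp)).differentiableAt (by simp)
  rw [← fderiv_apply_const hd, ← fderiv_apply_const hd]
  exact (hA'.isSymmSndFDerivAt (by simpa using two_le_infty)).eq v w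

theorem torsion_free [FiniteDimensional ℝ V] (h : IsWarpedHypersurface U J O H lam ρ y ν)
    {z : V} (hz : z ∈ U) (v w : V) :
    fderiv ℝ (warpedDifferential lam ρ y) z v w +
        warpedForm lam H ρ y z v (warpedDifferential lam ρ y z w) =
      fderiv ℝ (warpedDifferential lam ρ y) z w v +
        warpedForm lam H ρ y z w (warpedDifferential lam ρ y z v) := by
  have hd := h.differentiableAt_of_contDiffOn h.contDiffOn_warpedDifferential hz
  have hO := h.mapsTo_fibre hz
  have key : ∀ v w, fderiv ℝ (fun z => warpedDifferential lam ρ y z w) z v =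
      (fderiv ℝ (fun z => fderiv ℝ ρ z w) z v,
        lam (ρ z) • fderiv ℝ (fun z => fderiv ℝ y z w) z v +
          (deriv lam (ρ z) * fderiv ℝ ρ z v) • fderiv ℝ y z w) := by
    intro v w
    have h1 := (h.differentiableAt_of_contDiffOn
      (h.contDiffOn_fderiv_apply h.smooth_radius w) hz).hasFDerivAt
    have h2 := (h.differentiableAt_of_contDiffOn
      (h.contDiffOn_fderiv_apply h.smooth_fibre w) hz).hasFDerivAt
    have h3 := h1.prodMk ((h.hasFDerivAt_comp_radius h.smooth_warp hz).fun_smul h2)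
    have h4 : (fun z => warpedDifferential lam ρ y z w) =
      fun z => (fderiv ℝ ρ z w, lam (ρ z) • fderiv ℝ y z w) := rfl
    rw [h4, h3.fderiv]
    simp
  rw [fderiv_apply_const hd, fderiv_apply_const hd, key, key,
    h.fderiv_fderiv_symm h.smooth_radius hz v w, h.fderiv_fderiv_symm h.smooth_fibre hz v w]
  simp only [warpedForm_apply, warpedDifferential_apply, map_smul]
  rw [h.metric.leviCivita_symm hO (fderiv ℝ y z w),
    h.metric.symm _ hO (fderiv ℝ y z w)]
  ext
  · simp
  · simp only [Prod.snd_add]; module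

/-- The field `lam ∂_r` is closed and conformal, with factor the derivative of `lam`. -/
theorem conformal (h : IsWarpedHypersurface U J O H lam ρ y ν) {z : V} (hz : z ∈ U) (v : V) :
    covDeriv (warpedForm lam H ρ y) v (fun z => (lam (ρ z), (0 : E))) z =
      deriv lam (ρ z) • warpedDifferential lam ρ y z v := by
  have h1 := (h.hasFDerivAt_comp_radius h.smooth_warp hz).prodMk (hasFDerivAt_const (0 : E) z)
  rw [covDeriv, h1.fderiv, warpedForm_apply, warpedDifferential_apply]
  ext
  · simp
  · simp [smul_smul]

/-- The tangent space and the normal span the ambient space, by a dimension count. -/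
theorem span [FiniteDimensional ℝ V] (h : IsWarpedHypersurface U J O H lam ρ y ν)
    (hdim : Module.finrank ℝ V = Module.finrank ℝ E) {z : V} (hz : z ∈ U) (a : ℝ × E) :
    ∃ (T : V) (c : ℝ), a = warpedDifferential lam ρ y z T + c • ν z := by
  set L : V × ℝ →ₗ[ℝ] ℝ × E :=
    (warpedDifferential lam ρ y z : V →ₗ[ℝ] ℝ × E).coprod (LinearMap.toSpanSingleton ℝ _ (ν z))
  have hL : ∀ T c, L (T, c) = warpedDifferential lam ρ y z T + c • ν z := fun T c => by
    simp [L]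
  have hinj : Function.Injective L := by
    rw [injective_iff_map_eq_zero]
    rintro ⟨T, c⟩ hTc
    rw [hL] at hTc
    have h1 := congrArg (warpedMetric (H (y z)) (ν z)) hTc
    rw [map_add, map_smul, h.normal z hz, h.unit z hz] at h1
    simp at h1
    subst h1
    have h2 : warpedDifferential lam ρ y z T = warpedDifferential lam ρ y z 0 := by
      simpa using hTc
    simpa using h.injective z hz h2
  have hfin : Module.finrank ℝ (V × ℝ) = Module.finrank ℝ (ℝ × E) := by
    simp [hdim, add_comm]
  obtain ⟨⟨T, c⟩, hTc⟩ := (LinearMap.injective_iff_surjective_of_finrank_eq_finrank hfin).1 hinj a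
  exact ⟨T, c, by rw [← hTc, hL]⟩

theorem isHypersurfaceModel [FiniteDimensional ℝ V] (h : IsWarpedHypersurface U J O H lam ρ y ν)
    (hdim : Module.finrank ℝ V = Module.finrank ℝ E) :
    IsHypersurfaceModel U (fun z => warpedMetric (H (y z))) (warpedDifferential lam ρ y)
      (warpedForm lam H ρ y) ν (fun z => (lam (ρ z), (0 : E))) (fun z => deriv lam (ρ z)) where
  isOpen := h.isOpen
  smooth_metric := h.contDiffOn_warpedMetric
  smooth_differential := h.contDiffOn_warpedDifferential
  smooth_connection := h.contDiffOn_warpedForm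
  smooth_normal := h.smooth_normal
  smooth_field := h.contDiffOn_warp.prodMk contDiffOn_const
  symm z hz a b := by
    rw [warpedMetric_apply, warpedMetric_apply, h.metric.symm _ (h.mapsTo_fibre hz)]; ring
  compat z hz := h.compat hz
  torsion_free z hz := h.torsion_free hz
  conformal z hz := h.conformal hz
  unit := h.unit
  normal := h.normal
  span z hz := h.span hdim hz

/-- The curvature of the warped product, in terms of the curvature of the fibre and of the warping
function. -/
theorem curvatureForm_eq [FiniteDimensional ℝ V] (h : IsWarpedHypersurface U J O H lam ρ y ν)
    {z : V} (hz : z ∈ U) (v w : V) (a : ℝ × E) :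
    curvatureForm (warpedForm lam H ρ y) z v w a =
      (-deriv (deriv lam) (ρ z) * (fderiv ℝ ρ z v * H (y z) (fderiv ℝ y z w) a.2 -
          fderiv ℝ ρ z w * H (y z) (fderiv ℝ y z v) a.2),
        curvatureForm (leviCivita H) (y z) (fderiv ℝ y z v) (fderiv ℝ y z w) a.2 +
          (deriv (deriv lam) (ρ z) * a.1) •
            (fderiv ℝ ρ z v • fderiv ℝ y z w - fderiv ℝ ρ z w • fderiv ℝ y z v) -
          deriv lam (ρ z) ^ 2 • (H (y z) (fderiv ℝ y z w) a.2 • fderiv ℝ y z v -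
            H (y z) (fderiv ℝ y z v) a.2 • fderiv ℝ y z w)) := by
  have hd := h.differentiableAt_of_contDiffOn h.contDiffOn_warpedForm hz
  have hO := h.mapsTo_fibre hz
  have hy := (h.differentiableAt_of_contDiffOn h.smooth_fibre hz).hasFDerivAt
  have hH := ((h.metric.contDiffAt hO).differentiableAt (by simp)).hasFDerivAt
  have hΓ := (h.metric.differentiableAt_leviCivita hO).hasFDerivAt
  have key : ∀ v w, fderiv ℝ (fun z => warpedForm lam H ρ y z w a) z v =
      (-(deriv (deriv lam) (ρ z) * fderiv ℝ ρ z v) * H (y z) (fderiv ℝ y z w) a.2 -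
          deriv lam (ρ z) * (fderiv ℝ H (y z) (fderiv ℝ y z v) (fderiv ℝ y z w) a.2 +
            H (y z) (fderiv ℝ (fun z => fderiv ℝ y z w) z v) a.2),
        fderiv ℝ (leviCivita H) (y z) (fderiv ℝ y z v) (fderiv ℝ y z w) a.2 +
          leviCivita H (y z) (fderiv ℝ (fun z => fderiv ℝ y z w) z v) a.2 +
          ((deriv (deriv lam) (ρ z) * fderiv ℝ ρ z v) * a.1) • fderiv ℝ y z w +
          (deriv lam (ρ z) * a.1) • fderiv ℝ (fun z => fderiv ℝ y z w) z v) := by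
    intro v w
    have h1 := h.hasFDerivAt_comp_radius h.contDiffOn_deriv_warp hz
    have h2 := (h.differentiableAt_of_contDiffOn
      (h.contDiffOn_fderiv_apply h.smooth_fibre w) hz).hasFDerivAt
    have h3 := (((hH.comp z hy).clm_apply h2).clm_apply (hasFDerivAt_const a.2 z))
    have h4 := (((hΓ.comp z hy).clm_apply h2).clm_apply (hasFDerivAt_const a.2 z))
    have h5 := (h1.fun_neg.fun_mul h3).prodMk (h4.fun_add ((h1.mul_const a.1).fun_smul h2))
    have h6 : (fun z => warpedForm lam H ρ y z w a) =
      fun z => (-deriv lam (ρ z) * (H ∘ y) z (fderiv ℝ y z w) a.2,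
        (leviCivita H ∘ y) z (fderiv ℝ y z w) a.2 +
          (deriv lam (ρ z) * a.1) • fderiv ℝ y z w) := rfl
    rw [h6, h5.fderiv]
    ext
    · simp; ring
    · simp; module
  rw [curvatureForm, fderiv_apply_const₂ hd, fderiv_apply_const₂ hd, key, key,
    h.fderiv_fderiv_symm h.smooth_fibre hz v w]
  simp only [warpedForm_apply]
  have h1 := h.metric.compat hO (fderiv ℝ y z v) (fderiv ℝ y z w) a.2
  have h2 := h.metric.compat hO (fderiv ℝ y z w) (fderiv ℝ y z v) a.2
  have h3 := h.metric.leviCivita_symm hO (fderiv ℝ y z w) (fderiv ℝ y z v)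
  have h4 := h.metric.symm _ hO (fderiv ℝ y z w) (fderiv ℝ y z v)
  ext
  · simp only [Prod.fst_add, Prod.fst_sub, map_add, map_smul, smul_eq_mul, h1, h2, h3, h4]
    ring
  · simp only [Prod.snd_add, Prod.snd_sub, map_add, map_smul, curvatureForm, h3]
    module

/-- The curvature term in the equation for the support function has a sign: it is a nonnegative
multiple of the quantity in `hlam`, times a Cauchy-Schwarz defect for `e` and the tangential part
`T` of the conformal field. -/
theorem curvature_nonpos [FiniteDimensional ℝ V] (h : IsWarpedHypersurface U J O H lam ρ y ν)
    {z : V} (hz : z ∈ U) {c : ℝ}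
    (hc : ∀ a e b : E, H (y z) (curvatureForm (leviCivita H) (y z) a e e) b =
      c * (H (y z) a b * H (y z) e e - H (y z) a e * H (y z) b e))
    (hlam : 0 ≤ deriv (deriv lam) (ρ z) / lam (ρ z) +
      (c - deriv lam (ρ z) ^ 2) / lam (ρ z) ^ 2) (hν : 0 ≤ (ν z).1) {T : V} {u : ℝ}
    (hT : (lam (ρ z), (0 : E)) = warpedDifferential lam ρ y z T + u • ν z) (e : V) :
    warpedMetric (H (y z)) (curvatureForm (warpedForm lam H ρ y) z e T (ν z))
      (warpedDifferential lam ρ y z e) ≤ 0 := by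
  have hO := h.mapsTo_fibre hz
  have hl := h.warp_pos _ (h.mapsTo_radius hz)
  set l := lam (ρ z) with hl_def
  set m := deriv lam (ρ z)
  set q := deriv (deriv lam) (ρ z)
  set ye := fderiv ℝ y z e with hye
  set yT := fderiv ℝ y z T with hyT
  set re := fderiv ℝ ρ z e with hre
  set rT := fderiv ℝ ρ z T with hrT
  have hsymm := h.metric.symm _ hO
  have hq : 0 ≤ l * q + (c - m ^ 2) := by
    have h1 : l * q + (c - m ^ 2) = l ^ 2 * (q / l + (c - m ^ 2) / l ^ 2) := by field_simp
    rw [h1]; positivity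
  -- normality, and the tangential part of the conformal field
  have hNe : (ν z).1 * re + l * H (y z) (ν z).2 ye = 0 := by
    simpa [warpedMetric_apply, warpedDifferential_apply] using h.normal z hz e
  have hNT : (ν z).1 * rT + l * H (y z) (ν z).2 yT = 0 := by
    simpa [warpedMetric_apply, warpedDifferential_apply] using h.normal z hz T
  have hIT : ∀ v, l * fderiv ℝ ρ z v =
      rT * fderiv ℝ ρ z v + l ^ 2 * H (y z) yT (fderiv ℝ y z v) := by
    intro v
    have h1 := congrArg (fun b => warpedMetric (H (y z)) b (warpedDifferential lam ρ y z v)) hT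
    simp only [map_add, map_smul, add_apply, smul_apply, h.normal z hz] at h1
    simp only [warpedMetric_apply, warpedDifferential_apply, ← hl_def, ← hrT, ← hyT, map_smul,
      smul_apply, smul_eq_mul, map_zero, zero_apply] at h1
    linarith
  have hTe := hIT e
  have hTT := hIT T
  rw [← hrT, ← hyT] at hTT
  rw [← hre, ← hye] at hTe
  -- the Cauchy-Schwarz inequality for the first fundamental form
  have hCS : (l * re) ^ 2 ≤ (l * rT) * (re ^ 2 + l ^ 2 * H (y z) ye ye) := by
    have hnonneg : ∀ s : ℝ, 0 ≤ (re ^ 2 + l ^ 2 * H (y z) ye ye) * (s * s) +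
        (2 * (l * re)) * s + l * rT := by
      intro s
      have h1 : 0 ≤ H (y z) (yT + s • ye) (yT + s • ye) := by
        by_cases h0 : yT + s • ye = 0
        · simp [h0]
        · exact (h.metric.pos _ hO _ h0).le
      simp only [map_add, map_smul, add_apply, smul_apply, smul_eq_mul] at h1
      rw [hsymm ye yT] at h1
      have h2 := mul_nonneg (sq_nonneg l) h1
      have h3 := sq_nonneg (rT + s * re)
      linear_combination h2 + h3 - 2 * s * hTe - hTT
    have := discrim_le_zero hnonneg
    rw [discrim] at this
    linarith
  have hR : H (y z) (curvatureForm (leviCivita H) (y z) ye yT (ν z).2) ye =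
      c * (H (y z) yT (ν z).2 * H (y z) ye ye - H (y z) yT ye * H (y z) (ν z).2 ye) := by
    have h1 := h.metric.metric_curvatureForm_antisymm hO ye yT (ν z).2 ye
    rw [IsLocalMetric.curvatureForm_neg H (y z) ye yT ye, map_neg,
      hsymm (ν z).2 (curvatureForm (leviCivita H) (y z) yT ye ye), hc] at h1
    linarith
  have hval : warpedMetric (H (y z)) (curvatureForm (warpedForm lam H ρ y) z e T (ν z))
      (warpedDifferential lam ρ y z e) =
      (l * q + (c - m ^ 2)) * ((ν z).1 * (re * H (y z) yT ye - rT * H (y z) ye ye)) := by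
    rw [h.curvatureForm_eq hz, warpedMetric_apply, warpedDifferential_apply]
    simp only [map_add, map_sub, map_smul, add_apply, sub_apply, smul_apply, smul_eq_mul]
    rw [hR, hsymm ye (ν z).2, hsymm yT (ν z).2]
    have e1 : H (y z) (ν z).2 ye = -((ν z).1 * re) / l := by
      rw [eq_div_iff hl.ne']; linarith
    have e2 : H (y z) (ν z).2 yT = -((ν z).1 * rT) / l := by
      rw [eq_div_iff hl.ne']; linarith
    rw [e1, e2]
    field_simp
    ring
  rw [hval]
  refine mul_nonpos_of_nonneg_of_nonpos hq (mul_nonpos_of_nonneg_of_nonpos hν ?_)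
  have h1 : l ^ 3 * (re * H (y z) yT ye - rT * H (y z) ye ye) ≤ 0 := by
    have h2 : l ^ 3 * (re * H (y z) yT ye - rT * H (y z) ye ye) =
        (l * re) ^ 2 - (l * rT) * (re ^ 2 + l ^ 2 * H (y z) ye ye) := by
      have h3 : l ^ 2 * H (y z) yT ye = l * re - rT * re := by linarith
      calc _ = l * re * (l ^ 2 * H (y z) yT ye) - l ^ 3 * (rT * H (y z) ye ye) := by ring
        _ = _ := by rw [h3]; ring
    linarith
  by_contra hcon
  push Not at hcon
  have := mul_pos (pow_pos hl 3) hcon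
  linarith

end IsWarpedHypersurface

end Warped

/-! ### The second fundamental form in arbitrary coordinates -/

section Coordinates

/-- The derivative of `G (a, b)` at `x` when the base point moves with velocity `n` and the vectors
`a`, `b` move with velocities `a'`, `b'`. Applied to the normal field and to the differential of an
immersion, it is twice the second fundamental form; it is natural under diffeomorphisms. -/
noncomputable def metricVariation {D : Type*} [NormedAddCommGroup D] [NormedSpace ℝ D]
    (G : D → D →L[ℝ] D →L[ℝ] ℝ) (x n a b a' b' : D) : ℝ :=
  fderiv ℝ G x n a b + G x a' b + G x a b'

/-- Naturality of `metricVariation` under a change of coordinates `σ`. The velocities transform with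
a second derivative of `σ`, which is absorbed by the derivative of the metric because it is
symmetric. -/
theorem metricVariation_pullback {D E : Type*} [NormedAddCommGroup D] [NormedSpace ℝ D]
    [NormedAddCommGroup E] [NormedSpace ℝ E] {G : E → E →L[ℝ] E →L[ℝ] ℝ}
    {W : D → D →L[ℝ] D →L[ℝ] ℝ} {σ : D → E} {x : D} (hσ : ContDiffAt ℝ 2 σ x)
    (hG : DifferentiableAt ℝ G (σ x)) (hW : DifferentiableAt ℝ W x)
    (h : ∀ᶠ y in 𝓝 x, ∀ a b, W y a b = G (σ y) (fderiv ℝ σ y a) (fderiv ℝ σ y b))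
    (n a b a' b' : D) :
    metricVariation G (σ x) (fderiv ℝ σ x n) (fderiv ℝ σ x a) (fderiv ℝ σ x b)
      (fderiv ℝ (fderiv ℝ σ) x a n + fderiv ℝ σ x a')
      (fderiv ℝ (fderiv ℝ σ) x b n + fderiv ℝ σ x b') = metricVariation W x n a b a' b' := by
  have hd : HasFDerivAt σ (fderiv ℝ σ x) x := (hσ.differentiableAt (by simp)).hasFDerivAt
  have hd2 : HasFDerivAt (fderiv ℝ σ) (fderiv ℝ (fderiv ℝ σ) x) x :=
    ((hσ.fderiv_right (m := 1) (by norm_num)).differentiableAt (by simp)).hasFDerivAt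
  have hsymm := hσ.isSymmSndFDerivAt (by simp)
  have h1 : (fun y => W y a b) =ᶠ[𝓝 x] fun y => (G ∘ σ) y (fderiv ℝ σ y a) (fderiv ℝ σ y b) := by
    filter_upwards [h] with y hy using hy a b
  have h2 := (((hG.hasFDerivAt.comp x hd).clm_apply (hd2.clm_apply (hasFDerivAt_const a x))).clm_apply
    (hd2.clm_apply (hasFDerivAt_const b x)))
  have h3 : fderiv ℝ W x n a b = fderiv ℝ (fun y => W y a b) x n := fderiv_apply_const₂ hW n a b
  rw [metricVariation, metricVariation, h3, h1.fderiv_eq, h2.fderiv, h.self_of_nhds, h.self_of_nhds,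
    hsymm.eq a n, hsymm.eq b n]
  simp
  ring

/-- The ordinary derivatives in `metricVariation` may be replaced by covariant ones. -/
theorem IsLocalMetric.metricVariation_eq {E : Type*} [NormedAddCommGroup E] [NormedSpace ℝ E]
    [FiniteDimensional ℝ E] {O : Set E} {H : E → E →L[ℝ] E →L[ℝ] ℝ} (h : IsLocalMetric O H) {y : E}
    (hy : y ∈ O) (n a b a' b' : E) : metricVariation H y n a b a' b' =
      H y (a' + leviCivita H y a n) b + H y a (b' + leviCivita H y b n) := by
  rw [metricVariation, h.compat hy, h.leviCivita_symm hy n a, h.leviCivita_symm hy n b]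
  simp only [map_add, add_apply]
  ring

variable {E : Type*} [NormedAddCommGroup E] [NormedSpace ℝ E]
  {F : Type*} [NormedAddCommGroup F] [NormedSpace ℝ F]
  {Q : Type*} [TopologicalSpace Q] [ChartedSpace E Q] [IsManifold 𝓘(ℝ, E) ∞ Q]
  {M : Type*} [TopologicalSpace M] [ChartedSpace F M] [IsManifold 𝓘(ℝ, F) ∞ M]
  {D : Type*} [NormedAddCommGroup D] [NormedSpace ℝ D]

/-- The coordinates of the tangent vector `v` at `q` with respect to the map `K` into a vector
space, i.e. its image under the differential of `K`. -/
noncomputable def tangentCoord (K : Q → D) (q : Q) (v : TangentSpace 𝓘(ℝ, E) q) : D :=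
  mfderiv 𝓘(ℝ, E) 𝓘(ℝ, D) K q v

/-- The tangent vector which is the image of `a` under the differential at `x` of the map `C` from a
vector space. -/
noncomputable def tangentVector (C : D → Q) (x a : D) : TangentSpace 𝓘(ℝ, E) (C x) :=
  mfderiv 𝓘(ℝ, D) 𝓘(ℝ, E) C x a

theorem contMDiffOn_extChartAt_source (p : Q) :
    ContMDiffOn 𝓘(ℝ, E) 𝓘(ℝ, E) ∞ (extChartAt 𝓘(ℝ, E) p) (extChartAt 𝓘(ℝ, E) p).source :=
  fun _ hq => (contMDiffAt_extChartAt_of_mem hq).contMDiffWithinAt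

/-- `K : S → T` is a smooth coordinate system on the open subset `S` of the manifold `Q`, with
inverse `C` and with values in the open subset `T` of the vector space `D`. -/
structure IsCoordinateSystem (S : Set Q) (T : Set D) (K : Q → D) (C : D → Q) : Prop where
  isOpen_source : IsOpen S
  isOpen_target : IsOpen T
  smooth : ContMDiffOn 𝓘(ℝ, E) 𝓘(ℝ, D) ∞ K S
  smooth_inv : ContMDiffOn 𝓘(ℝ, D) 𝓘(ℝ, E) ∞ C T
  mapsTo : MapsTo K S T
  mapsTo_inv : MapsTo C T S
  left_inv : ∀ q ∈ S, C (K q) = q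
  right_inv : ∀ x ∈ T, K (C x) = x

theorem isCoordinateSystem_extChartAt (p : Q) : IsCoordinateSystem (E := E)
    (extChartAt 𝓘(ℝ, E) p).source (extChartAt 𝓘(ℝ, E) p).target (extChartAt 𝓘(ℝ, E) p)
    (extChartAt 𝓘(ℝ, E) p).symm where
  isOpen_source := isOpen_extChartAt_source p
  isOpen_target := isOpen_extChartAt_target p
  smooth := contMDiffOn_extChartAt_source p
  smooth_inv := contMDiffOn_extChartAt_symm p
  mapsTo _ hq := (extChartAt 𝓘(ℝ, E) p).map_source hq
  mapsTo_inv _ hy := (extChartAt 𝓘(ℝ, E) p).map_target hy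
  left_inv _ hq := (extChartAt 𝓘(ℝ, E) p).left_inv hq
  right_inv _ hy := (extChartAt 𝓘(ℝ, E) p).right_inv hy

namespace IsCoordinateSystem

variable {S : Set Q} {T : Set D} {K : Q → D} {C : D → Q}

theorem mfderiv_inv_mfderiv (h : IsCoordinateSystem (E := E) S T K C) {q : Q} (hq : q ∈ S)
    (v : TangentSpace 𝓘(ℝ, E) q) :
    mfderiv 𝓘(ℝ, D) 𝓘(ℝ, E) C (K q) (mfderiv 𝓘(ℝ, E) 𝓘(ℝ, D) K q v) = v := by
  have h1 : MDifferentiableAt 𝓘(ℝ, E) 𝓘(ℝ, D) K q :=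
    (h.smooth.contMDiffAt (h.isOpen_source.mem_nhds hq)).mdifferentiableAt (by simp)
  have h2 : MDifferentiableAt 𝓘(ℝ, D) 𝓘(ℝ, E) C (K q) :=
    (h.smooth_inv.contMDiffAt (h.isOpen_target.mem_nhds (h.mapsTo hq))).mdifferentiableAt (by simp)
  have h3 : C ∘ K =ᶠ[𝓝 q] id := by
    filter_upwards [h.isOpen_source.mem_nhds hq] with y hy using h.left_inv y hy
  have h4 := h3.mfderiv_eq (I := 𝓘(ℝ, E)) (I' := 𝓘(ℝ, E))
  rw [mfderiv_comp q h2 h1, mfderiv_id] at h4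
  exact DFunLike.congr_fun h4 v

/-- Change of coordinates for tangent vectors. -/
theorem tangentCoord_eq {L : Type*} [NormedAddCommGroup L] [NormedSpace ℝ L] {f : Q → L}
    (h : IsCoordinateSystem (E := E) S T K C) {q : Q} (hq : q ∈ S)
    (hf : MDifferentiableAt 𝓘(ℝ, E) 𝓘(ℝ, L) f q) (v : TangentSpace 𝓘(ℝ, E) q) :
    tangentCoord f q v = fderiv ℝ (f ∘ C) (K q) (tangentCoord K q v) := by
  have h1 : MDifferentiableAt 𝓘(ℝ, D) 𝓘(ℝ, L) (f ∘ C) (K q) := by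
    refine MDifferentiableAt.comp _ (I' := 𝓘(ℝ, E)) ?_ ((h.smooth_inv.contMDiffAt
      (h.isOpen_target.mem_nhds (h.mapsTo hq))).mdifferentiableAt (by simp))
    rwa [h.left_inv q hq]
  have h2 : f =ᶠ[𝓝 q] (f ∘ C) ∘ K := by
    filter_upwards [h.isOpen_source.mem_nhds hq] with y hy
    exact congrArg f (h.left_inv y hy).symm
  have h3 := h2.mfderiv_eq (I := 𝓘(ℝ, E)) (I' := 𝓘(ℝ, L))
  rw [mfderiv_comp q h1 ((h.smooth.contMDiffAt
    (h.isOpen_source.mem_nhds hq)).mdifferentiableAt (by simp)), mfderiv_eq_fderiv] at h3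
  exact DFunLike.congr_fun h3 v

theorem metric_mfderiv (h : IsCoordinateSystem (E := E) S T K C) {g : RiemMetric E Q}
    {W : D → D →L[ℝ] D →L[ℝ] ℝ} (hW : ∀ x ∈ T, ∀ a b, W x a b = g.inner (C x)
      (tangentVector C x a) (tangentVector C x b)) {q : Q} (hq : q ∈ S)
    (v w : TangentSpace 𝓘(ℝ, E) q) :
    W (K q) (tangentCoord K q v) (tangentCoord K q w) =
      g.inner q v w := by
  rw [hW _ (h.mapsTo hq), tangentVector, tangentVector, tangentCoord, tangentCoord,
    h.mfderiv_inv_mfderiv hq, h.mfderiv_inv_mfderiv hq, h.left_inv q hq]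

end IsCoordinateSystem

/-- The map `X` in the chart of `M` at `x₀` and the coordinates `K` of `Q`. -/
noncomputable def mapInCoord (x₀ : M) (X : M → Q) (K : Q → D) (z : F) : D :=
  K (X ((extChartAt 𝓘(ℝ, F) x₀).symm z))

/-- The coordinates with respect to `K` of the field `ν` along `X`, in the chart of `M` at `x₀`. -/
noncomputable def fieldInCoord (x₀ : M) {X : M → Q} (ν : ∀ x : M, TangentSpace 𝓘(ℝ, E) (X x))
    (K : Q → D) (z : F) : D :=
  tangentCoord K (X ((extChartAt 𝓘(ℝ, F) x₀).symm z))
    (ν ((extChartAt 𝓘(ℝ, F) x₀).symm z))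

variable {S : Set Q} {K : Q → D} {x₀ : M} {X : M → Q}
  {ν : ∀ x : M, TangentSpace 𝓘(ℝ, E) (X x)} {z : F}

theorem contMDiffAt_comp_extChartAt_symm {R : Type*} [TopologicalSpace R] [ChartedSpace D R]
    {f : M → R} (hf : ContMDiff 𝓘(ℝ, F) 𝓘(ℝ, D) ∞ f)
    (hz : z ∈ (extChartAt 𝓘(ℝ, F) x₀).target) :
    ContMDiffAt 𝓘(ℝ, F) 𝓘(ℝ, D) ∞ (fun z => f ((extChartAt 𝓘(ℝ, F) x₀).symm z)) z :=
  hf.contMDiffAt.comp z (contMDiffAt_extChartAt_symm_of_mem hz)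

theorem contDiffAt_mapInCoord (hX : ContMDiff 𝓘(ℝ, F) 𝓘(ℝ, E) ∞ X) (hS : IsOpen S)
    (hK : ContMDiffOn 𝓘(ℝ, E) 𝓘(ℝ, D) ∞ K S) (hz : z ∈ (extChartAt 𝓘(ℝ, F) x₀).target)
    (hzS : X ((extChartAt 𝓘(ℝ, F) x₀).symm z) ∈ S) :
    ContDiffAt ℝ ∞ (mapInCoord x₀ X K) z := by
  rw [← contMDiffAt_iff_contDiffAt]
  exact (hK.contMDiffAt (hS.mem_nhds hzS)).comp z (contMDiffAt_comp_extChartAt_symm hX hz)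

theorem fderiv_mapInCoord (hX : ContMDiff 𝓘(ℝ, F) 𝓘(ℝ, E) ∞ X) (hS : IsOpen S)
    (hK : ContMDiffOn 𝓘(ℝ, E) 𝓘(ℝ, D) ∞ K S) (hz : z ∈ (extChartAt 𝓘(ℝ, F) x₀).target)
    (hzS : X ((extChartAt 𝓘(ℝ, F) x₀).symm z) ∈ S) (v : F) :
    fderiv ℝ (mapInCoord x₀ X K) z v =
      tangentCoord K (X ((extChartAt 𝓘(ℝ, F) x₀).symm z))
        (mfderiv 𝓘(ℝ, F) 𝓘(ℝ, E) X ((extChartAt 𝓘(ℝ, F) x₀).symm z)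
          (tangentVector (extChartAt 𝓘(ℝ, F) x₀).symm z v)) := by
  have h1 : MDifferentiableAt 𝓘(ℝ, E) 𝓘(ℝ, D) K (X ((extChartAt 𝓘(ℝ, F) x₀).symm z)) :=
    (hK.contMDiffAt (hS.mem_nhds hzS)).mdifferentiableAt (by simp)
  have h2 : MDifferentiableAt 𝓘(ℝ, F) 𝓘(ℝ, E) X ((extChartAt 𝓘(ℝ, F) x₀).symm z) :=
    hX.contMDiffAt.mdifferentiableAt (by simp)
  have h3 := mdifferentiableAt_extChartAt_symm_of_mem hz
  have h4 : mapInCoord x₀ X K = K ∘ (X ∘ (extChartAt 𝓘(ℝ, F) x₀).symm) := rfl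
  rw [← mfderiv_eq_fderiv, h4, mfderiv_comp z (g := K) h1 (h2.comp z h3), mfderiv_comp z h2 h3]
  rfl

theorem eventually_mem_chart (hX : Continuous X) (hS : IsOpen S)
    (hz : z ∈ (extChartAt 𝓘(ℝ, F) x₀).target)
    (hzS : X ((extChartAt 𝓘(ℝ, F) x₀).symm z) ∈ S) :
    ∀ᶠ y in 𝓝 z, y ∈ (extChartAt 𝓘(ℝ, F) x₀).target ∧
      X ((extChartAt 𝓘(ℝ, F) x₀).symm y) ∈ S := by
  refine Filter.Eventually.and ((isOpen_extChartAt_target x₀).mem_nhds hz) ?_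
  have h1 : ContinuousAt (extChartAt 𝓘(ℝ, F) x₀).symm z :=
    (contMDiffAt_extChartAt_symm_of_mem hz).continuousAt
  exact (hX.continuousAt.comp h1).preimage_mem_nhds (hS.mem_nhds hzS)

theorem contDiffAt_fieldInCoord_extChartAt
    (hν : ContMDiff 𝓘(ℝ, F) 𝓘(ℝ, E).tangent ∞ (fun x => (⟨X x, ν x⟩ : TangentBundle 𝓘(ℝ, E) Q)))
    (hz : z ∈ (extChartAt 𝓘(ℝ, F) x₀).target) {p : Q}
    (hp : X ((extChartAt 𝓘(ℝ, F) x₀).symm z) ∈ (extChartAt 𝓘(ℝ, E) p).source) :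
    ContDiffAt ℝ ∞ (fieldInCoord x₀ ν (extChartAt 𝓘(ℝ, E) p)) z := by
  rw [← contMDiffAt_iff_contDiffAt]
  exact ((contMDiffAt_tangentBundle_iff hp).1 hν.contMDiffAt).2.comp z
    (contMDiffAt_extChartAt_symm_of_mem hz)

/-- Smoothness of a field along a map is defined through the charts of the tangent bundle; it carries
over to any smooth coordinates. -/
theorem contDiffAt_fieldInCoord (hX : ContMDiff 𝓘(ℝ, F) 𝓘(ℝ, E) ∞ X)
    (hν : ContMDiff 𝓘(ℝ, F) 𝓘(ℝ, E).tangent ∞ (fun x => (⟨X x, ν x⟩ : TangentBundle 𝓘(ℝ, E) Q)))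
    (hS : IsOpen S)
    (hK : ContMDiffOn 𝓘(ℝ, E) 𝓘(ℝ, D) ∞ K S) (hz : z ∈ (extChartAt 𝓘(ℝ, F) x₀).target)
    (hzS : X ((extChartAt 𝓘(ℝ, F) x₀).symm z) ∈ S) :
    ContDiffAt ℝ ∞ (fieldInCoord x₀ ν K) z := by
  obtain ⟨p, hp⟩ : ∃ p, p = X ((extChartAt 𝓘(ℝ, F) x₀).symm z) := ⟨_, rfl⟩
  have hpS : X ((extChartAt 𝓘(ℝ, F) x₀).symm z) ∈ (extChartAt 𝓘(ℝ, E) p).source := by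
    rw [← hp]; exact mem_extChartAt_source p
  have h1 := contDiffAt_fieldInCoord_extChartAt hν hz hpS
  have h2 := contDiffAt_mapInCoord hX (isOpen_extChartAt_source p)
    (contMDiffOn_extChartAt_source p) hz hpS
  have h3 : ContDiffAt ℝ ∞ (K ∘ (extChartAt 𝓘(ℝ, E) p).symm)
      (mapInCoord x₀ X (extChartAt 𝓘(ℝ, E) p) z) := by
    rw [← contMDiffAt_iff_contDiffAt]
    refine ContMDiffAt.comp _ ?_
      (contMDiffAt_extChartAt_symm_of_mem ((extChartAt 𝓘(ℝ, E) p).map_source hpS))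
    rw [mapInCoord, (extChartAt 𝓘(ℝ, E) p).left_inv hpS]
    exact hK.contMDiffAt (hS.mem_nhds hzS)
  refine (((h3.fderiv_right (m := ∞) (by simp)).comp z h2).clm_apply h1).congr_of_eventuallyEq ?_
  filter_upwards [eventually_mem_chart hX.continuous hS hz hzS,
    eventually_mem_chart hX.continuous (isOpen_extChartAt_source p) hz hpS] with y hy hy'
  exact (isCoordinateSystem_extChartAt p).tangentCoord_eq hy'.2
    ((hK.contMDiffAt (hS.mem_nhds hy.2)).mdifferentiableAt (by simp)) _

theorem firstFundForm_eq {T : Set D} {C : D → Q} (h : IsCoordinateSystem (E := E) S T K C)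
    {g : RiemMetric E Q} {W : D → D →L[ℝ] D →L[ℝ] ℝ}
    (hW : ∀ x ∈ T, ∀ a b, W x a b = g.inner (C x)
      (tangentVector C x a) (tangentVector C x b))
    (hX : ContMDiff 𝓘(ℝ, F) 𝓘(ℝ, E) ∞ X) (hz : z ∈ (extChartAt 𝓘(ℝ, F) x₀).target)
    (hzS : X ((extChartAt 𝓘(ℝ, F) x₀).symm z) ∈ S) (v w : F) :
    firstFundForm (F := F) g X ((extChartAt 𝓘(ℝ, F) x₀).symm z)
        (tangentVector (extChartAt 𝓘(ℝ, F) x₀).symm z v)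
        (tangentVector (extChartAt 𝓘(ℝ, F) x₀).symm z w) =
      W (mapInCoord x₀ X K z) (fderiv ℝ (mapInCoord x₀ X K) z v)
        (fderiv ℝ (mapInCoord x₀ X K) z w) := by
  rw [fderiv_mapInCoord hX h.isOpen_source h.smooth hz hzS,
    fderiv_mapInCoord hX h.isOpen_source h.smooth hz hzS]
  exact (h.metric_mfderiv hW hzS _ _).symm

theorem covDerivAlong_eq [FiniteDimensional ℝ E] (g : RiemMetric E Q)
    (hX : ContMDiff 𝓘(ℝ, F) 𝓘(ℝ, E) ∞ X)
    (hν : ContMDiff 𝓘(ℝ, F) 𝓘(ℝ, E).tangent ∞ (fun x => (⟨X x, ν x⟩ : TangentBundle 𝓘(ℝ, E) Q)))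
    (hz : z ∈ (extChartAt 𝓘(ℝ, F) x₀).target) {p : Q}
    (hp : p = X ((extChartAt 𝓘(ℝ, F) x₀).symm z)) (v : F) :
    covDerivAlong (F := F) g X ν ((extChartAt 𝓘(ℝ, F) x₀).symm z)
        (tangentVector (extChartAt 𝓘(ℝ, F) x₀).symm z v) =
      fderiv ℝ (fieldInCoord x₀ ν (extChartAt 𝓘(ℝ, E) p)) z v +
        leviCivita (metricInChart g p) (mapInCoord x₀ X (extChartAt 𝓘(ℝ, E) p) z)
          (fderiv ℝ (mapInCoord x₀ X (extChartAt 𝓘(ℝ, E) p)) z v)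
          (fieldInCoord x₀ ν (extChartAt 𝓘(ℝ, E) p) z) := by
  subst hp
  have hpS := mem_extChartAt_source (I := 𝓘(ℝ, E)) (X ((extChartAt 𝓘(ℝ, F) x₀).symm z))
  rw [fderiv_mapInCoord hX (isOpen_extChartAt_source _)
    (contMDiffOn_extChartAt_source _) hz hpS]
  rw [covDerivAlong, christoffel_eq_leviCivita]
  congr 1
  have h1 : MDifferentiableAt 𝓘(ℝ, F) 𝓘(ℝ, E)
      (fun y => chartCoord (X ((extChartAt 𝓘(ℝ, F) x₀).symm z)) (X y) (ν y))
      ((extChartAt 𝓘(ℝ, F) x₀).symm z) :=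
    ((contMDiffAt_tangentBundle_iff hpS).1 hν.contMDiffAt).2.mdifferentiableAt (by simp)
  have h2 := mfderiv_comp_apply z h1 (mdifferentiableAt_extChartAt_symm_of_mem hz) v
  rw [← mfderiv_eq_fderiv]
  exact h2.symm

/-- The symmetrized second fundamental form in arbitrary coordinates. It involves only first
derivatives of the metric, hence no transformation law for Christoffel symbols is needed. -/
theorem secondFundForm_add_eq [FiniteDimensional ℝ E] {T : Set D} {C : D → Q}
    (h : IsCoordinateSystem (E := E) S T K C)
    {g : RiemMetric E Q} {W : D → D →L[ℝ] D →L[ℝ] ℝ}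
    (hW : ∀ x ∈ T, ∀ a b, W x a b = g.inner (C x)
      (tangentVector C x a) (tangentVector C x b))
    (hWd : DifferentiableOn ℝ W T)
    (hX : ContMDiff 𝓘(ℝ, F) 𝓘(ℝ, E) ∞ X)
    (hν : ContMDiff 𝓘(ℝ, F) 𝓘(ℝ, E).tangent ∞ (fun x => (⟨X x, ν x⟩ : TangentBundle 𝓘(ℝ, E) Q)))
    (hz : z ∈ (extChartAt 𝓘(ℝ, F) x₀).target)
    (hzS : X ((extChartAt 𝓘(ℝ, F) x₀).symm z) ∈ S) (v w : F) :
    secondFundForm (F := F) g X ν ((extChartAt 𝓘(ℝ, F) x₀).symm z)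
        (tangentVector (extChartAt 𝓘(ℝ, F) x₀).symm z v)
        (tangentVector (extChartAt 𝓘(ℝ, F) x₀).symm z w) +
      secondFundForm (F := F) g X ν ((extChartAt 𝓘(ℝ, F) x₀).symm z)
        (tangentVector (extChartAt 𝓘(ℝ, F) x₀).symm z w)
        (tangentVector (extChartAt 𝓘(ℝ, F) x₀).symm z v) =
      metricVariation W (mapInCoord x₀ X K z) (fieldInCoord x₀ ν K z)
        (fderiv ℝ (mapInCoord x₀ X K) z v) (fderiv ℝ (mapInCoord x₀ X K) z w)
        (fderiv ℝ (fieldInCoord x₀ ν K) z v) (fderiv ℝ (fieldInCoord x₀ ν K) z w) := by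
  obtain ⟨p, hp⟩ : ∃ p, p = X ((extChartAt 𝓘(ℝ, F) x₀).symm z) := ⟨_, rfl⟩
  have hpS : X ((extChartAt 𝓘(ℝ, F) x₀).symm z) ∈ (extChartAt 𝓘(ℝ, E) p).source := by
    rw [← hp]; exact mem_extChartAt_source p
  have hmetric := isLocalMetric_metricInChart g p
  have hpT : mapInCoord x₀ X (extChartAt 𝓘(ℝ, E) p) z ∈ (extChartAt 𝓘(ℝ, E) p).target :=
    (extChartAt 𝓘(ℝ, E) p).map_source hpS
  -- the left-hand side, in the chart of `Q` at `X x`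
  have hsecond : ∀ v w, secondFundForm (F := F) g X ν ((extChartAt 𝓘(ℝ, F) x₀).symm z)
        (tangentVector (extChartAt 𝓘(ℝ, F) x₀).symm z v)
        (tangentVector (extChartAt 𝓘(ℝ, F) x₀).symm z w) =
      metricInChart g p (mapInCoord x₀ X (extChartAt 𝓘(ℝ, E) p) z)
        (fderiv ℝ (fieldInCoord x₀ ν (extChartAt 𝓘(ℝ, E) p)) z v +
        leviCivita (metricInChart g p) (mapInCoord x₀ X (extChartAt 𝓘(ℝ, E) p) z)
          (fderiv ℝ (mapInCoord x₀ X (extChartAt 𝓘(ℝ, E) p)) z v)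
          (fieldInCoord x₀ ν (extChartAt 𝓘(ℝ, E) p) z))
        (fderiv ℝ (mapInCoord x₀ X (extChartAt 𝓘(ℝ, E) p)) z w) := by
    intro v w
    rw [secondFundForm, covDerivAlong_eq g hX hν hz hp v, fderiv_mapInCoord hX
      (isOpen_extChartAt_source p) (contMDiffOn_extChartAt_source _) hz hpS w]
    subst hp
    rfl
  rw [hsecond, hsecond, hmetric.symm _ hpT _ (fderiv ℝ (mapInCoord x₀ X (extChartAt 𝓘(ℝ, E) p)) z v),
    ← hmetric.metricVariation_eq hpT]
  -- the change of coordinates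
  obtain ⟨σ, hσ⟩ : ∃ σ : D → E, σ = fun x => extChartAt 𝓘(ℝ, E) p (C x) := ⟨_, rfl⟩
  have hzT : mapInCoord x₀ X K z ∈ T := h.mapsTo hzS
  have hCz : C (mapInCoord x₀ X K z) = X ((extChartAt 𝓘(ℝ, F) x₀).symm z) := h.left_inv _ hzS
  have hCd : ∀ x ∈ T, MDifferentiableAt 𝓘(ℝ, D) 𝓘(ℝ, E) C x := fun x hx =>
    (h.smooth_inv.contMDiffAt (h.isOpen_target.mem_nhds hx)).mdifferentiableAt (by simp)
  have hσd : ∀ x ∈ T, C x ∈ (extChartAt 𝓘(ℝ, E) p).source → ∀ a, fderiv ℝ σ x a =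
      tangentCoord (extChartAt 𝓘(ℝ, E) p) (C x) (tangentVector (E := E) C x a) := by
    intro x hx hx' a
    rw [← mfderiv_eq_fderiv, hσ]
    exact mfderiv_comp_apply x (mdifferentiableAt_extChartAt_of_mem hx') (hCd x hx) a
  have hσc : ContDiffAt ℝ ∞ σ (mapInCoord x₀ X K z) := by
    rw [← contMDiffAt_iff_contDiffAt, hσ]
    refine ContMDiffAt.comp _ ?_ (h.smooth_inv.contMDiffAt (h.isOpen_target.mem_nhds hzT))
    rw [hCz]
    exact contMDiffAt_extChartAt_of_mem hpS
  have hev : ∀ᶠ x in 𝓝 (mapInCoord x₀ X K z), x ∈ T ∧ C x ∈ (extChartAt 𝓘(ℝ, E) p).source := by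
    refine Filter.Eventually.and (h.isOpen_target.mem_nhds hzT) ?_
    refine (hCd _ hzT).continuousAt.preimage_mem_nhds ?_
    rw [hCz]
    exact (isOpen_extChartAt_source p).mem_nhds hpS
  have hpull : ∀ᶠ x in 𝓝 (mapInCoord x₀ X K z), ∀ a b,
      W x a b = metricInChart g p (σ x) (fderiv ℝ σ x a) (fderiv ℝ σ x b) := by
    filter_upwards [hev] with x hx a b
    rw [hσd x hx.1 hx.2, hσd x hx.1 hx.2, hW x hx.1, hσ]
    exact (metricInChart_chartCoord g hx.2 _ _).symm
  have hevz := eventually_mem_chart hX.continuous h.isOpen_source hz hzS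
  have hevz' := eventually_mem_chart hX.continuous (isOpen_extChartAt_source p) hz hpS
  have hmap : mapInCoord x₀ X (extChartAt 𝓘(ℝ, E) p) =ᶠ[𝓝 z] σ ∘ mapInCoord x₀ X K := by
    filter_upwards [hevz] with y hy
    rw [hσ]
    exact congrArg (extChartAt 𝓘(ℝ, E) p) (h.left_inv _ hy.2).symm
  have hfield : fieldInCoord x₀ ν (extChartAt 𝓘(ℝ, E) p) =ᶠ[𝓝 z]
      fun y => fderiv ℝ σ (mapInCoord x₀ X K y) (fieldInCoord x₀ ν K y) := by
    filter_upwards [hevz, hevz'] with y hy hy'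
    rw [hσ]
    exact h.tangentCoord_eq hy.2 (mdifferentiableAt_extChartAt_of_mem hy'.2) _
  have hmd := ((contDiffAt_mapInCoord hX h.isOpen_source h.smooth hz hzS).differentiableAt
    (by simp)).hasFDerivAt
  have hfd := ((contDiffAt_fieldInCoord hX hν h.isOpen_source h.smooth hz hzS).differentiableAt
    (by simp)).hasFDerivAt
  have hσ1 := (hσc.differentiableAt (by simp)).hasFDerivAt
  have hσ2 := ((hσc.fderiv_right (m := ∞) (by simp)).differentiableAt (by simp)).hasFDerivAt
  have hd1 : ∀ v, fderiv ℝ (mapInCoord x₀ X (extChartAt 𝓘(ℝ, E) p)) z v =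
      fderiv ℝ σ (mapInCoord x₀ X K z) (fderiv ℝ (mapInCoord x₀ X K) z v) := by
    intro v
    rw [hmap.fderiv_eq, (hσ1.comp z hmd).fderiv]
    rfl
  have hd2 : ∀ v, fderiv ℝ (fieldInCoord x₀ ν (extChartAt 𝓘(ℝ, E) p)) z v =
      fderiv ℝ (fderiv ℝ σ) (mapInCoord x₀ X K z) (fderiv ℝ (mapInCoord x₀ X K) z v)
          (fieldInCoord x₀ ν K z) +
        fderiv ℝ σ (mapInCoord x₀ X K z) (fderiv ℝ (fieldInCoord x₀ ν K) z v) := by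
    intro v
    have h1 := (hσ2.comp z hmd).clm_apply hfd
    rw [hfield.fderiv_eq]
    refine (DFunLike.congr_fun h1.fderiv v).trans ?_
    simp [add_comm]
  rw [hd1, hd1, hd2, hd2, hfield.self_of_nhds, hmap.self_of_nhds]
  refine metricVariation_pullback (hσc.of_le two_le_infty) ?_
    ((hWd _ hzT).differentiableAt (h.isOpen_target.mem_nhds hzT)) hpull _ _ _ _ _
  rw [← Function.comp_apply (f := σ), ← hmap.self_of_nhds]
  exact (hmetric.contDiffAt hpT).differentiableAt (by simp)

end Coordinates

/-! ### Hypersurfaces of the warped product in polar coordinates -/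

theorem isOpen_radialInterval (rbar : EReal) : IsOpen (radialInterval rbar) :=
  (isOpen_lt continuous_const continuous_id).inter
    (isOpen_lt continuous_coe_real_ereal continuous_const)

section PolarCoordinates

theorem differentiableAt_warpedMetric {E : Type*} [NormedAddCommGroup E] [NormedSpace ℝ E]
    {H : E → E →L[ℝ] E →L[ℝ] ℝ} {lam : ℝ → ℝ} {x : ℝ × E} (hlam : DifferentiableAt ℝ lam x.1)
    (hH : DifferentiableAt ℝ H x.2) :
    DifferentiableAt ℝ (fun a : ℝ × E => warpedMetric (lam a.1 ^ 2 • H a.2)) x := by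
  have h1 : DifferentiableAt ℝ (fun a : ℝ × E => lam a.1) x :=
    DifferentiableAt.comp (f := fun a : ℝ × E => a.1) x hlam differentiableAt_fst
  have h2 : DifferentiableAt ℝ (fun a : ℝ × E => H a.2) x :=
    DifferentiableAt.comp (f := fun a : ℝ × E => a.2) x hH differentiableAt_snd
  have h3 := (h1.fun_pow 2).fun_smul h2
  have h4 : (fun a : ℝ × E => warpedMetric (lam a.1 ^ 2 • H a.2)) = fun a : ℝ × E =>
      (ContinuousLinearMap.mul ℝ ℝ).bilinearComp (ContinuousLinearMap.fst ℝ ℝ E)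
        (ContinuousLinearMap.fst ℝ ℝ E) + (((ContinuousLinearMap.compL ℝ (ℝ × E) E ℝ).flip
          (ContinuousLinearMap.snd ℝ ℝ E)).comp ((lam a.1 ^ 2 • H a.2).comp
            (ContinuousLinearMap.snd ℝ ℝ E))) := rfl
  rw [h4]
  exact (differentiableAt_const _).fun_add ((differentiableAt_const _).clm_comp
    (h3.clm_comp (differentiableAt_const _)))

/-- The symmetrized second fundamental form computed from the metric `dr² + lam(r)² H` in coordinates
agrees with the one in the rescaled frame; `m` is the normal before rescaling. -/
theorem IsWarpedHypersurface.metricVariation_eq {V : Type*} [NormedAddCommGroup V]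
    [NormedSpace ℝ V] {E : Type*} [NormedAddCommGroup E] [NormedSpace ℝ E] [FiniteDimensional ℝ E]
    {U : Set V} {J : Set ℝ} {O : Set E} {H : E → E →L[ℝ] E →L[ℝ] ℝ} {lam : ℝ → ℝ}
    {ρ : V → ℝ} {y : V → E} {m : V → ℝ × E}
    (h : IsWarpedHypersurface U J O H lam ρ y (fun z => ((m z).1, lam (ρ z) • (m z).2)))
    {z : V} (hz : z ∈ U) (hm : DifferentiableAt ℝ m z) (v w : V) :
    metricVariation (fun a => warpedMetric (lam a.1 ^ 2 • H a.2)) (ρ z, y z) (m z)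
        (fderiv ℝ ρ z v, fderiv ℝ y z v) (fderiv ℝ ρ z w, fderiv ℝ y z w)
        (fderiv ℝ m z v) (fderiv ℝ m z w) =
      secondForm (fun z => warpedMetric (H (y z))) (warpedDifferential lam ρ y)
          (warpedForm lam H ρ y) (fun z => ((m z).1, lam (ρ z) • (m z).2)) z v w +
        secondForm (fun z => warpedMetric (H (y z))) (warpedDifferential lam ρ y)
          (warpedForm lam H ρ y) (fun z => ((m z).1, lam (ρ z) • (m z).2)) z w v := by
  have hO := h.mapsTo_fibre hz
  have hJ := h.mapsTo_radius hz
  have hl : HasDerivAt lam (deriv lam (ρ z)) (ρ z) :=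
    ((h.smooth_warp.contDiffAt (h.isOpen_interval.mem_nhds hJ)).differentiableAt
      (by simp)).hasDerivAt
  have hH := ((h.metric.contDiffAt hO).differentiableAt (by simp)).hasFDerivAt
  have hfst : HasFDerivAt (fun a : ℝ × E => a.1) (ContinuousLinearMap.fst ℝ ℝ E) (ρ z, y z) :=
    hasFDerivAt_fst
  have hl2 : HasDerivAt (fun r => lam r ^ 2) (2 * lam (ρ z) * deriv lam (ρ z)) (ρ z) := by
    simpa using hl.fun_pow 2
  have hl1 : HasFDerivAt (fun a : ℝ × E => lam a.1 ^ 2) _ (ρ z, y z) :=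
    HasDerivAt.comp_hasFDerivAt (h₂ := fun r => lam r ^ 2) (ρ z, y z) hl2 hfst
  have hH1 : HasFDerivAt (fun a : ℝ × E => H a.2) _ (ρ z, y z) :=
    HasFDerivAt.comp (ρ z, y z) (f := fun a : ℝ × E => a.2) hH hasFDerivAt_snd
  have hW : ∀ b c : ℝ × E, fderiv ℝ (fun a : ℝ × E => warpedMetric (lam a.1 ^ 2 • H a.2) b c)
      (ρ z, y z) (m z) = 2 * lam (ρ z) * deriv lam (ρ z) * (m z).1 * H (y z) b.2 c.2 +
        lam (ρ z) ^ 2 * fderiv ℝ H (y z) (m z).2 b.2 c.2 := by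
    intro b c
    have h1 := (hl1.fun_mul ((hH1.clm_apply (hasFDerivAt_const b.2 _)).clm_apply
      (hasFDerivAt_const c.2 _))).const_add (b.1 * c.1)
    have h2 : (fun a : ℝ × E => warpedMetric (lam a.1 ^ 2 • H a.2) b c) =
        fun a => b.1 * c.1 + lam a.1 ^ 2 * H a.2 b.2 c.2 := by
      ext a; rw [warpedMetric_apply]; rfl
    rw [h2, h1.fderiv]
    simp
    ring
  have hWd : DifferentiableAt ℝ (fun a : ℝ × E => warpedMetric (lam a.1 ^ 2 • H a.2))
      (ρ z, y z) :=
    differentiableAt_warpedMetric hl.differentiableAt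
      ((h.metric.contDiffAt hO).differentiableAt (by simp))
  have hν : ∀ v, fderiv ℝ (fun z => ((m z).1, lam (ρ z) • (m z).2)) z v =
      ((fderiv ℝ m z v).1, lam (ρ z) • (fderiv ℝ m z v).2 +
        (deriv lam (ρ z) * fderiv ℝ ρ z v) • (m z).2) := by
    intro v
    have h1 := (hm.hasFDerivAt.fst).prodMk
      ((h.hasFDerivAt_comp_radius h.smooth_warp hz).fun_smul hm.hasFDerivAt.snd)
    rw [h1.fderiv]
    simp
  rw [metricVariation, fderiv_apply_const₂ hWd, hW]
  simp only [IsHypersurfaceModel.secondForm_apply, covDeriv, hν, warpedForm_apply,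
    warpedDifferential_apply, warpedMetric_apply, map_add, map_smul,
    add_apply, smul_apply, smul_eq_mul, h.metric.compat hO]
  have hs := h.metric.symm _ hO
  have hΓ := h.metric.leviCivita_symm hO
  rw [hΓ (m z).2, hΓ (m z).2, hs (fderiv ℝ y z v) (m z).2, hs (fderiv ℝ y z w) (m z).2,
    hs (fderiv ℝ y z w) (fderiv ℝ y z v), hs (fderiv ℝ y z v) (fderiv ℝ m z w).2,
    hs (fderiv ℝ y z v) (leviCivita H (y z) (fderiv ℝ y z w) (m z).2)]
  ring

variable {n : ℕ}
  {N : Type*} [TopologicalSpace N] [ChartedSpace (EuclideanSpace ℝ (Fin n)) N]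
  [IsManifold (𝓡 n) ∞ N]
  {Q : Type*} [TopologicalSpace Q] [ChartedSpace (EuclideanSpace ℝ (Fin (n + 1))) Q]
  [IsManifold (𝓡 (n + 1)) ∞ Q]

/-- Polar coordinates on the warped product: the radius, and the chart of the fibre at `q`. -/
noncomputable def warpedCoord (ψ : OpenPartialHomeomorph (ℝ × N) Q) (q : N) (y : Q) :
    ℝ × EuclideanSpace ℝ (Fin n) :=
  ((ψ.symm y).1, extChartAt (𝓡 n) q (ψ.symm y).2)

/-- The inverse of the polar coordinates. -/
noncomputable def warpedParam (ψ : OpenPartialHomeomorph (ℝ × N) Q) (q : N)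
    (a : ℝ × EuclideanSpace ℝ (Fin n)) : Q :=
  ψ (a.1, (extChartAt (𝓡 n) q).symm a.2)

/-- The domain of the polar coordinates. -/
def warpedSource (ψ : OpenPartialHomeomorph (ℝ × N) Q) (q : N) : Set Q :=
  ψ.target ∩ ψ.symm ⁻¹' (univ ×ˢ (extChartAt (𝓡 n) q).source)

variable {gN : RiemMetric (EuclideanSpace ℝ (Fin n)) N}
  {gQ : RiemMetric (EuclideanSpace ℝ (Fin (n + 1))) Q} {rbar : EReal} {lam : ℝ → ℝ}
  {ψ : OpenPartialHomeomorph (ℝ × N) Q}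

namespace IsWarpedProduct

theorem isCoordinateSystem (h : IsWarpedProduct gN gQ rbar lam ψ) (q : N) :
    IsCoordinateSystem (E := EuclideanSpace ℝ (Fin (n + 1))) (warpedSource (n := n) ψ q)
      (radialInterval rbar ×ˢ (extChartAt (𝓡 n) q).target) (warpedCoord (n := n) ψ q)
      (warpedParam (n := n) ψ q) where
  isOpen_source := ψ.isOpen_inter_preimage_symm (isOpen_univ.prod (isOpen_extChartAt_source q))
  isOpen_target := (isOpen_radialInterval rbar).prod (isOpen_extChartAt_target q)
  smooth := by
    intro y hy
    have h1 : ContMDiffAt (𝓡 (n + 1)) (𝓘(ℝ, ℝ).prod (𝓡 n)) ∞ ψ.symm y :=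
      h.smooth_symm.contMDiffAt (ψ.open_target.mem_nhds hy.1)
    have h2 := (contMDiffAt_extChartAt_of_mem hy.2.2).comp y (contMDiffAt_snd.comp y h1)
    exact ((contMDiffAt_fst.comp y h1).prodMk_space h2).contMDiffWithinAt
  smooth_inv := by
    intro a ha
    have h0 : (a.1, (extChartAt (𝓡 n) q).symm a.2) ∈ ψ.source := by
      rw [h.source_eq]; exact ⟨ha.1, mem_univ _⟩
    have h1 : ContMDiffAt (𝓘(ℝ, ℝ).prod (𝓡 n)) (𝓡 (n + 1)) ∞ ψ
        (a.1, (extChartAt (𝓡 n) q).symm a.2) :=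
      h.smooth.contMDiffAt (ψ.open_source.mem_nhds h0)
    have h2 : ContMDiffAt 𝓘(ℝ, ℝ × EuclideanSpace ℝ (Fin n)) (𝓡 n) ∞
        (fun a : ℝ × EuclideanSpace ℝ (Fin n) => (extChartAt (𝓡 n) q).symm a.2) a :=
      (contMDiffAt_extChartAt_symm_of_mem ha.2).comp a contDiffAt_snd.contMDiffAt
    have h3 : ContMDiffAt 𝓘(ℝ, ℝ × EuclideanSpace ℝ (Fin n)) 𝓘(ℝ, ℝ) ∞
        (fun a : ℝ × EuclideanSpace ℝ (Fin n) => a.1) a := contDiffAt_fst.contMDiffAt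
    exact (h1.comp a (h3.prodMk h2)).contMDiffWithinAt
  mapsTo y hy := by
    have h1 := ψ.map_target hy.1
    rw [h.source_eq] at h1
    exact ⟨h1.1, (extChartAt (𝓡 n) q).map_source hy.2.2⟩
  mapsTo_inv a ha := by
    have h0 : (a.1, (extChartAt (𝓡 n) q).symm a.2) ∈ ψ.source := by
      rw [h.source_eq]; exact ⟨ha.1, mem_univ _⟩
    refine ⟨ψ.map_source h0, ?_⟩
    rw [mem_preimage, warpedParam, ψ.left_inv h0]
    exact ⟨mem_univ _, (extChartAt (𝓡 n) q).map_target ha.2⟩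
  left_inv y hy := by
    rw [warpedParam, warpedCoord, (extChartAt (𝓡 n) q).left_inv hy.2.2]
    exact ψ.right_inv hy.1
  right_inv a ha := by
    have h0 : (a.1, (extChartAt (𝓡 n) q).symm a.2) ∈ ψ.source := by
      rw [h.source_eq]; exact ⟨ha.1, mem_univ _⟩
    rw [warpedCoord, warpedParam, ψ.left_inv h0, (extChartAt (𝓡 n) q).right_inv ha.2]

theorem tangentVector_eq (h : IsWarpedProduct gN gQ rbar lam ψ) (q : N)
    {x : ℝ × EuclideanSpace ℝ (Fin n)}
    (hx : x ∈ radialInterval rbar ×ˢ (extChartAt (𝓡 n) q).target)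
    (a : ℝ × EuclideanSpace ℝ (Fin n)) :
    tangentVector (E := EuclideanSpace ℝ (Fin (n + 1))) (warpedParam (n := n) ψ q) x a =
      mfderiv (𝓘(ℝ, ℝ).prod (𝓡 n)) (𝓡 (n + 1)) ψ (x.1, (extChartAt (𝓡 n) q).symm x.2)
        (a.1, mfderiv (𝓡 n) (𝓡 n) (extChartAt (𝓡 n) q).symm x.2 a.2) := by
  have h0 : (x.1, (extChartAt (𝓡 n) q).symm x.2) ∈ ψ.source := by
    rw [h.source_eq]; exact ⟨hx.1, mem_univ _⟩
  have h1 : MDifferentiableAt (𝓘(ℝ, ℝ).prod (𝓡 n)) (𝓡 (n + 1)) ψ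
      (x.1, (extChartAt (𝓡 n) q).symm x.2) :=
    (h.smooth.contMDiffAt (ψ.open_source.mem_nhds h0)).mdifferentiableAt (by simp)
  have h2 : HasMFDerivAt 𝓘(ℝ, ℝ × EuclideanSpace ℝ (Fin n)) 𝓘(ℝ, ℝ)
      (fun a : ℝ × EuclideanSpace ℝ (Fin n) => a.1) x
      (ContinuousLinearMap.fst ℝ ℝ (EuclideanSpace ℝ (Fin n))) :=
    hasFDerivAt_fst.hasMFDerivAt
  have h3 : HasMFDerivAt 𝓘(ℝ, ℝ × EuclideanSpace ℝ (Fin n)) (𝓡 n)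
      (fun a : ℝ × EuclideanSpace ℝ (Fin n) => a.2) x
      (ContinuousLinearMap.snd ℝ ℝ (EuclideanSpace ℝ (Fin n))) :=
    hasFDerivAt_snd.hasMFDerivAt
  have h4 := HasMFDerivAt.comp x (mdifferentiableAt_extChartAt_symm_of_mem hx.2).hasMFDerivAt h3
  have h5 := HasMFDerivAt.comp x h1.hasMFDerivAt (h2.prodMk h4)
  exact DFunLike.congr_fun h5.mfderiv a

theorem warpedMetric_eq (h : IsWarpedProduct gN gQ rbar lam ψ) (q : N)
    {x : ℝ × EuclideanSpace ℝ (Fin n)}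
    (hx : x ∈ radialInterval rbar ×ˢ (extChartAt (𝓡 n) q).target)
    (a b : ℝ × EuclideanSpace ℝ (Fin n)) :
    warpedMetric (lam x.1 ^ 2 • metricInChart gN q x.2) a b =
      gQ.inner (warpedParam ψ q x) (tangentVector (warpedParam ψ q) x a)
        (tangentVector (warpedParam ψ q) x b) := by
  have h0 : (x.1, (extChartAt (𝓡 n) q).symm x.2) ∈ ψ.source := by
    rw [h.source_eq]; exact ⟨hx.1, mem_univ _⟩
  rw [h.tangentVector_eq q hx, h.tangentVector_eq q hx, warpedMetric_apply]
  exact (h.isometric _ h0 _ _ _ _).symm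

end IsWarpedProduct

end PolarCoordinates

/-! ### The differential inequality -/

section Inequality

variable {V : Type*} [NormedAddCommGroup V] [NormedSpace ℝ V] [FiniteDimensional ℝ V]
  {E : Type*} [NormedAddCommGroup E] [NormedSpace ℝ E] [FiniteDimensional ℝ E]

/-- The first fundamental form of the hypersurface `(ρ, y)` of the warped product. -/
noncomputable abbrev warpedFirstForm (lam : ℝ → ℝ) (H : E → E →L[ℝ] E →L[ℝ] ℝ) (ρ : V → ℝ)
    (y : V → E) : V → V →L[ℝ] V →L[ℝ] ℝ :=
  firstForm (fun z => warpedMetric (H (y z))) (warpedDifferential lam ρ y)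

/-- The second fundamental form of the hypersurface `(ρ, y)` of the warped product. -/
noncomputable abbrev warpedSecondForm (lam : ℝ → ℝ) (H : E → E →L[ℝ] E →L[ℝ] ℝ) (ρ : V → ℝ)
    (y : V → E) (ν : V → ℝ × E) : V → V →L[ℝ] V →L[ℝ] ℝ :=
  secondForm (fun z => warpedMetric (H (y z))) (warpedDifferential lam ρ y)
    (warpedForm lam H ρ y) ν

namespace IsWarpedHypersurface

variable {U : Set V} {J : Set ℝ} {O : Set E} {H : E → E →L[ℝ] E →L[ℝ] ℝ} {lam : ℝ → ℝ}
  {ρ : V → ℝ} {y : V → E} {ν : V → ℝ × E}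

theorem contDiffOn_firstForm (h : IsWarpedHypersurface U J O H lam ρ y ν) :
    ContDiffOn ℝ ∞ (warpedFirstForm lam H ρ y) U := by
  rw [contDiffOn_clm_apply]; intro v
  rw [contDiffOn_clm_apply]; intro w
  exact (h.contDiffOn_warpedMetric.clm_apply
    (h.contDiffOn_warpedDifferential.clm_apply contDiffOn_const)).clm_apply
    (h.contDiffOn_warpedDifferential.clm_apply contDiffOn_const)

theorem contDiffOn_secondForm (h : IsWarpedHypersurface U J O H lam ρ y ν) :
    ContDiffOn ℝ ∞ (warpedSecondForm lam H ρ y ν) U := by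
  rw [contDiffOn_clm_apply]; intro v
  rw [contDiffOn_clm_apply]; intro w
  simp only [IsHypersurfaceModel.secondForm_apply, covDeriv]
  exact (h.contDiffOn_warpedMetric.clm_apply ((h.contDiffOn_fderiv_apply h.smooth_normal v).add
    ((h.contDiffOn_warpedForm.clm_apply contDiffOn_const).clm_apply h.smooth_normal))).clm_apply
    (h.contDiffOn_warpedDifferential.clm_apply contDiffOn_const)

theorem contDiffOn_potential (h : IsWarpedHypersurface U J O H lam ρ y ν) {Φ : ℝ → ℝ}
    (hΦ : ∀ r ∈ J, HasDerivAt Φ (lam r) r) : ContDiffOn ℝ ∞ (fun z => Φ (ρ z)) U := by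
  have h1 : ContDiffOn ℝ ∞ Φ J := by
    rw [contDiffOn_infty_iff_deriv_of_isOpen h.isOpen_interval]
    exact ⟨fun r hr => (hΦ r hr).differentiableAt.differentiableWithinAt,
      h.smooth_warp.congr fun r hr => (hΦ r hr).deriv⟩
  exact h1.comp h.smooth_radius h.mapsTo_radius

/-- The differential inequality at the bottom of the maximum principle. It concerns
`w = u ^ (1 + 1 / α) / (1 + 1 / α) - Φ`, where `u` is the support function and `Φ` is the potential of
the conformal field, for a hypersurface with `F = u ^ (-1 / α)`; the frame `e` is principal, and `S i`
is the value at `(e i, e i)` of the Christoffel symbols of the first fundamental form. -/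
theorem sum_second_derivative_le {n : ℕ} (h : IsWarpedHypersurface U J O H lam ρ y ν)
    (hV : Module.finrank ℝ V = n) (hE : Module.finrank ℝ E = n)
    {Γ : Set (Fin n → ℝ)} (hΓ : IsAdmissibleCone Γ) {f : (Fin n → ℝ) → ℝ}
    (hf : IsCurvatureFunction Γ f) {κ : V → Fin n → ℝ} {e : V → Fin n → V}
    (hdiag : ∀ z ∈ U, Diagonalizes (warpedFirstForm lam H ρ y z) (warpedSecondForm lam H ρ y ν z)
      (κ z) (e z)) (hκ : ∀ z ∈ U, κ z ∈ Γ) {α : ℝ} (hα : 0 < α)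
    (heq : ∀ z ∈ U, f (κ z) ^ (-α) = lam (ρ z) * (ν z).1) {Φ : ℝ → ℝ}
    (hΦ : ∀ r ∈ J, HasDerivAt Φ (lam r) r) {z : V} (hz : z ∈ U) {c : ℝ}
    (hc : ∀ a e b : E, H (y z) (curvatureForm (leviCivita H) (y z) a e e) b =
      c * (H (y z) a b * H (y z) e e - H (y z) a e * H (y z) b e))
    (hlam : 0 ≤ deriv (deriv lam) (ρ z) / lam (ρ z) +
      (c - deriv lam (ρ z) ^ 2) / lam (ρ z) ^ 2) {w : V → ℝ}
    (hw : ∀ z ∈ U, w z = (f (κ z) ^ (-α)) ^ (1 + 1 / α) / (1 + 1 / α) - Φ (ρ z)) :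
    ContDiffAt ℝ ∞ w z ∧
    (∀ i, fderiv ℝ w z (e z i) =
      (κ z i / f (κ z) - 1) * (lam (ρ z) * fderiv ℝ ρ z (e z i))) ∧
    ∃ S : Fin n → V, (∀ i v, warpedFirstForm lam H ρ y z (S i) v =
      fderiv ℝ (warpedFirstForm lam H ρ y) z (e z i) (e z i) v -
        fderiv ℝ (warpedFirstForm lam H ρ y) z v (e z i) (e z i) / 2) ∧
      ∑ i, partialDeriv f i (κ z) * fderiv ℝ (fderiv ℝ w) z (e z i) (e z i) ≤
        ∑ i, partialDeriv f i (κ z) * fderiv ℝ w z (S i) +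
        deriv lam (ρ z) * (1 - ∑ i, partialDeriv f i (κ z)) +
        1 / (α * f (κ z) ^ (-α)) * ∑ i, κ z i * (lam (ρ z) * fderiv ℝ ρ z (e z i)) ^ 2 *
          (partialDeriv f i (κ z) * κ z i / f (κ z) - 1) := by
  have hmodel := h.isHypersurfaceModel (hV.trans hE.symm)
  have hnhds := h.isOpen.mem_nhds hz
  have hd : Diagonalizes (warpedFirstForm lam H ρ y z) (warpedSecondForm lam H ρ y ν z)
    (κ z) (e z) := hdiag z hz
  have hI := h.differentiableAt_of_contDiffOn h.contDiffOn_firstForm hz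
  have hII := h.differentiableAt_of_contDiffOn h.contDiffOn_secondForm hz
  have hF : ∀ z ∈ U, 0 < f (κ z) := fun z hz => hf.pos _ (hκ z hz)
  have hFz := hF z hz
  -- the support function
  obtain ⟨u, hu⟩ : ∃ u : V → ℝ, u = fun z => lam (ρ z) * (ν z).1 := ⟨_, rfl⟩
  have huF : ∀ z ∈ U, f (κ z) ^ (-α) = u z := fun z hz => by rw [heq z hz, hu]
  have hupos : ∀ z ∈ U, 0 < u z := fun z hz => by
    rw [← huF z hz]; exact Real.rpow_pos_of_pos (hF z hz) _
  have huz := hupos z hz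
  have husmooth : ContDiffOn ℝ ∞ u U := by
    rw [hu]; exact h.contDiffOn_warp.mul h.smooth_normal.fst
  have hug : ∀ z ∈ U, u z = warpedMetric (H (y z)) (lam (ρ z), (0 : E)) (ν z) := by
    intro z _; rw [hu, warpedMetric_apply]; simp
  -- the potential
  obtain ⟨Ψ, hΨ⟩ : ∃ Ψ : V → ℝ, Ψ = fun z => Φ (ρ z) := ⟨_, rfl⟩
  have hΨsmooth : ContDiffOn ℝ ∞ Ψ U := by rw [hΨ]; exact h.contDiffOn_potential hΦ
  have hΨd : ∀ z ∈ U, ∀ v, fderiv ℝ Ψ z v = lam (ρ z) * fderiv ℝ ρ z v := by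
    intro z hz v
    have h1 := (hΦ _ (h.mapsTo_radius hz)).comp_hasFDerivAt z
      (h.differentiableAt_of_contDiffOn h.smooth_radius hz).hasFDerivAt
    rw [hΨ]
    refine (DFunLike.congr_fun h1.fderiv v).trans ?_
    simp
  have hΨg : ∀ z ∈ U, ∀ v, fderiv ℝ Ψ z v =
      warpedMetric (H (y z)) (lam (ρ z), (0 : E)) (warpedDifferential lam ρ y z v) := by
    intro z hz v
    rw [hΨd z hz, warpedMetric_apply, warpedDifferential_apply]; simp
  have hdiff : ∀ {q : V → ℝ}, ContDiffOn ℝ ∞ q U → ∀ z ∈ U, DifferentiableAt ℝ q z :=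
    fun hq z hz => h.differentiableAt_of_contDiffOn hq hz
  have hdiff2 : ∀ {q : V → ℝ}, ContDiffOn ℝ ∞ q U → DifferentiableAt ℝ (fderiv ℝ q) z :=
    fun hq => h.differentiableAt_of_contDiffOn (hq.fderiv_of_isOpen h.isOpen (by simp)) hz
  -- the function `w` and its derivatives
  have hα' : 1 + 1 / α ≠ 0 := by positivity
  have hwU : ∀ z ∈ U, w z = u z ^ (1 + 1 / α) / (1 + 1 / α) - Ψ z := fun z hz => by
    rw [hw z hz, huF z hz, hΨ]
  have hwsmooth : ContDiffAt ℝ ∞ w z := by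
    refine ContDiffAt.congr_of_eventuallyEq (f := fun z => u z ^ (1 + 1 / α) / (1 + 1 / α) - Ψ z)
      ?_ (by filter_upwards [hnhds] with z hz using hwU z hz)
    exact (((husmooth.contDiffAt hnhds).rpow_const_of_ne huz.ne').div_const _).sub
      (hΨsmooth.contDiffAt hnhds)
  have hwd : ∀ z ∈ U, fderiv ℝ w z = u z ^ (1 / α) • fderiv ℝ u z - fderiv ℝ Ψ z := by
    intro z hz
    have h1 : w =ᶠ[𝓝 z] fun z => u z ^ (1 + 1 / α) / (1 + 1 / α) - Ψ z := by
      filter_upwards [h.isOpen.mem_nhds hz] with z hz using hwU z hz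
    have h2 := (((hdiff husmooth z hz).hasFDerivAt.rpow_const (p := 1 + 1 / α)
      (Or.inl (hupos z hz).ne')).mul_const (1 + 1 / α)⁻¹).fun_sub
      (hdiff hΨsmooth z hz).hasFDerivAt
    simp only [← div_eq_mul_inv] at h2
    rw [h1.fderiv_eq, h2.fderiv, smul_smul, add_sub_cancel_left, ← mul_assoc,
      inv_mul_cancel₀ hα', one_mul]
  have hwd2 : ∀ v, fderiv ℝ (fderiv ℝ w) z v v = u z ^ (1 / α) * fderiv ℝ (fderiv ℝ u) z v v +
      1 / α * u z ^ (1 / α - 1) * fderiv ℝ u z v ^ 2 - fderiv ℝ (fderiv ℝ Ψ) z v v := by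
    intro v
    have h1 : fderiv ℝ w =ᶠ[𝓝 z] fun z => u z ^ (1 / α) • fderiv ℝ u z - fderiv ℝ Ψ z := by
      filter_upwards [hnhds] with z hz using hwd z hz
    have h2 := (((hdiff husmooth z hz).hasFDerivAt.rpow_const (p := 1 / α)
      (Or.inl huz.ne')).fun_smul (hdiff2 husmooth).hasFDerivAt).fun_sub (hdiff2 hΨsmooth).hasFDerivAt
    rw [h1.fderiv_eq, h2.fderiv]
    simp
    ring
  have hub : u z ^ (1 / α) = 1 / f (κ z) := by
    rw [← huF z hz, ← Real.rpow_mul hFz.le, neg_mul, mul_one_div_cancel hα.ne',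
      Real.rpow_neg_one, one_div]
  have hub1 : u z ^ (1 / α - 1) = 1 / (f (κ z) * u z) := by
    rw [Real.rpow_sub_one huz.ne', hub, div_div]
  -- the tangential part of the conformal field
  obtain ⟨T, c', hT⟩ := hmodel.span z hz (lam (ρ z), (0 : E))
  have hc' : c' = u z := by
    rw [hug z hz, hT, map_add, add_apply, map_smul, smul_apply, h.unit z hz,
      hmodel.symm z hz, h.normal z hz]
    simp
  subst hc'
  have hprin : ∀ i v, warpedSecondForm lam H ρ y ν z (e z i) v =
      κ z i * warpedFirstForm lam H ρ y z (e z i) v := by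
    intro i v
    rw [hd.expand hV v]
    simp only [map_sum, map_smul, smul_eq_mul, Finset.mul_sum]
    refine Finset.sum_congr rfl fun j _ => ?_
    rw [(hd i j).1, (hd i j).2]
    split_ifs <;> ring
  have hsec := fun i => hmodel.second_derivatives hz hI hII hug hΨg (hdiff2 hΨsmooth)
    (hdiff2 husmooth) (e := e z i) (κ := κ z i) (by simpa using (hd i i).1) (hprin i) hT
  choose h1 h2 S hS hΨ2 hu2 using hsec
  have hp : ∀ i, fderiv ℝ Ψ z (e z i) = lam (ρ z) * fderiv ℝ ρ z (e z i) := fun i => hΨd z hz _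
  have hwe : ∀ i, fderiv ℝ w z (e z i) = (κ z i / f (κ z) - 1) * fderiv ℝ Ψ z (e z i) := by
    intro i
    rw [hwd z hz, sub_apply, smul_apply, hub, h2 i, smul_eq_mul]
    ring
  refine ⟨hwsmooth, fun i => by rw [hwe, hp], S, hS, ?_⟩
  -- the derivative of `F` along the tangential part of the conformal field
  have hev : ∀ᶠ z in 𝓝 z, z ∈ U := hnhds
  obtain ⟨hFd, hFv⟩ := Diagonalizes.differentiableAt_comp hV (hev.mono hdiag) hI hII
    (hf.differentiableAt hΓ (hκ z hz)) (hev.mono fun z hz σ => hf.symmetric σ _ (hκ z hz))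
    (hf.partialDeriv_eq hΓ (hκ z hz))
  have huT : fderiv ℝ u z T = ∑ i, κ z i * fderiv ℝ Ψ z (e z i) ^ 2 := by
    conv_lhs => rw [hd.expand hV T]
    simp only [map_sum, map_smul, smul_eq_mul]
    refine Finset.sum_congr rfl fun i _ => ?_
    rw [h2 i, h1 i]
    ring
  have huFT : fderiv ℝ u z T = -α * (u z / f (κ z)) * fderiv ℝ (fun z => f (κ z)) z T := by
    have h3 : u =ᶠ[𝓝 z] fun z => f (κ z) ^ (-α) := by
      filter_upwards [hnhds] with z hz using (huF z hz).symm
    rw [h3.fderiv_eq, (hFd.hasFDerivAt.rpow_const (p := -α) (Or.inl hFz.ne')).fderiv, smul_apply,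
      Real.rpow_sub_one hFz.ne', huF z hz]
    simp
  have hFT : fderiv ℝ (fun z => f (κ z)) z T =
      -(f (κ z) / (α * u z)) * ∑ i, κ z i * fderiv ℝ Ψ z (e z i) ^ 2 := by
    rw [← huT, huFT]
    field_simp
  have hcurv : ∀ i, warpedMetric (H (y z)) (curvatureForm (warpedForm lam H ρ y) z (e z i) T (ν z))
      (warpedDifferential lam ρ y z (e z i)) ≤ 0 := by
    intro i
    refine h.curvature_nonpos hz hc hlam ?_ hT _
    have h3 : 0 < lam (ρ z) * (ν z).1 := by rw [← heq z hz, huF z hz]; exact huz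
    exact (pos_of_mul_pos_right h3 (h.warp_pos _ (h.mapsTo_radius hz)).le).le
  have hEuler := hf.sum_partialDeriv_mul hΓ (hκ z hz)
  have hsq := hf.sq_le_sum _ (hκ z hz)
  have hmono := hf.strictly_increasing _ (hκ z hz)
  rw [huF z hz]
  rw [hFv T] at hFT
  obtain ⟨a, ha⟩ : ∃ a : Fin n → ℝ, a = fun i => partialDeriv f i (κ z) := ⟨_, rfl⟩
  obtain ⟨F, hF⟩ : ∃ F, F = f (κ z) := ⟨_, rfl⟩
  have haz : ∀ i, partialDeriv f i (κ z) = a i := fun i => by rw [ha]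
  simp only [haz, ← hF] at hEuler hsq hmono hFT hub hub1 hFz hwe ⊢
  -- the second derivative of `w` in the direction `e i`; the curvature term is nonpositive and dropped
  have hterm : ∀ i, a i * fderiv ℝ (fderiv ℝ w) z (e z i) (e z i) ≤
      a i * fderiv ℝ w z (S i) + deriv lam (ρ z) * (a i * κ z i / F - a i) -
        (u z / F) * (a i * κ z i ^ 2 - F * (a i * κ z i)) +
        a i * (fderiv ℝ (warpedSecondForm lam H ρ y ν) z T (e z i) (e z i) -
          κ z i * fderiv ℝ (warpedFirstForm lam H ρ y) z T (e z i) (e z i)) / F +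
        1 / (α * u z) * (κ z i * fderiv ℝ Ψ z (e z i) ^ 2 * (a i * κ z i / F)) := by
    intro i
    have h3 := mul_nonpos_of_nonneg_of_nonpos (div_pos (hmono i) hFz).le (hcurv i)
    rw [hwd2, hu2, hΨ2, hwd z hz, sub_apply, smul_apply, hub, hub1, h2, smul_eq_mul, ← sub_nonneg]
    refine (neg_nonneg.2 h3).trans (le_of_eq ?_)
    field_simp
    ring
  obtain ⟨b, hb⟩ : ∃ b : Fin n → ℝ, ∀ i,
      fderiv ℝ (warpedSecondForm lam H ρ y ν) z T (e z i) (e z i) -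
        κ z i * fderiv ℝ (warpedFirstForm lam H ρ y) z T (e z i) (e z i) = b i :=
    ⟨_, fun _ => rfl⟩
  simp only [hb] at hFT hterm
  refine (Finset.sum_le_sum fun i _ => hterm i).trans ?_
  simp only [Finset.sum_add_distrib, Finset.sum_sub_distrib, ← Finset.mul_sum, ← Finset.sum_div,
    hFT, hEuler, ← hp, mul_sub, mul_one]
  -- the only place where `F ^ 2 ≤ ∑ a i * κ i ^ 2` is used
  have h3 : 0 ≤ (u z / F) * (∑ i, a i * κ z i ^ 2 - F ^ 2) :=
    mul_nonneg (div_pos huz hFz).le (sub_nonneg.2 hsq)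
  have h4 : F / F = 1 := div_self hFz.ne'
  have h5 : -(F / (α * u z)) * (∑ i, κ z i * fderiv ℝ Ψ z (e z i) ^ 2) / F =
      -(1 / (α * u z) * ∑ i, κ z i * fderiv ℝ Ψ z (e z i) ^ 2) := by
    field_simp
  rw [h4, h5]
  linarith

end IsWarpedHypersurface

end Inequality

/-! ### The fundamental forms in polar coordinates -/

section PolarForms

variable {n : ℕ}
  {N : Type*} [TopologicalSpace N] [ChartedSpace (EuclideanSpace ℝ (Fin n)) N]
  [IsManifold (𝓡 n) ∞ N]
  {Q : Type*} [TopologicalSpace Q] [ChartedSpace (EuclideanSpace ℝ (Fin (n + 1))) Q]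
  [IsManifold (𝓡 (n + 1)) ∞ Q]
  {gN : RiemMetric (EuclideanSpace ℝ (Fin n)) N}
  {gQ : RiemMetric (EuclideanSpace ℝ (Fin (n + 1))) Q} {rbar : EReal} {lam : ℝ → ℝ}
  {ψ : OpenPartialHomeomorph (ℝ × N) Q}
  {M : Type*} [TopologicalSpace M] [ChartedSpace (EuclideanSpace ℝ (Fin n)) M]
  [IsManifold (𝓡 n) ∞ M] {X : M → Q} {ν : ∀ x : M, TangentSpace (𝓡 (n + 1)) (X x)}

theorem radialField_apply {p : ℝ × N} (hp : p ∈ ψ.source) :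
    radialField lam ψ (ψ p) =
      mfderiv (𝓘(ℝ, ℝ).prod (𝓡 n)) (𝓡 (n + 1)) ψ p (lam p.1, (0 : EuclideanSpace ℝ (Fin n))) := by
  have key : ∀ p', p' = p → (lam p'.1 • (mfderiv (𝓘(ℝ, ℝ).prod (𝓡 n)) (𝓡 (n + 1)) ψ p'
      ((1 : ℝ), (0 : EuclideanSpace ℝ (Fin n))) : EuclideanSpace ℝ (Fin (n + 1)))) =
      (mfderiv (𝓘(ℝ, ℝ).prod (𝓡 n)) (𝓡 (n + 1)) ψ p
        (lam p.1, (0 : EuclideanSpace ℝ (Fin n))) : EuclideanSpace ℝ (Fin (n + 1))) := by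
    rintro p' rfl
    have h1 : (lam p'.1, (0 : EuclideanSpace ℝ (Fin n))) =
      lam p'.1 • ((1 : ℝ), (0 : EuclideanSpace ℝ (Fin n))) := by simp
    rw [h1]
    exact (ContinuousLinearMap.map_smul _ _ _).symm
  exact (if_pos (ψ.map_source hp)).trans (key _ (ψ.left_inv hp))

/-- In polar coordinates the metric dual of `lam ∂_r` is `lam dr`. -/
theorem IsWarpedProduct.inner_radialField (h : IsWarpedProduct gN gQ rbar lam ψ) (q : N) {y : Q}
    (hy : y ∈ warpedSource (n := n) ψ q) (v : TangentSpace (𝓡 (n + 1)) y) :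
    gQ.inner y (radialField lam ψ y) v =
      lam (ψ.symm y).1 * (tangentCoord (warpedCoord (n := n) ψ q) y v).1 := by
  have hS := h.isCoordinateSystem q
  have key : ∀ a ∈ radialInterval rbar ×ˢ (extChartAt (𝓡 n) q).target,
      ∀ v : TangentSpace (𝓡 (n + 1)) (warpedParam (n := n) ψ q a),
      gQ.inner (warpedParam (n := n) ψ q a) (radialField lam ψ (warpedParam (n := n) ψ q a)) v =
        lam a.1 * (tangentCoord (warpedCoord (n := n) ψ q) (warpedParam (n := n) ψ q a) v).1 := by
    intro a ha v
    have h0 : (a.1, (extChartAt (𝓡 n) q).symm a.2) ∈ ψ.source := by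
      rw [h.source_eq]; exact ⟨ha.1, mem_univ _⟩
    have h1 : radialField lam ψ (warpedParam (n := n) ψ q a) =
        tangentVector (E := EuclideanSpace ℝ (Fin (n + 1))) (warpedParam (n := n) ψ q) a
          (lam a.1, 0) := by
      refine (radialField_apply h0).trans (Eq.trans ?_ (h.tangentVector_eq q ha _).symm)
      have h1 : (0 : EuclideanSpace ℝ (Fin n)) =
          (mfderiv (𝓡 n) (𝓡 n) (extChartAt (𝓡 n) q).symm a.2 (0 : EuclideanSpace ℝ (Fin n)) :
            EuclideanSpace ℝ (Fin n)) := (ContinuousLinearMap.map_zero _).symm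
      exact congrArg (fun b : EuclideanSpace ℝ (Fin n) => (mfderiv (𝓘(ℝ, ℝ).prod (𝓡 n))
        (𝓡 (n + 1)) ψ (a.1, (extChartAt (𝓡 n) q).symm a.2) (lam a.1, b) :
          EuclideanSpace ℝ (Fin (n + 1)))) h1
    have h2 : v = tangentVector (E := EuclideanSpace ℝ (Fin (n + 1))) (warpedParam (n := n) ψ q) a
        (tangentCoord (warpedCoord (n := n) ψ q) (warpedParam (n := n) ψ q a) v) := by
      have h3 := hS.mfderiv_inv_mfderiv (hS.mapsTo_inv ha) v
      rw [hS.right_inv a ha] at h3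
      exact h3.symm
    rw [h1]
    conv_lhs => rw [h2]
    rw [← h.warpedMetric_eq q ha, warpedMetric_apply]
    simp
  have h3 := key _ (hS.mapsTo hy)
  rw [hS.left_inv y hy] at h3
  exact h3 v

/-- The part of the chart domain at `x₀` whose image lies in the domain of the polar coordinates. -/
def polarDomain (ψ : OpenPartialHomeomorph (ℝ × N) Q) (X : M → Q) (x₀ : M) (q : N) :
    Set (EuclideanSpace ℝ (Fin n)) :=
  {z | z ∈ (extChartAt (𝓡 n) x₀).target ∧
    X ((extChartAt (𝓡 n) x₀).symm z) ∈ warpedSource (n := n) ψ q}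

/-- The radius along the hypersurface `X`, in the chart at `x₀`. -/
noncomputable def radiusInChart (ψ : OpenPartialHomeomorph (ℝ × N) Q) (X : M → Q) (x₀ : M)
    (z : EuclideanSpace ℝ (Fin n)) : ℝ :=
  (ψ.symm (X ((extChartAt (𝓡 n) x₀).symm z))).1

/-- The coordinates in the chart of the fibre at `q` of the projection to the fibre of the
hypersurface `X`, in the chart at `x₀`. -/
noncomputable def fibreInChart (ψ : OpenPartialHomeomorph (ℝ × N) Q) (X : M → Q) (x₀ : M) (q : N)
    (z : EuclideanSpace ℝ (Fin n)) : EuclideanSpace ℝ (Fin n) :=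
  extChartAt (𝓡 n) q (ψ.symm (X ((extChartAt (𝓡 n) x₀).symm z))).2

/-- The unit normal `ν` in polar coordinates in the rescaled frame, in the chart at `x₀`. -/
noncomputable def normalInChart (lam : ℝ → ℝ) (ψ : OpenPartialHomeomorph (ℝ × N) Q) (X : M → Q)
    (ν : ∀ x : M, TangentSpace (𝓡 (n + 1)) (X x)) (x₀ : M) (q : N)
    (z : EuclideanSpace ℝ (Fin n)) : ℝ × EuclideanSpace ℝ (Fin n) :=
  ((fieldInCoord x₀ ν (warpedCoord (n := n) ψ q) z).1,
    lam (radiusInChart ψ X x₀ z) • (fieldInCoord x₀ ν (warpedCoord (n := n) ψ q) z).2)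

theorem isOpen_polarDomain (h : IsWarpedProduct gN gQ rbar lam ψ) (hX : Continuous X) (x₀ : M)
    (q : N) : IsOpen (polarDomain (n := n) ψ X x₀ q) := by
  rw [isOpen_iff_mem_nhds]
  intro z hz
  exact eventually_mem_chart hX (h.isCoordinateSystem q).isOpen_source hz.1 hz.2

theorem fderiv_mapInCoord_warpedCoord (h : IsWarpedProduct gN gQ rbar lam ψ)
    (hX : ContMDiff (𝓡 n) (𝓡 (n + 1)) ∞ X) {x₀ : M} {q : N} {z : EuclideanSpace ℝ (Fin n)}
    (hz : z ∈ polarDomain ψ X x₀ q) (v : EuclideanSpace ℝ (Fin n)) :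
    fderiv ℝ (mapInCoord x₀ X (warpedCoord (n := n) ψ q)) z v =
      (fderiv ℝ (radiusInChart ψ X x₀) z v, fderiv ℝ (fibreInChart ψ X x₀ q) z v) := by
  have hS := h.isCoordinateSystem q
  have h1 := ((contDiffAt_mapInCoord hX hS.isOpen_source hS.smooth hz.1 hz.2).differentiableAt
    (by simp)).hasFDerivAt
  have h2 : fderiv ℝ (radiusInChart ψ X x₀) z = _ := h1.fst.fderiv
  have h3 : fderiv ℝ (fibreInChart ψ X x₀ q) z = _ := h1.snd.fderiv
  rw [h2, h3]
  rfl

theorem warpedFirstForm_inChart (h : IsWarpedProduct gN gQ rbar lam ψ)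
    (hX : ContMDiff (𝓡 n) (𝓡 (n + 1)) ∞ X) {x₀ : M} {q : N} {z : EuclideanSpace ℝ (Fin n)}
    (hz : z ∈ polarDomain ψ X x₀ q) (v w : EuclideanSpace ℝ (Fin n)) :
    warpedFirstForm lam (metricInChart gN q) (radiusInChart ψ X x₀) (fibreInChart ψ X x₀ q) z v w =
      firstFundForm (F := EuclideanSpace ℝ (Fin n)) gQ X ((extChartAt (𝓡 n) x₀).symm z)
        (tangentVector (extChartAt (𝓡 n) x₀).symm z v)
        (tangentVector (extChartAt (𝓡 n) x₀).symm z w) := by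
  rw [firstFundForm_eq (h.isCoordinateSystem q)
    (W := fun x => warpedMetric (lam x.1 ^ 2 • metricInChart gN q x.2))
    (fun x hx a b => h.warpedMetric_eq q hx a b) hX hz.1 hz.2, fderiv_mapInCoord_warpedCoord h hX hz,
    fderiv_mapInCoord_warpedCoord h hX hz, IsHypersurfaceModel.firstForm_apply, warpedMetric_apply,
    warpedMetric_apply, warpedDifferential_apply, warpedDifferential_apply]
  simp only [map_smul, smul_apply, smul_eq_mul]
  simp only [mapInCoord, warpedCoord, radiusInChart, fibreInChart]
  ring

theorem IsWarpedProduct.isWarpedHypersurface (h : IsWarpedProduct gN gQ rbar lam ψ)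
    (hsmooth : ContDiffOn ℝ ∞ lam (radialInterval rbar))
    (hpos : ∀ r ∈ radialInterval rbar, 0 < lam r)
    (hX : IsSmoothImmersion (EuclideanSpace ℝ (Fin n)) (EuclideanSpace ℝ (Fin (n + 1))) X)
    (hν : IsUnitNormal (EuclideanSpace ℝ (Fin n)) gQ X ν) (x₀ : M) (q : N) :
    IsWarpedHypersurface (polarDomain ψ X x₀ q) (radialInterval rbar) (extChartAt (𝓡 n) q).target
      (metricInChart gN q) lam (radiusInChart ψ X x₀) (fibreInChart ψ X x₀ q)
      (normalInChart lam ψ X ν x₀ q) := by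
  have hS := h.isCoordinateSystem q
  have hmap : ∀ z ∈ polarDomain ψ X x₀ q,
      ContDiffAt ℝ ∞ (mapInCoord x₀ X (warpedCoord (n := n) ψ q)) z := fun z hz =>
    contDiffAt_mapInCoord hX.smooth hS.isOpen_source hS.smooth hz.1 hz.2
  have hρ : ContDiffOn ℝ ∞ (radiusInChart ψ X x₀) (polarDomain ψ X x₀ q) := fun z hz =>
    (hmap z hz).fst.contDiffWithinAt
  have hfield : ∀ z ∈ polarDomain ψ X x₀ q,
      ContDiffAt ℝ ∞ (fieldInCoord x₀ ν (warpedCoord (n := n) ψ q)) z := fun z hz =>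
    contDiffAt_fieldInCoord hX.smooth hν.smooth hS.isOpen_source hS.smooth hz.1 hz.2
  have hJ : MapsTo (radiusInChart ψ X x₀) (polarDomain ψ X x₀ q) (radialInterval rbar) :=
    fun z hz => (hS.mapsTo hz.2).1
  have hW : ∀ z ∈ polarDomain ψ X x₀ q, ∀ a b : TangentSpace (𝓡 (n + 1))
      (X ((extChartAt (𝓡 n) x₀).symm z)),
      (tangentCoord (warpedCoord (n := n) ψ q) _ a).1 *
        (tangentCoord (warpedCoord (n := n) ψ q) _ b).1 + lam (radiusInChart ψ X x₀ z) ^ 2 *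
        metricInChart gN q (fibreInChart ψ X x₀ q z)
          (tangentCoord (warpedCoord (n := n) ψ q) _ a).2
          (tangentCoord (warpedCoord (n := n) ψ q) _ b).2 = gQ.inner _ a b := by
    intro z hz a b
    rw [← hS.metric_mfderiv (W := fun x => warpedMetric (lam x.1 ^ 2 • metricInChart gN q x.2))
      (fun x hx a b => h.warpedMetric_eq q hx a b) hz.2, warpedMetric_apply]
    rfl
  exact {
    isOpen := isOpen_polarDomain h hX.smooth.continuous x₀ q
    isOpen_interval := isOpen_radialInterval rbar
    metric := isLocalMetric_metricInChart gN q
    smooth_warp := hsmooth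
    warp_pos := hpos
    smooth_radius := hρ
    smooth_fibre := fun z hz => (hmap z hz).snd.contDiffWithinAt
    smooth_normal := fun z hz => ((hfield z hz).fst.contDiffWithinAt).prodMk
      (((hsmooth.comp hρ hJ) z hz).smul (hfield z hz).snd.contDiffWithinAt)
    mapsTo_radius := hJ
    mapsTo_fibre := fun z hz => (hS.mapsTo hz.2).2
    injective := by
      intro z hz
      rw [injective_iff_map_eq_zero]
      intro v hv
      have h1 := warpedFirstForm_inChart h hX.smooth hz v v
      rw [IsHypersurfaceModel.firstForm_apply, hv, map_zero, firstFundForm] at h1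
      by_contra hne
      refine (gQ.pos _ _ fun h0 => hne ?_).ne h1
      have h2 := hX.injective_mfderiv _ (h0.trans (map_zero _).symm)
      have h3 := mfderiv_extChartAt_mfderiv_symm hz.1 v
      rw [tangentVector] at h2
      exact h3.symm.trans ((congrArg _ h2).trans (map_zero _))
    unit := by
      intro z hz
      have h1 := hW z hz (ν _) (ν _)
      rw [hν.unit] at h1
      rw [warpedMetric_apply, ← h1]
      simp only [normalInChart, map_smul, smul_apply, smul_eq_mul, fieldInCoord]
      ring
    normal := by
      intro z hz v
      have h1 := hW z hz (ν _) (mfderiv (𝓡 n) (𝓡 (n + 1)) X ((extChartAt (𝓡 n) x₀).symm z)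
        (tangentVector (extChartAt (𝓡 n) x₀).symm z v))
      rw [hν.normal] at h1
      have h2 := fderiv_mapInCoord hX.smooth hS.isOpen_source hS.smooth hz.1 hz.2 v
      rw [← h2, fderiv_mapInCoord_warpedCoord h hX.smooth hz] at h1
      rw [warpedMetric_apply, warpedDifferential_apply, ← h1]
      simp only [normalInChart, map_smul, smul_apply, smul_eq_mul, fieldInCoord]
      ring }

/-- Only the symmetrized forms are compared: `secondFundForm` is defined through the shape operator
and is not symmetric by definition. -/
theorem warpedSecondForm_inChart_add (h : IsWarpedProduct gN gQ rbar lam ψ)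
    (hsmooth : ContDiffOn ℝ ∞ lam (radialInterval rbar))
    (hpos : ∀ r ∈ radialInterval rbar, 0 < lam r)
    (hX : IsSmoothImmersion (EuclideanSpace ℝ (Fin n)) (EuclideanSpace ℝ (Fin (n + 1))) X)
    (hν : IsUnitNormal (EuclideanSpace ℝ (Fin n)) gQ X ν) {x₀ : M} {q : N}
    {z : EuclideanSpace ℝ (Fin n)} (hz : z ∈ polarDomain ψ X x₀ q)
    (v w : EuclideanSpace ℝ (Fin n)) :
    warpedSecondForm lam (metricInChart gN q) (radiusInChart ψ X x₀) (fibreInChart ψ X x₀ q)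
        (normalInChart lam ψ X ν x₀ q) z v w +
      warpedSecondForm lam (metricInChart gN q) (radiusInChart ψ X x₀) (fibreInChart ψ X x₀ q)
        (normalInChart lam ψ X ν x₀ q) z w v =
      secondFundForm (F := EuclideanSpace ℝ (Fin n)) gQ X ν ((extChartAt (𝓡 n) x₀).symm z)
        (tangentVector (extChartAt (𝓡 n) x₀).symm z v)
        (tangentVector (extChartAt (𝓡 n) x₀).symm z w) +
      secondFundForm (F := EuclideanSpace ℝ (Fin n)) gQ X ν ((extChartAt (𝓡 n) x₀).symm z)
        (tangentVector (extChartAt (𝓡 n) x₀).symm z w)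
        (tangentVector (extChartAt (𝓡 n) x₀).symm z v) := by
  have hS := h.isCoordinateSystem q
  have hhyp := h.isWarpedHypersurface hsmooth hpos hX hν x₀ q
  have hWd : DifferentiableOn ℝ (fun x : ℝ × EuclideanSpace ℝ (Fin n) =>
      warpedMetric (lam x.1 ^ 2 • metricInChart gN q x.2))
      (radialInterval rbar ×ˢ (extChartAt (𝓡 n) q).target) := fun x hx =>
    (differentiableAt_warpedMetric ((hsmooth.contDiffAt ((isOpen_radialInterval rbar).mem_nhds
      hx.1)).differentiableAt (by simp)) (((isLocalMetric_metricInChart gN q).contDiffAt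
        hx.2).differentiableAt (by simp))).differentiableWithinAt
  rw [secondFundForm_add_eq hS
    (W := fun x => warpedMetric (lam x.1 ^ 2 • metricInChart gN q x.2))
    (fun x hx a b => h.warpedMetric_eq q hx a b) hWd hX.smooth hν.smooth hz.1 hz.2,
    fderiv_mapInCoord_warpedCoord h hX.smooth hz, fderiv_mapInCoord_warpedCoord h hX.smooth hz]
  exact (hhyp.metricVariation_eq hz ((contDiffAt_fieldInCoord hX.smooth hν.smooth hS.isOpen_source
    hS.smooth hz.1 hz.2).differentiableAt (by simp)) v w).symm

end PolarForms

/-! ### Ellipticity -/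

section Ellipticity

open scoped RealInnerProductSpace

variable {V : Type*} [NormedAddCommGroup V] [InnerProductSpace ℝ V] {n : ℕ}

namespace Diagonalizes

variable {a b : V →L[ℝ] V →L[ℝ] ℝ} {κ : Fin n → ℝ} {e : Fin n → V}

theorem norm_sq_frame_le (h : Diagonalizes a b κ e) {B : ℝ} (hB : ∀ v, ‖v‖ ^ 2 ≤ B * a v v)
    (i : Fin n) : ‖e i‖ ^ 2 ≤ B := by
  simpa [(h i i).1] using hB (e i)

/-- A principal frame is uniformly elliptic: it detects every covector. -/
theorem norm_sq_le_sum_inner [FiniteDimensional ℝ V] (hn : Module.finrank ℝ V = n)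
    (h : Diagonalizes a b κ e) {B : ℝ} (ha : ‖a‖ ≤ B) (ξ : V) :
    ‖ξ‖ ^ 2 ≤ B * ∑ i, ⟪ξ, e i⟫ ^ 2 := by
  have h1 : ‖ξ‖ ^ 2 = ∑ i, a ξ (e i) * ⟪ξ, e i⟫ := by
    have h0 := congrArg (fun v => ⟪ξ, v⟫) (h.expand hn ξ)
    simpa only [inner_sum, real_inner_smul_right, real_inner_self_eq_norm_sq] using h0
  have h2 : (‖ξ‖ ^ 2) ^ 2 ≤ (B * ‖ξ‖ ^ 2) * ∑ i, ⟪ξ, e i⟫ ^ 2 := by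
    rw [h1]
    refine (Finset.sum_mul_sq_le_sq_mul_sq _ _ _).trans ?_
    rw [← h.apply_self hn, ← h1]
    refine mul_le_mul_of_nonneg_right ?_ (Finset.sum_nonneg fun _ _ => sq_nonneg _)
    calc a ξ ξ ≤ ‖a ξ ξ‖ := le_abs_self _
      _ ≤ ‖a‖ * ‖ξ‖ * ‖ξ‖ := a.le_opNorm₂ ξ ξ
      _ ≤ B * ‖ξ‖ ^ 2 := by rw [mul_assoc, ← sq]; gcongr
  by_cases h0 : ξ = 0
  · subst h0; simp
  · have h3 : 0 < ‖ξ‖ ^ 2 := by positivity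
    nlinarith

/-- The Christoffel symbols are bounded by the metric and its derivative. Here `a` is the metric and
`D` its derivative, and `s` is the value of the Christoffel symbols at `(e i, e i)`. -/
theorem norm_christoffel_le (h : Diagonalizes a b κ e) {B : ℝ} (hB0 : 0 ≤ B)
    (hB : ∀ v, ‖v‖ ^ 2 ≤ B * a v v) {D : V →L[ℝ] V →L[ℝ] V →L[ℝ] ℝ} (hD : ‖D‖ ≤ B) {s : V}
    {i : Fin n} (hs : ∀ v, a s v = D (e i) (e i) v - D v (e i) (e i) / 2) :
    ‖s‖ ≤ 2 * B ^ 3 := by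
  have hei := h.norm_sq_frame_le hB i
  have hDb : ∀ x y z : V, |D x y z| ≤ B * ‖x‖ * ‖y‖ * ‖z‖ := fun x y z =>
    calc |D x y z| ≤ ‖D x‖ * ‖y‖ * ‖z‖ := (D x).le_opNorm₂ y z
      _ ≤ (‖D‖ * ‖x‖) * ‖y‖ * ‖z‖ := by gcongr; exact D.le_opNorm x
      _ ≤ B * ‖x‖ * ‖y‖ * ‖z‖ := by gcongr
  have h1 := hDb (e i) (e i) s
  have h2 := hDb s (e i) (e i)
  have h3 : B * ‖e i‖ * ‖e i‖ * ‖s‖ ≤ B * B * ‖s‖ := by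
    rw [mul_assoc B, ← sq]; gcongr
  have h4 : B * ‖s‖ * ‖e i‖ * ‖e i‖ ≤ B * B * ‖s‖ := by
    calc B * ‖s‖ * ‖e i‖ * ‖e i‖ = B * ‖e i‖ * ‖e i‖ * ‖s‖ := by ring
      _ ≤ _ := h3
  have h5 : a s s ≤ 2 * (B * B * ‖s‖) := by
    rw [hs]
    have := (abs_le.1 h1).2
    have := (abs_le.1 h2).1
    have : 0 ≤ B * B * ‖s‖ := by positivity
    linarith
  have h6 : ‖s‖ ^ 2 ≤ B * (2 * (B * B * ‖s‖)) := (hB s).trans (by gcongr)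
  by_cases h0 : ‖s‖ = 0
  · rw [h0]; positivity
  · have h7 : 0 < ‖s‖ := lt_of_le_of_ne (norm_nonneg _) (Ne.symm h0)
    nlinarith

/-- The differential inequality implies that the second order part is bounded by a multiple of the
differential. A negative `κ i` contributes with the wrong sign, but then
`(p i) ^ 2 ≤ (G (e i)) ^ 2`. -/
theorem sum_le_mul_norm (h : Diagonalizes a b κ e) {B m L : ℝ} (hB0 : 0 ≤ B) (hm : 0 < m)
    (hL : 0 ≤ L) (hB : ∀ v, ‖v‖ ^ 2 ≤ B * a v v) {D : V →L[ℝ] V →L[ℝ] V →L[ℝ] ℝ} (hD : ‖D‖ ≤ B)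
    {S : Fin n → V} (hS : ∀ i v, a (S i) v = D (e i) (e i) v - D v (e i) (e i) / 2)
    {φ p q : Fin n → ℝ} {F μ τ : ℝ} {G : V →L[ℝ] ℝ} (hφm : ∀ i, 0 < φ i) (hφL : ∀ i, φ i ≤ L)
    (hκ : ∀ i, |κ i| ≤ L) (hF : m ≤ F) (hφF : ∀ i, 0 ≤ F - φ i * κ i) (hG : ‖G‖ ≤ L)
    (hp : ∀ i, G (e i) = (κ i / F - 1) * p i) (hμ : 0 ≤ μ) (hsum : 1 ≤ ∑ i, φ i) (hτ0 : 0 ≤ τ)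
    (hτ : τ ≤ L) (hq : ∑ i, φ i * q i ≤ ∑ i, φ i * G (S i) + μ * (1 - ∑ i, φ i) +
      τ * ∑ i, κ i * p i ^ 2 * (φ i * κ i / F - 1)) :
    ∑ i, φ i * q i ≤ n * (L * (2 * B ^ 3) + L * (L * (L * L / m + 1) * (L * B))) * ‖G‖ := by
  have hF0 : 0 < F := hm.trans_le hF
  have h1 : ∑ i, φ i * G (S i) ≤ ∑ _i : Fin n, L * (2 * B ^ 3) * ‖G‖ := by
    refine Finset.sum_le_sum fun i _ => ?_
    have h2 : G (S i) ≤ ‖G‖ * (2 * B ^ 3) := (le_abs_self _).trans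
      ((G.le_opNorm _).trans (by gcongr; exact h.norm_christoffel_le hB0 hB hD (hS i)))
    calc φ i * G (S i) ≤ φ i * (‖G‖ * (2 * B ^ 3)) :=
          mul_le_mul_of_nonneg_left h2 (hφm i).le
      _ ≤ L * (‖G‖ * (2 * B ^ 3)) :=
          mul_le_mul_of_nonneg_right (hφL i) (by positivity)
      _ = _ := by ring
  have h2 : μ * (1 - ∑ i, φ i) ≤ 0 := mul_nonpos_of_nonneg_of_nonpos hμ (by linarith)
  have h3 : ∀ i, κ i * p i ^ 2 * (φ i * κ i / F - 1) ≤
      L * (L * L / m + 1) * (L * B) * ‖G‖ := by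
    intro i
    have hR : 0 ≤ L * (L * L / m + 1) * (L * B) * ‖G‖ := by positivity
    rcases le_or_gt 0 (κ i) with hi | hi
    · refine le_trans (mul_nonpos_of_nonneg_of_nonpos (by positivity) ?_) hR
      rw [sub_nonpos, div_le_one hF0]
      linarith [hφF i]
    · have h4 : p i ^ 2 ≤ L * B * ‖G‖ := by
        have h5 : 1 ≤ (κ i / F - 1) ^ 2 := by
          have := div_neg_of_neg_of_pos hi hF0
          nlinarith
        calc p i ^ 2 = 1 * p i ^ 2 := (one_mul _).symm
          _ ≤ (κ i / F - 1) ^ 2 * p i ^ 2 := by gcongr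
          _ = |G (e i)| ^ 2 := by rw [sq_abs, hp]; ring
          _ ≤ (‖G‖ * ‖e i‖) ^ 2 := by gcongr; exact G.le_opNorm _
          _ = ‖G‖ * ‖e i‖ ^ 2 * ‖G‖ := by ring
          _ ≤ L * B * ‖G‖ := by gcongr; exact h.norm_sq_frame_le hB i
      have h6 : -κ i ≤ L := (neg_le_abs _).trans (hκ i)
      have h7 : φ i * -κ i / F ≤ L * L / m := by
        have : 0 ≤ -κ i := by linarith
        exact div_le_div₀ (by positivity)
          (mul_le_mul (hφL i) h6 this hL) hm hF
      have h8 : 0 ≤ φ i * -κ i / F :=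
        div_nonneg (mul_nonneg (hφm i).le (by linarith)) hF0.le
      calc κ i * p i ^ 2 * (φ i * κ i / F - 1) = -κ i * (φ i * -κ i / F + 1) * p i ^ 2 := by ring
        _ ≤ L * (L * L / m + 1) * (L * B * ‖G‖) := by gcongr
        _ = _ := by ring
  have h4 : τ * ∑ i, κ i * p i ^ 2 * (φ i * κ i / F - 1) ≤
      ∑ _i : Fin n, L * (L * (L * L / m + 1) * (L * B) * ‖G‖) := by
    rw [← Finset.mul_sum]
    calc τ * ∑ i, κ i * p i ^ 2 * (φ i * κ i / F - 1)
        ≤ τ * ∑ _i : Fin n, L * (L * L / m + 1) * (L * B) * ‖G‖ :=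
          mul_le_mul_of_nonneg_left (Finset.sum_le_sum fun i _ => h3 i) hτ0
      _ ≤ _ := mul_le_mul_of_nonneg_right hτ (Finset.sum_nonneg fun _ _ => by positivity)
  simp only [Finset.sum_const, Finset.card_univ, Fintype.card_fin, nsmul_eq_mul] at h1 h4
  calc _ ≤ _ := hq
    _ ≤ n * (L * (2 * B ^ 3) * ‖G‖) + 0 +
        n * (L * (L * (L * L / m + 1) * (L * B) * ‖G‖)) := by gcongr
    _ = _ := by ring

end Diagonalizes

end Ellipticity

/-- Principal curvatures are only given up to order, so bounds near a point rest on the symmetry of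
the curvature function. -/
theorem Diagonalizes.eventually_bounds {V : Type*} [NormedAddCommGroup V] [NormedSpace ℝ V]
    [FiniteDimensional ℝ V] {n : ℕ} (hn : Module.finrank ℝ V = n)
    {Z : Type*} [TopologicalSpace Z] {a b : Z → V →L[ℝ] V →L[ℝ] ℝ} {κ : Z → Fin n → ℝ}
    {e : Z → Fin n → V} {z₁ : Z} (h : ∀ᶠ z in 𝓝 z₁, Diagonalizes (a z) (b z) (κ z) (e z))
    (ha : ContinuousAt a z₁) (hb : ContinuousAt b z₁) {Γ : Set (Fin n → ℝ)}
    (hΓ : IsAdmissibleCone Γ) {f : (Fin n → ℝ) → ℝ} (hf : IsCurvatureFunction Γ f)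
    (hκ : ∀ᶠ z in 𝓝 z₁, κ z ∈ Γ) :
    ∃ m > 0, ∃ L, ∀ᶠ z in 𝓝 z₁, m ≤ f (κ z) ∧ f (κ z) ≤ L ∧
      ∀ i, m ≤ partialDeriv f i (κ z) ∧ partialDeriv f i (κ z) ≤ L ∧ |κ z i| ≤ L := by
  have hk := hκ.self_of_nhds
  have hfs := hf.smooth.contDiffAt (hΓ.isOpen.mem_nhds hk)
  have hpc : ∀ i, ContinuousAt (partialDeriv f i) (κ z₁) := fun i =>
    ((hfs.fderiv_right (m := ∞) (by simp)).continuousAt).clm_apply continuousAt_const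
  obtain ⟨m, hm, hmf, hmp⟩ : ∃ m > 0, m < f (κ z₁) ∧ ∀ i, m < partialDeriv f i (κ z₁) := by
    have h1 : ∀ᶠ m : ℝ in 𝓝[>] 0, m < f (κ z₁) ∧ ∀ i, m < partialDeriv f i (κ z₁) :=
      Filter.Eventually.and (nhdsWithin_le_nhds (Iio_mem_nhds (hf.pos _ hk)))
        (eventually_all.2 fun i => nhdsWithin_le_nhds
          (Iio_mem_nhds (hf.strictly_increasing _ hk i)))
    obtain ⟨m, hm⟩ := (h1.and self_mem_nhdsWithin).exists
    exact ⟨m, hm.2, hm.1.1, hm.1.2⟩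
  obtain ⟨L, hLf, hLp⟩ : ∃ L, f (κ z₁) < L ∧
      ∀ i, partialDeriv f i (κ z₁) < L ∧ |κ z₁ i| < L := by
    have h1 : ∀ᶠ L : ℝ in atTop, f (κ z₁) < L ∧
        ∀ i, partialDeriv f i (κ z₁) < L ∧ |κ z₁ i| < L :=
      (eventually_gt_atTop _).and (eventually_all.2 fun i =>
        (eventually_gt_atTop _).and (eventually_gt_atTop _))
    exact h1.exists
  refine ⟨m, hm, L, ?_⟩
  have hS : ∀ᶠ k in 𝓝 (κ z₁), m < f k ∧ f k < L ∧
      ∀ i, m < partialDeriv f i k ∧ partialDeriv f i k < L ∧ |k i| < L := by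
    refine (hfs.continuousAt.eventually_const_lt hmf).and
      ((hfs.continuousAt.eventually_lt_const hLf).and (eventually_all.2 fun i => ?_))
    refine ((hpc i).eventually_const_lt (hmp i)).and
      (((hpc i).eventually_lt_const (hLp i).1).and ?_)
    exact (continuous_abs.comp (continuous_apply i)).continuousAt.eventually_lt_const (hLp i).2
  filter_upwards [Diagonalizes.eventually_exists_perm hn h ha hb hS, hκ] with z hz hzΓ
  obtain ⟨σ, hσ1, hσ2, hσ3⟩ := hz
  rw [hf.symmetric σ _ hzΓ] at hσ1 hσ2
  refine ⟨hσ1.le, hσ2.le, fun i => ?_⟩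
  have h1 := hσ3 (σ.symm i)
  rw [hf.partialDeriv_comp_perm hΓ hzΓ, Equiv.apply_symm_apply, Function.comp_apply,
    Equiv.apply_symm_apply] at h1
  exact ⟨h1.1.le, h1.2.1.le, h1.2.2.le⟩

/-! ### Self-similar hypersurfaces -/

section SelfSimilar

variable {n : ℕ}
  {N : Type*} [TopologicalSpace N] [ChartedSpace (EuclideanSpace ℝ (Fin n)) N]
  [IsManifold (𝓡 n) ∞ N]
  {Q : Type*} [TopologicalSpace Q] [ChartedSpace (EuclideanSpace ℝ (Fin (n + 1))) Q]
  [IsManifold (𝓡 (n + 1)) ∞ Q]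
  {M : Type*} [TopologicalSpace M] [ChartedSpace (EuclideanSpace ℝ (Fin n)) M]
  [IsManifold (𝓡 n) ∞ M]

/-- `X : M → Q` is a hypersurface of the warped product `Q` over a space form `N`, with unit normal
`ν` and principal curvatures `k`, and it solves `f(k)^(-α) = g(lam ∂_r, ν)`. -/
structure IsSelfSimilarHypersurface (gN : RiemMetric (EuclideanSpace ℝ (Fin n)) N) (c : ℝ)
    (rbar : EReal) (lam : ℝ → ℝ) (gQ : RiemMetric (EuclideanSpace ℝ (Fin (n + 1))) Q)
    (ψ : OpenPartialHomeomorph (ℝ × N) Q) (X : M → Q) (ν : ∀ x : M, TangentSpace (𝓡 (n + 1)) (X x))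
    (Γ : Set (Fin n → ℝ)) (f : (Fin n → ℝ) → ℝ) (k : M → Fin n → ℝ) (α : ℝ) : Prop where
  curvature : HasConstantSectionalCurvature gN c
  smooth_warp : ContDiffOn ℝ ∞ lam (radialInterval rbar)
  warp_pos : ∀ r ∈ radialInterval rbar, 0 < lam r
  warp_deriv_pos : ∀ r ∈ radialInterval rbar, 0 < deriv lam r
  warp_condition : ∀ r ∈ radialInterval rbar,
    0 ≤ deriv (deriv lam) r / lam r + (c - deriv lam r ^ 2) / lam r ^ 2
  product : IsWarpedProduct gN gQ rbar lam ψ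
  immersion : IsSmoothImmersion (EuclideanSpace ℝ (Fin n)) (EuclideanSpace ℝ (Fin (n + 1))) X
  normal : IsUnitNormal (EuclideanSpace ℝ (Fin n)) gQ X ν
  cone : IsAdmissibleCone Γ
  curvatureFunction : IsCurvatureFunction Γ f
  principal : ∀ x, IsPrincipalCurvatures gQ X ν x (k x)
  mem_cone : ∀ x, k x ∈ Γ
  exponent_pos : 0 < α
  equation : ∀ x, f (k x) ^ (-α) = gQ.inner (X x) (radialField lam ψ (X x)) (ν x)

/-- The function `u ^ (1 + 1 / α) / (1 + 1 / α) - Φ(r)` to which the minimum principle is applied,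
where `u = f(k) ^ (-α)` is the support function and `Φ` is a primitive of the warping function. -/
noncomputable def testFunction (ψ : OpenPartialHomeomorph (ℝ × N) Q) (X : M → Q)
    (f : (Fin n → ℝ) → ℝ) (k : M → Fin n → ℝ) (α : ℝ) (Φ : ℝ → ℝ) (x : M) : ℝ :=
  (f (k x) ^ (-α)) ^ (1 + 1 / α) / (1 + 1 / α) - Φ (ψ.symm (X x)).1

namespace IsSelfSimilarHypersurface

variable {gN : RiemMetric (EuclideanSpace ℝ (Fin n)) N} {c : ℝ} {rbar : EReal} {lam : ℝ → ℝ}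
  {gQ : RiemMetric (EuclideanSpace ℝ (Fin (n + 1))) Q} {ψ : OpenPartialHomeomorph (ℝ × N) Q}
  {X : M → Q} {ν : ∀ x : M, TangentSpace (𝓡 (n + 1)) (X x)} {Γ : Set (Fin n → ℝ)}
  {f : (Fin n → ℝ) → ℝ} {k : M → Fin n → ℝ} {α : ℝ}

/-- The support function is positive, so the hypersurface avoids the apex. -/
theorem mem_target (h : IsSelfSimilarHypersurface gN c rbar lam gQ ψ X ν Γ f k α) (x : M) :
    X x ∈ ψ.target := by
  by_contra hx
  have h1 := h.equation x
  have h2 : radialField (n := n) lam ψ (X x) = 0 := if_neg hx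
  rw [h2, map_zero] at h1
  exact (Real.rpow_pos_of_pos (h.curvatureFunction.pos _ (h.mem_cone x)) _).ne' h1

theorem radius_mem (h : IsSelfSimilarHypersurface gN c rbar lam gQ ψ X ν Γ f k α) (x : M) :
    (ψ.symm (X x)).1 ∈ radialInterval rbar := by
  have h1 := ψ.map_target (h.mem_target x)
  rw [h.product.source_eq] at h1
  exact h1.1

theorem mem_polarDomain (h : IsSelfSimilarHypersurface gN c rbar lam gQ ψ X ν Γ f k α) {x₀ : M}
    {z : EuclideanSpace ℝ (Fin n)} (hz : z ∈ (extChartAt (𝓡 n) x₀).target) {q : N}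
    (hq : (ψ.symm (X ((extChartAt (𝓡 n) x₀).symm z))).2 ∈ (extChartAt (𝓡 n) q).source) :
    z ∈ polarDomain ψ X x₀ q :=
  ⟨hz, h.mem_target _, mem_univ _, hq⟩

theorem isWarpedHypersurface (h : IsSelfSimilarHypersurface gN c rbar lam gQ ψ X ν Γ f k α)
    (x₀ : M) (q : N) :
    IsWarpedHypersurface (polarDomain ψ X x₀ q) (radialInterval rbar) (extChartAt (𝓡 n) q).target
      (metricInChart gN q) lam (radiusInChart ψ X x₀) (fibreInChart ψ X x₀ q)
      (normalInChart lam ψ X ν x₀ q) :=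
  h.product.isWarpedHypersurface h.smooth_warp h.warp_pos h.immersion h.normal x₀ q

theorem equation_inChart (h : IsSelfSimilarHypersurface gN c rbar lam gQ ψ X ν Γ f k α) {x₀ : M}
    {q : N} {z : EuclideanSpace ℝ (Fin n)} (hz : z ∈ polarDomain ψ X x₀ q) :
    f (k ((extChartAt (𝓡 n) x₀).symm z)) ^ (-α) =
      lam (radiusInChart ψ X x₀ z) * (normalInChart lam ψ X ν x₀ q z).1 := by
  rw [h.equation, h.product.inner_radialField q hz.2]
  rfl

/-- The principal curvatures diagonalize the forms of the moving frame model. The second fundamental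
form is recovered from its symmetrization. -/
theorem exists_diagonalizes (h : IsSelfSimilarHypersurface gN c rbar lam gQ ψ X ν Γ f k α)
    {x₀ : M} {q : N} {z : EuclideanSpace ℝ (Fin n)} (hz : z ∈ polarDomain ψ X x₀ q) :
    ∃ e, Diagonalizes
      (warpedFirstForm lam (metricInChart gN q) (radiusInChart ψ X x₀) (fibreInChart ψ X x₀ q) z)
      (warpedSecondForm lam (metricInChart gN q) (radiusInChart ψ X x₀) (fibreInChart ψ X x₀ q)
        (normalInChart lam ψ X ν x₀ q) z) (k ((extChartAt (𝓡 n) x₀).symm z)) e := by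
  obtain ⟨e, he⟩ := h.principal ((extChartAt (𝓡 n) x₀).symm z)
  have hlift : ∀ v : TangentSpace (𝓡 n) ((extChartAt (𝓡 n) x₀).symm z),
      ∃ a : EuclideanSpace ℝ (Fin n),
        tangentVector (E := EuclideanSpace ℝ (Fin n)) (extChartAt (𝓡 n) x₀).symm z a = v := by
    intro v
    have h1 := mfderiv_symm_mfderiv_extChartAt ((extChartAt (𝓡 n) x₀).map_target hz.1) v
    rw [(extChartAt (𝓡 n) x₀).right_inv hz.1] at h1
    exact ⟨_, h1⟩
  choose a ha using fun i => hlift (e i)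
  have hmodel := (h.isWarpedHypersurface x₀ q).isHypersurfaceModel rfl
  refine ⟨a, fun i j => ⟨?_, ?_⟩⟩
  · rw [warpedFirstForm_inChart h.product h.immersion.smooth hz, ha, ha]
    exact (he i j).1
  · have h1 := warpedSecondForm_inChart_add h.product h.smooth_warp h.warp_pos h.immersion h.normal
      hz (a i) (a j)
    rw [ha, ha, (he i j).2, (he j i).2] at h1
    have h2 : (if j = i then k ((extChartAt (𝓡 n) x₀).symm z) j else 0) =
        if i = j then k ((extChartAt (𝓡 n) x₀).symm z) i else 0 := by
      by_cases hij : i = j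
      · subst hij; rfl
      · rw [if_neg hij, if_neg (Ne.symm hij)]
    have h3 := hmodel.secondForm_symm hz (a i) (a j)
    rw [h2] at h1
    simp only [warpedSecondForm] at h1 ⊢
    linarith

theorem firstForm_eventuallyEq (h : IsSelfSimilarHypersurface gN c rbar lam gQ ψ X ν Γ f k α)
    {x₀ : M} {q q' : N} {z : EuclideanSpace ℝ (Fin n)} (hz : z ∈ polarDomain ψ X x₀ q)
    (hz' : z ∈ polarDomain ψ X x₀ q') :
    warpedFirstForm lam (metricInChart gN q) (radiusInChart ψ X x₀) (fibreInChart ψ X x₀ q) =ᶠ[𝓝 z]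
      warpedFirstForm lam (metricInChart gN q') (radiusInChart ψ X x₀)
        (fibreInChart ψ X x₀ q') := by
  filter_upwards [(h.isWarpedHypersurface x₀ q).isOpen.mem_nhds hz,
    (h.isWarpedHypersurface x₀ q').isOpen.mem_nhds hz'] with y hy hy'
  ext v w
  rw [warpedFirstForm_inChart h.product h.immersion.smooth hy,
    warpedFirstForm_inChart h.product h.immersion.smooth hy']

/-- The differential inequality for the test function in the chart at `x₀`. The constant curvature
of the fibre enters at the centre of a chart of the fibre, which depends on the point `z`; the first
fundamental form may be taken in any polar coordinates. -/
theorem exists_frame (h : IsSelfSimilarHypersurface gN c rbar lam gQ ψ X ν Γ f k α) {Φ : ℝ → ℝ}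
    (hΦ : ∀ r ∈ radialInterval rbar, HasDerivAt Φ (lam r) r) {x₀ : M} {q : N}
    {z : EuclideanSpace ℝ (Fin n)} (hz : z ∈ polarDomain ψ X x₀ q)
    {w : EuclideanSpace ℝ (Fin n) → ℝ}
    (hw : w = fun z => testFunction ψ X f k α Φ ((extChartAt (𝓡 n) x₀).symm z))
    {I : EuclideanSpace ℝ (Fin n) →
      EuclideanSpace ℝ (Fin n) →L[ℝ] EuclideanSpace ℝ (Fin n) →L[ℝ] ℝ}
    (hI : I = warpedFirstForm lam (metricInChart gN q) (radiusInChart ψ X x₀)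
      (fibreInChart ψ X x₀ q)) {κ : Fin n → ℝ} (hκ : κ = k ((extChartAt (𝓡 n) x₀).symm z)) :
    ContDiffAt ℝ ∞ w z ∧ ∃ (b : EuclideanSpace ℝ (Fin n) →L[ℝ] EuclideanSpace ℝ (Fin n) →L[ℝ] ℝ)
      (e S : Fin n → EuclideanSpace ℝ (Fin n)), Diagonalizes (I z) b κ e ∧
      (∀ i, fderiv ℝ w z (e i) = (κ i / f κ - 1) *
        (lam (radiusInChart ψ X x₀ z) * fderiv ℝ (radiusInChart ψ X x₀) z (e i))) ∧
      (∀ i v, I z (S i) v = fderiv ℝ I z (e i) (e i) v - fderiv ℝ I z v (e i) (e i) / 2) ∧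
      ∑ i, partialDeriv f i κ * fderiv ℝ (fderiv ℝ w) z (e i) (e i) ≤
        ∑ i, partialDeriv f i κ * fderiv ℝ w z (S i) +
        deriv lam (radiusInChart ψ X x₀ z) * (1 - ∑ i, partialDeriv f i κ) +
        1 / (α * f κ ^ (-α)) * ∑ i, κ i *
          (lam (radiusInChart ψ X x₀ z) * fderiv ℝ (radiusInChart ψ X x₀) z (e i)) ^ 2 *
          (partialDeriv f i κ * κ i / f κ - 1) := by
  obtain ⟨q', hq'⟩ : ∃ q' : N, q' = (ψ.symm (X ((extChartAt (𝓡 n) x₀).symm z))).2 := ⟨_, rfl⟩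
  have hz' : z ∈ polarDomain ψ X x₀ q' :=
    h.mem_polarDomain hz.1 (by rw [← hq']; exact mem_extChartAt_source q')
  have hhyp := h.isWarpedHypersurface x₀ q'
  have hex : ∀ y, ∃ e, y ∈ polarDomain ψ X x₀ q' → Diagonalizes
      (warpedFirstForm lam (metricInChart gN q') (radiusInChart ψ X x₀) (fibreInChart ψ X x₀ q') y)
      (warpedSecondForm lam (metricInChart gN q') (radiusInChart ψ X x₀) (fibreInChart ψ X x₀ q')
        (normalInChart lam ψ X ν x₀ q') y) (k ((extChartAt (𝓡 n) x₀).symm y)) e := by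
    intro y
    by_cases hy : y ∈ polarDomain ψ X x₀ q'
    · obtain ⟨e, he⟩ := h.exists_diagonalizes hy
      exact ⟨e, fun _ => he⟩
    · exact ⟨fun _ => 0, fun hy' => absurd hy' hy⟩
  choose e he using hex
  have hy : fibreInChart ψ X x₀ q' z = extChartAt (𝓡 n) q' q' := by
    rw [fibreInChart, ← hq']
  have hcurv := h.curvature.curvatureForm_eq q'
  rw [← hy] at hcurv
  have hIeq : I =ᶠ[𝓝 z] warpedFirstForm lam (metricInChart gN q') (radiusInChart ψ X x₀)
      (fibreInChart ψ X x₀ q') := by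
    rw [hI]; exact h.firstForm_eventuallyEq hz hz'
  obtain ⟨h1, h2, S, h3, h4⟩ := hhyp.sum_second_derivative_le
    (κ := fun z => k ((extChartAt (𝓡 n) x₀).symm z)) (w := w)
    finrank_euclideanSpace_fin finrank_euclideanSpace_fin h.cone h.curvatureFunction he
    (fun z _ => h.mem_cone _) h.exponent_pos (fun z hz => h.equation_inChart hz) hΦ hz' hcurv
    (h.warp_condition _ (h.radius_mem _)) (fun z _ => by rw [hw]; rfl)
  subst hκ
  refine ⟨h1, warpedSecondForm lam (metricInChart gN q') (radiusInChart ψ X x₀)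
    (fibreInChart ψ X x₀ q') (normalInChart lam ψ X ν x₀ q') z, e z, S, ?_, h2, ?_, h4⟩
  · rw [hIeq.self_of_nhds]; exact he z hz'
  · intro i v
    rw [hIeq.fderiv_eq, hIeq.self_of_nhds]
    exact h3 i v

end IsSelfSimilarHypersurface

end SelfSimilar

/-! ### Rigidity -/

section Rigidity

theorem ordConnected_radialInterval (rbar : EReal) : (radialInterval rbar).OrdConnected := by
  refine ⟨fun a ha b hb r hr => ⟨ha.1.trans_le hr.1, ?_⟩⟩
  exact (EReal.coe_le_coe_iff.2 hr.2).trans_lt hb.2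

theorem exists_primitive {rbar : EReal} {lam : ℝ → ℝ}
    (hlam : ContinuousOn lam (radialInterval rbar)) :
    ∃ Φ : ℝ → ℝ, ∀ r ∈ radialInterval rbar, HasDerivAt Φ (lam r) r := by
  rcases (radialInterval rbar).eq_empty_or_nonempty with h0 | ⟨r₁, hr₁⟩
  · exact ⟨0, fun r hr => by rw [h0] at hr; exact hr.elim⟩
  · refine ⟨fun r => ∫ t in r₁..r, lam t, fun r hr => ?_⟩
    have hopen := isOpen_radialInterval rbar
    refine intervalIntegral.integral_hasDerivAt_right ?_ ?_ (hlam.continuousAt (hopen.mem_nhds hr))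
    · exact (hlam.mono ((ordConnected_radialInterval rbar).uIcc_subset hr₁ hr)).intervalIntegrable
    · exact hlam.stronglyMeasurableAtFilter hopen r hr

variable {n : ℕ}
  {N : Type*} [TopologicalSpace N] [ChartedSpace (EuclideanSpace ℝ (Fin n)) N]
  [IsManifold (𝓡 n) ∞ N]
  {Q : Type*} [TopologicalSpace Q] [ChartedSpace (EuclideanSpace ℝ (Fin (n + 1))) Q]
  [IsManifold (𝓡 (n + 1)) ∞ Q]
  {M : Type*} [TopologicalSpace M] [ChartedSpace (EuclideanSpace ℝ (Fin n)) M]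
  [IsManifold (𝓡 n) ∞ M]

namespace IsSelfSimilarHypersurface

variable {gN : RiemMetric (EuclideanSpace ℝ (Fin n)) N} {c : ℝ} {rbar : EReal} {lam : ℝ → ℝ}
  {gQ : RiemMetric (EuclideanSpace ℝ (Fin (n + 1))) Q} {ψ : OpenPartialHomeomorph (ℝ × N) Q}
  {X : M → Q} {ν : ∀ x : M, TangentSpace (𝓡 (n + 1)) (X x)} {Γ : Set (Fin n → ℝ)}
  {f : (Fin n → ℝ) → ℝ} {k : M → Fin n → ℝ} {α : ℝ} {Φ : ℝ → ℝ}

theorem exists_mem_polarDomain (h : IsSelfSimilarHypersurface gN c rbar lam gQ ψ X ν Γ f k α)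
    {x₀ : M} {z : EuclideanSpace ℝ (Fin n)} (hz : z ∈ (extChartAt (𝓡 n) x₀).target) :
    ∃ q, z ∈ polarDomain ψ X x₀ q :=
  ⟨_, h.mem_polarDomain hz (mem_extChartAt_source _)⟩

/-- The strong minimum principle for the test function: it is constant near a minimum point. -/
theorem eventually_testFunction_eq
    (h : IsSelfSimilarHypersurface gN c rbar lam gQ ψ X ν Γ f k α)
    (hΦ : ∀ r ∈ radialInterval rbar, HasDerivAt Φ (lam r) r) {x₀ : M}
    (hmin : ∀ x, testFunction ψ X f k α Φ x₀ ≤ testFunction ψ X f k α Φ x) :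
    ∀ᶠ x in 𝓝 x₀, testFunction ψ X f k α Φ x = testFunction ψ X f k α Φ x₀ := by
  obtain ⟨z₀, hz₀⟩ : ∃ z₀, z₀ = extChartAt (𝓡 n) x₀ x₀ := ⟨_, rfl⟩
  have hz₀T : z₀ ∈ (extChartAt (𝓡 n) x₀).target := by
    rw [hz₀]; exact mem_extChartAt_target x₀
  have hx₀ : (extChartAt (𝓡 n) x₀).symm z₀ = x₀ := by
    rw [hz₀]; exact extChartAt_to_inv x₀
  obtain ⟨q, hq⟩ := h.exists_mem_polarDomain hz₀T
  have hhyp := h.isWarpedHypersurface x₀ q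
  have hU := hhyp.isOpen.mem_nhds hq
  obtain ⟨w, hw⟩ : ∃ w : EuclideanSpace ℝ (Fin n) → ℝ,
      w = fun z => testFunction ψ X f k α Φ ((extChartAt (𝓡 n) x₀).symm z) := ⟨_, rfl⟩
  obtain ⟨I, hI⟩ : ∃ I, I = warpedFirstForm lam (metricInChart gN q) (radiusInChart ψ X x₀)
      (fibreInChart ψ X x₀ q) := ⟨_, rfl⟩
  have hIc : ContDiffAt ℝ ∞ I z₀ := by rw [hI]; exact hhyp.contDiffOn_firstForm.contDiffAt hU
  have hIIc := (hhyp.contDiffOn_secondForm.contDiffAt hU).continuousAt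
  have hwc := (h.exists_frame hΦ hq hw hI rfl).1
  -- bounds near `z₀`
  have hex : ∀ y, ∃ e, y ∈ polarDomain ψ X x₀ q → Diagonalizes (I y)
      (warpedSecondForm lam (metricInChart gN q) (radiusInChart ψ X x₀) (fibreInChart ψ X x₀ q)
        (normalInChart lam ψ X ν x₀ q) y) (k ((extChartAt (𝓡 n) x₀).symm y)) e := by
    intro y
    by_cases hy : y ∈ polarDomain ψ X x₀ q
    · obtain ⟨e, he⟩ := h.exists_diagonalizes hy
      exact ⟨e, fun _ => by rw [hI]; exact he⟩
    · exact ⟨fun _ => 0, fun hy' => absurd hy' hy⟩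
  choose e₀ he₀ using hex
  have hdiag : ∀ᶠ y in 𝓝 z₀, Diagonalizes (I y)
      (warpedSecondForm lam (metricInChart gN q) (radiusInChart ψ X x₀) (fibreInChart ψ X x₀ q)
        (normalInChart lam ψ X ν x₀ q) y) (k ((extChartAt (𝓡 n) x₀).symm y)) (e₀ y) := by
    filter_upwards [hU] with y hy using he₀ y hy
  -- `m` is a lower bound for `F` and its partial derivatives, `L₀` an upper bound for these and for
  -- the curvatures
  obtain ⟨m, hm, L₀, hL₀⟩ := Diagonalizes.eventually_bounds finrank_euclideanSpace_fin hdiag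
    hIc.continuousAt hIIc h.cone h.curvatureFunction (Eventually.of_forall fun z => h.mem_cone _)
  obtain ⟨B₀, hB₀, η, hη, hBη⟩ := hdiag.self_of_nhds.exists_norm_sq_le finrank_euclideanSpace_fin
  -- one constant for the metric, its inverse and its derivative
  obtain ⟨B, hB⟩ : ∃ B, B = B₀ + ‖I z₀‖ + ‖fderiv ℝ I z₀‖ + 1 := ⟨_, rfl⟩
  have hBpos : 0 < B := by rw [hB]; positivity
  have hIB : ∀ᶠ z in 𝓝 z₀, ‖I z‖ < B := by
    refine hIc.continuousAt.norm.eventually_lt_const ?_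
    have := norm_nonneg (fderiv ℝ I z₀)
    rw [hB]; linarith
  have hDB : ∀ᶠ z in 𝓝 z₀, ‖fderiv ℝ I z‖ < B := by
    refine (hIc.fderiv_right (m := ∞) (by simp)).continuousAt.norm.eventually_lt_const ?_
    have := norm_nonneg (I z₀)
    rw [hB]; linarith
  have hB1 : ∀ᶠ z in 𝓝 z₀, ∀ v, ‖v‖ ^ 2 ≤ B * I z v v := by
    have h1 : ∀ᶠ z in 𝓝 z₀, ‖I z - I z₀‖ < η := by
      refine (hIc.continuousAt.sub continuousAt_const).norm.eventually_lt_const ?_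
      simpa using hη
    filter_upwards [h1] with z hz v
    have h2 := hBη _ hz.le v
    have h3 : 0 ≤ I z v v := by
      by_contra h3
      have := mul_neg_of_pos_of_neg hB₀ (not_le.1 h3)
      have := sq_nonneg ‖v‖
      linarith
    refine h2.trans (mul_le_mul_of_nonneg_right ?_ h3)
    have := norm_nonneg (I z₀)
    have := norm_nonneg (fderiv ℝ I z₀)
    rw [hB]; linarith
  -- one constant above `L₀`, the differential of `w`, and `1 / (α * F ^ (-α))`
  obtain ⟨L, hL⟩ : ∃ L, L = |L₀| + (‖fderiv ℝ w z₀‖ + 1) + 1 / α * |L₀| ^ α := ⟨_, rfl⟩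
  have hα := h.exponent_pos
  have hLα : 0 ≤ 1 / α * |L₀| ^ α := by positivity
  have hL0 : L₀ ≤ L := by
    have := le_abs_self L₀
    have := norm_nonneg (fderiv ℝ w z₀)
    rw [hL]; linarith
  have hLpos : 0 ≤ L := by rw [hL]; positivity
  have hGL : ∀ᶠ z in 𝓝 z₀, ‖fderiv ℝ w z‖ < L := by
    refine (hwc.fderiv_right (m := ∞) (by simp)).continuousAt.norm.eventually_lt_const ?_
    have := abs_nonneg L₀
    rw [hL]; linarith
  have hU' : ∀ᶠ z in 𝓝 z₀, z ∈ polarDomain ψ X x₀ q := hU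
  obtain ⟨R, hR, hball⟩ := Metric.eventually_nhds_iff_ball.1
    (((Filter.Eventually.and hU' hL₀).and (hIB.and hDB)).and (hB1.and hGL))
  -- the strong minimum principle
  have hsmp : ∀ᶠ z in 𝓝 z₀, w z - w z₀ = 0 := by
    refine strong_minimum_principle (ι := Fin n) (R := R) (θ := m / B)
      (C := n * (L * B) + n * (L * (2 * B ^ 3) + L * (L * (L * L / m + 1) * (L * B))))
      hR (div_pos hm hBpos) ?_ ?_ (sub_self _) ?_
    · intro z hz
      exact (((h.exists_frame hΦ (hball z hz).1.1.1 hw hI rfl).1).sub contDiffAt_const).of_le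
        two_le_infty
    · intro z _
      rw [sub_nonneg, hw]
      simpa only [hx₀] using hmin _
    · intro z hz
      obtain ⟨⟨⟨hzU, hF1, hF2, hzb⟩, hzI, hzD⟩, hzB, hzG⟩ := hball z hz
      obtain ⟨κ, hκ⟩ : ∃ κ, κ = k ((extChartAt (𝓡 n) x₀).symm z) := ⟨_, rfl⟩
      obtain ⟨-, b, e, S, hd, hG, hS, hineq⟩ := h.exists_frame hΦ hzU hw hI hκ
      rw [← hκ] at hF1 hF2 hzb
      have hκΓ : κ ∈ Γ := by rw [hκ]; exact h.mem_cone _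
      have hF := h.curvatureFunction.pos κ hκΓ
      have hrad := h.radius_mem ((extChartAt (𝓡 n) x₀).symm z)
      have hφ : ∀ i, 0 < partialDeriv f i κ := h.curvatureFunction.strictly_increasing κ hκΓ
      have hφL : ∀ i, partialDeriv f i κ ≤ L := fun i => (hzb i).2.1.trans hL0
      have hτ : 1 / (α * f κ ^ (-α)) ≤ L := by
        have h1 : 1 / (α * f κ ^ (-α)) = 1 / α * f κ ^ α := by
          rw [Real.rpow_neg hF.le]; field_simp
        have h2 : f κ ^ α ≤ |L₀| ^ α :=
          Real.rpow_le_rpow hF.le (hF2.trans (le_abs_self _)) hα.le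
        have h3 : 1 / α * f κ ^ α ≤ 1 / α * |L₀| ^ α := by gcongr
        have := norm_nonneg (fderiv ℝ w z₀)
        have := abs_nonneg L₀
        rw [h1, hL]; linarith
      have hfd : fderiv ℝ (fun z => w z - w z₀) = fderiv ℝ w := by
        funext y; exact fderiv_sub_const _
      have hest := hd.sum_le_mul_norm hBpos.le hm hLpos hzB hzD.le hS hφ hφL
        (fun i => (hzb i).2.2.trans hL0) hF1 (h.curvatureFunction.partial_mul_le κ hκΓ) hzG.le hG
        (h.warp_deriv_pos _ hrad).le (h.curvatureFunction.one_le_sum κ hκΓ)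
        (one_div_nonneg.2 (mul_nonneg hα.le (Real.rpow_pos_of_pos hF _).le)) hτ hineq
      refine ⟨fun i => partialDeriv f i κ, e, fun i => (hφ i).le, ?_, ?_, ?_⟩
      · have h1 : ∑ i, partialDeriv f i κ * ‖e i‖ ^ 2 ≤ ∑ _i : Fin n, L * B :=
          Finset.sum_le_sum fun i _ => mul_le_mul (hφL i) (hd.norm_sq_frame_le hzB i)
            (sq_nonneg _) hLpos
        simp only [Finset.sum_const, Finset.card_univ, Fintype.card_fin, nsmul_eq_mul] at h1
        refine h1.trans (le_add_of_nonneg_right ?_)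
        positivity
      · intro ξ
        have h1 := hd.norm_sq_le_sum_inner finrank_euclideanSpace_fin hzI.le ξ
        calc m / B * ‖ξ‖ ^ 2 ≤ m / B * (B * ∑ i, inner ℝ ξ (e i) ^ 2) := by gcongr
          _ = ∑ i, m * inner ℝ ξ (e i) ^ 2 := by rw [← Finset.mul_sum]; field_simp
          _ ≤ _ := Finset.sum_le_sum fun i _ =>
            mul_le_mul_of_nonneg_right (hzb i).1 (sq_nonneg _)
      · rw [hfd]
        refine hest.trans (mul_le_mul_of_nonneg_right (le_add_of_nonneg_left ?_) (norm_nonneg _))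
        positivity
  have hcont : Tendsto (extChartAt (𝓡 n) x₀) (𝓝 x₀) (𝓝 z₀) := by
    rw [hz₀]; exact continuousAt_extChartAt x₀
  filter_upwards [hcont.eventually hsmp, extChartAt_source_mem_nhds (I := 𝓡 n) x₀] with x hx hxs
  rw [hw] at hx
  simp only [hx₀, (extChartAt (𝓡 n) x₀).left_inv hxs] at hx
  linarith

theorem continuous_testFunction (h : IsSelfSimilarHypersurface gN c rbar lam gQ ψ X ν Γ f k α)
    (hΦ : ∀ r ∈ radialInterval rbar, HasDerivAt Φ (lam r) r) :
    Continuous (testFunction ψ X f k α Φ) := by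
  rw [continuous_iff_continuousAt]
  intro x₀
  obtain ⟨q, hq⟩ := h.exists_mem_polarDomain (mem_extChartAt_target (I := 𝓡 n) x₀)
  have h1 := (h.exists_frame hΦ hq rfl rfl rfl).1.continuousAt
  refine (h1.comp (continuousAt_extChartAt x₀)).congr ?_
  filter_upwards [extChartAt_source_mem_nhds (I := 𝓡 n) x₀] with x hx
  exact congrArg _ ((extChartAt (𝓡 n) x₀).left_inv hx)

/-- The minimum points of the test function form a nonempty open and closed set. -/
theorem testFunction_eq [CompactSpace M] [ConnectedSpace M]
    (h : IsSelfSimilarHypersurface gN c rbar lam gQ ψ X ν Γ f k α)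
    (hΦ : ∀ r ∈ radialInterval rbar, HasDerivAt Φ (lam r) r) :
    ∃ C, ∀ x, testFunction ψ X f k α Φ x = C := by
  have hcont := h.continuous_testFunction hΦ
  obtain ⟨x₁, -, hx₁⟩ := isCompact_univ.exists_isMinOn univ_nonempty hcont.continuousOn
  have hmin : ∀ x, testFunction ψ X f k α Φ x₁ ≤ testFunction ψ X f k α Φ x :=
    fun x => hx₁ (mem_univ x)
  obtain ⟨A, hA⟩ : ∃ A, A = {x | testFunction ψ X f k α Φ x = testFunction ψ X f k α Φ x₁} :=
    ⟨_, rfl⟩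
  have hclopen : IsClopen A := by
    rw [hA]
    refine ⟨isClosed_eq hcont continuous_const, ?_⟩
    rw [isOpen_iff_mem_nhds]
    intro x hx
    have hx' : testFunction ψ X f k α Φ x = testFunction ψ X f k α Φ x₁ := hx
    filter_upwards [h.eventually_testFunction_eq hΦ (x₀ := x) fun y => hx'.trans_le (hmin y)]
      with y hy using hy.trans hx'
  have huniv : A = univ := hclopen.eq_univ ⟨x₁, by rw [hA]; rfl⟩
  refine ⟨testFunction ψ X f k α Φ x₁, fun x => ?_⟩
  have : x ∈ A := by rw [huniv]; trivial
  rw [hA] at this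
  exact this

/-- Once the test function is constant, equality in the differential inequality forces the radius to
be constant. The partial derivatives of `f` then sum to `1`. In a principal direction with `dρ ≠ 0`
the curvature `κ i` would be `F` and the `i`-th partial derivative would be `1`, leaving nothing for
those in the other directions, which are positive as well. -/
theorem fderiv_radiusInChart (hn : 2 ≤ n)
    (h : IsSelfSimilarHypersurface gN c rbar lam gQ ψ X ν Γ f k α)
    (hΦ : ∀ r ∈ radialInterval rbar, HasDerivAt Φ (lam r) r)
    (hconst : ∃ C, ∀ x, testFunction ψ X f k α Φ x = C) {x₀ : M} {z : EuclideanSpace ℝ (Fin n)}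
    (hz : z ∈ (extChartAt (𝓡 n) x₀).target) : fderiv ℝ (radiusInChart ψ X x₀) z = 0 := by
  obtain ⟨C, hC⟩ := hconst
  obtain ⟨q, hq⟩ := h.exists_mem_polarDomain hz
  obtain ⟨w, hw⟩ : ∃ w : EuclideanSpace ℝ (Fin n) → ℝ,
      w = fun z => testFunction ψ X f k α Φ ((extChartAt (𝓡 n) x₀).symm z) := ⟨_, rfl⟩
  obtain ⟨κ, hκ⟩ : ∃ κ, κ = k ((extChartAt (𝓡 n) x₀).symm z) := ⟨_, rfl⟩
  obtain ⟨-, b, e, S, hd, hG, -, hineq⟩ := h.exists_frame hΦ hq hw rfl hκ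
  have hw0 : w = fun _ => C := by rw [hw]; funext y; exact hC _
  have hκΓ : κ ∈ Γ := by rw [hκ]; exact h.mem_cone _
  have hrad := h.radius_mem ((extChartAt (𝓡 n) x₀).symm z)
  have hF := h.curvatureFunction.pos κ hκΓ
  have hφ : ∀ i, 0 < partialDeriv f i κ := h.curvatureFunction.strictly_increasing κ hκΓ
  have hsum := h.curvatureFunction.one_le_sum κ hκΓ
  have hμ : 0 < deriv lam (radiusInChart ψ X x₀ z) := h.warp_deriv_pos _ hrad
  have hl : 0 < lam (radiusInChart ψ X x₀ z) := h.warp_pos _ hrad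
  have hτ : 0 < 1 / (α * f κ ^ (-α)) :=
    one_div_pos.2 (mul_pos h.exponent_pos (Real.rpow_pos_of_pos hF _))
  rw [hw0] at hG hineq
  simp only [fderiv_fun_const, Pi.zero_apply, zero_apply, mul_zero, Finset.sum_const_zero,
    zero_add, fderiv_zero] at hG hineq
  obtain ⟨p, hp⟩ : ∃ p : Fin n → ℝ, ∀ i,
      lam (radiusInChart ψ X x₀ z) * fderiv ℝ (radiusInChart ψ X x₀) z (e i) = p i :=
    ⟨_, fun _ => rfl⟩
  simp only [hp] at hG hineq
  have hterm : ∀ i, κ i * p i ^ 2 * (partialDeriv f i κ * κ i / f κ - 1) ≤ 0 := by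
    intro i
    rcases mul_eq_zero.1 (hG i).symm with h1 | h1
    · have h2 : κ i = f κ := by rwa [sub_eq_zero, div_eq_one_iff_eq hF.ne'] at h1
      have h3 := h.curvatureFunction.partial_mul_le κ hκΓ i
      refine mul_nonpos_of_nonneg_of_nonpos (by rw [h2]; positivity) ?_
      rw [sub_nonpos, div_le_one hF]
      linarith
    · rw [h1]; simp
  have hsum1 : ∑ i, partialDeriv f i κ = 1 := by
    refine le_antisymm ?_ hsum
    by_contra hlt
    have h1 := mul_neg_of_pos_of_neg hμ (sub_neg.2 (not_le.1 hlt))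
    have h2 := mul_nonpos_of_nonneg_of_nonpos hτ.le
      (Finset.sum_nonpos (s := Finset.univ) fun i _ => hterm i)
    linarith
  have hzero : ∀ i, κ i * p i ^ 2 * (partialDeriv f i κ * κ i / f κ - 1) = 0 := by
    rw [hsum1, sub_self, mul_zero, zero_add] at hineq
    have h1 : 0 ≤ ∑ i, κ i * p i ^ 2 * (partialDeriv f i κ * κ i / f κ - 1) :=
      nonneg_of_mul_nonneg_right hineq hτ
    have h2 := le_antisymm (Finset.sum_nonpos (s := Finset.univ) fun i _ => hterm i) h1
    intro i
    exact (Finset.sum_eq_zero_iff_of_nonpos fun i _ => hterm i).1 h2 i (Finset.mem_univ i)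
  have hpz : ∀ i, p i = 0 := by
    intro i
    by_contra hne
    have h1 : κ i = f κ := by
      have := (mul_eq_zero.1 (hG i).symm).resolve_right hne
      rwa [sub_eq_zero, div_eq_one_iff_eq hF.ne'] at this
    have h2 : partialDeriv f i κ = 1 := by
      have h3 := hzero i
      rw [h1, mul_div_assoc, div_self hF.ne', mul_one] at h3
      have h4 := (mul_eq_zero.1 h3).resolve_left (mul_ne_zero hF.ne' (pow_ne_zero 2 hne))
      linarith
    have : Nontrivial (Fin n) := Fin.nontrivial_iff_two_le.2 hn
    obtain ⟨j, hj⟩ := exists_ne i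
    have h3 : partialDeriv f i κ + partialDeriv f j κ ≤ ∑ i, partialDeriv f i κ := by
      rw [← Finset.sum_pair (f := fun i => partialDeriv f i κ) hj.symm]
      exact Finset.sum_le_sum_of_subset_of_nonneg (Finset.subset_univ _) fun l _ _ => (hφ l).le
    linarith [hφ j]
  ext v
  rw [hd.expand finrank_euclideanSpace_fin v, map_sum, zero_apply]
  refine Finset.sum_eq_zero fun i _ => ?_
  have h1 : fderiv ℝ (radiusInChart ψ X x₀) z (e i) = 0 :=
    (mul_eq_zero.1 ((hp i).trans (hpz i))).resolve_left hl.ne'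
  rw [map_smul, h1, smul_zero]

theorem exists_radius_eq [ConnectedSpace M]
    (h : IsSelfSimilarHypersurface gN c rbar lam gQ ψ X ν Γ f k α)
    (hρ : ∀ (x₀ : M), ∀ z ∈ (extChartAt (𝓡 n) x₀).target,
      fderiv ℝ (radiusInChart ψ X x₀) z = 0) :
    ∃ r₀ ∈ radialInterval rbar, ∀ x, (ψ.symm (X x)).1 = r₀ := by
  have hloc : IsLocallyConstant fun x => (ψ.symm (X x)).1 := by
    rw [IsLocallyConstant.iff_eventually_eq]
    intro x₀
    obtain ⟨R, hR, hball⟩ := Metric.mem_nhds_iff.1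
      ((isOpen_extChartAt_target (I := 𝓡 n) x₀).mem_nhds (mem_extChartAt_target x₀))
    have hd : DifferentiableOn ℝ (radiusInChart ψ X x₀)
        (Metric.ball (extChartAt (𝓡 n) x₀ x₀) R) := by
      intro z hz
      obtain ⟨q, hq⟩ := h.exists_mem_polarDomain (hball hz)
      have hhyp := h.isWarpedHypersurface x₀ q
      exact (hhyp.differentiableAt_of_contDiffOn hhyp.smooth_radius hq).differentiableWithinAt
    have hcont : ∀ᶠ x in 𝓝 x₀, extChartAt (𝓡 n) x₀ x ∈ Metric.ball (extChartAt (𝓡 n) x₀ x₀) R :=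
      (continuousAt_extChartAt x₀).preimage_mem_nhds (Metric.ball_mem_nhds _ hR)
    filter_upwards [hcont, extChartAt_source_mem_nhds (I := 𝓡 n) x₀] with x hx hxs
    have h1 := Metric.isOpen_ball.is_const_of_fderiv_eq_zero
      (convex_ball _ R).isPreconnected hd (fun z hz => hρ x₀ z (hball hz)) hx
      (Metric.mem_ball_self hR)
    rwa [radiusInChart, radiusInChart, (extChartAt (𝓡 n) x₀).left_inv hxs,
      extChartAt_to_inv] at h1
  obtain ⟨x₁⟩ : Nonempty M := inferInstance
  exact ⟨_, h.radius_mem x₁, fun x =>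
    hloc.apply_eq_of_isPreconnected isPreconnected_univ (mem_univ x) (mem_univ x₁)⟩

/-- A hypersurface of constant radius projects to the fibre by a local diffeomorphism, which is onto
because the fibre is connected. -/
theorem surjective_fibre [T2Space N] [ConnectedSpace N] [CompactSpace M] [ConnectedSpace M]
    (h : IsSelfSimilarHypersurface gN c rbar lam gQ ψ X ν Γ f k α)
    (hρ : ∀ (x₀ : M), ∀ z ∈ (extChartAt (𝓡 n) x₀).target,
      fderiv ℝ (radiusInChart ψ X x₀) z = 0) :
    Function.Surjective fun x => (ψ.symm (X x)).2 := by
  have hcont : Continuous fun x => (ψ.symm (X x)).2 := by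
    rw [continuous_iff_continuousAt]
    intro x
    exact (continuous_snd.continuousAt.comp (ψ.continuousAt_symm (h.mem_target x))).comp
      h.immersion.smooth.continuous.continuousAt
  have hopen : IsOpen (range fun x => (ψ.symm (X x)).2) := by
    rw [isOpen_iff_mem_nhds]
    rintro _ ⟨x₀, rfl⟩
    obtain ⟨z₀, hz₀⟩ : ∃ z₀, z₀ = extChartAt (𝓡 n) x₀ x₀ := ⟨_, rfl⟩
    have hz₀T : z₀ ∈ (extChartAt (𝓡 n) x₀).target := by
      rw [hz₀]; exact mem_extChartAt_target x₀
    have hx₀ : (extChartAt (𝓡 n) x₀).symm z₀ = x₀ := by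
      rw [hz₀]; exact extChartAt_to_inv x₀
    obtain ⟨q, hq⟩ := h.exists_mem_polarDomain hz₀T
    have hhyp := h.isWarpedHypersurface x₀ q
    have hU := hhyp.isOpen.mem_nhds hq
    -- the radial component of the differential vanishes, so the fibre component is injective
    have hinj : Function.Injective (fderiv ℝ (fibreInChart ψ X x₀ q) z₀) := by
      rw [injective_iff_map_eq_zero]
      intro v hv
      refine hhyp.injective z₀ hq ?_
      rw [warpedDifferential_apply, warpedDifferential_apply, hv, hρ x₀ z₀ hz₀T]
      simp
    have hstrict : HasStrictFDerivAt (fibreInChart ψ X x₀ q)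
        (fderiv ℝ (fibreInChart ψ X x₀ q) z₀) z₀ :=
      (hhyp.smooth_fibre.contDiffAt hU).hasStrictFDerivAt (by simp)
    have hmap := hstrict.map_nhds_eq_of_surj
      (LinearMap.range_eq_top.2 (LinearMap.injective_iff_surjective.1 hinj))
    have himage : fibreInChart ψ X x₀ q '' polarDomain ψ X x₀ q ∈
        𝓝 (fibreInChart ψ X x₀ q z₀) := by
      rw [← hmap]; exact image_mem_map hU
    have hsrc : (ψ.symm (X x₀)).2 ∈ (extChartAt (𝓡 n) q).source := by
      have := hq.2.2.2
      rwa [hx₀] at this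
    have hval : fibreInChart ψ X x₀ q z₀ = extChartAt (𝓡 n) q (ψ.symm (X x₀)).2 := by
      rw [fibreInChart, hx₀]
    rw [hval] at himage
    filter_upwards [(contMDiffAt_extChartAt_of_mem hsrc).continuousAt.preimage_mem_nhds himage,
      (isOpen_extChartAt_source q).mem_nhds hsrc] with y hy hys
    obtain ⟨z, hz, hzy⟩ := hy
    exact ⟨(extChartAt (𝓡 n) x₀).symm z, (extChartAt (𝓡 n) q).injOn hz.2.2.2 hys hzy⟩
  have hclopen : IsClopen (range fun x => (ψ.symm (X x)).2) :=
    ⟨(isCompact_range hcont).isClosed, hopen⟩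
  exact range_eq_univ.1 (hclopen.eq_univ (range_nonempty _))

end IsSelfSimilarHypersurface

end Rigidity

theorem mainTheorem1 {n : ℕ} (hn : 2 ≤ n)
    -- the closed fibre `N`, of constant sectional curvature `c`
    {N : Type*} [TopologicalSpace N] [T2Space N] [CompactSpace N] [ConnectedSpace N]
    [ChartedSpace (EuclideanSpace ℝ (Fin n)) N] [IsManifold (𝓡 n) ∞ N]
    (gN : RiemMetric (EuclideanSpace ℝ (Fin n)) N) (c : ℝ)
    (hc : HasConstantSectionalCurvature gN c)
    -- the warping function on `(0, rbar)`
    (rbar : EReal) (lam : ℝ → ℝ)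
    (hlam_smooth : ContDiffOn ℝ ∞ lam (radialInterval rbar))
    (hlam_pos : ∀ r ∈ radialInterval rbar, 0 < lam r)
    (hlam_deriv : ∀ r ∈ radialInterval rbar, 0 < deriv lam r)
    (hlam : ∀ r ∈ radialInterval rbar,
      0 ≤ deriv (deriv lam) r / lam r + (c - deriv lam r ^ 2) / lam r ^ 2)
    -- the ambient warped product `Q = [0, rbar) ×_lam N`
    {Q : Type*} [TopologicalSpace Q] [T2Space Q]
    [ChartedSpace (EuclideanSpace ℝ (Fin (n + 1))) Q] [IsManifold (𝓡 (n + 1)) ∞ Q]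
    (gQ : RiemMetric (EuclideanSpace ℝ (Fin (n + 1))) Q)
    (ψ : OpenPartialHomeomorph (ℝ × N) Q) (hψ : IsWarpedProduct gN gQ rbar lam ψ)
    -- the closed immersed hypersurface `X : M → Q` with unit normal `ν`
    {M : Type*} [TopologicalSpace M] [T2Space M] [CompactSpace M] [ConnectedSpace M]
    [ChartedSpace (EuclideanSpace ℝ (Fin n)) M] [IsManifold (𝓡 n) ∞ M]
    (X : M → Q)
    (hX : IsSmoothImmersion (EuclideanSpace ℝ (Fin n)) (EuclideanSpace ℝ (Fin (n + 1))) X)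
    (ν : ∀ x : M, TangentSpace (𝓡 (n + 1)) (X x))
    (hν : IsUnitNormal (EuclideanSpace ℝ (Fin n)) gQ X ν)
    -- the cone and the curvature function
    (Γ : Set (Fin n → ℝ)) (hΓ : IsAdmissibleCone Γ)
    (f : (Fin n → ℝ) → ℝ) (hf : IsCurvatureFunction Γ f)
    -- the principal curvatures of the hypersurface
    (k : M → Fin n → ℝ) (hk : ∀ x, IsPrincipalCurvatures gQ X ν x (k x))
    (hkΓ : ∀ x, k x ∈ Γ)
    -- the self-similar equation
    (α : ℝ) (hα : 0 < α)
    (heq : ∀ x, f (k x) ^ (-α) = gQ.inner (X x) (radialField lam ψ (X x)) (ν x)) :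
    ∃ r₀ ∈ radialInterval rbar, range X = ψ '' ({r₀} ×ˢ (univ : Set N)) := by
  have h : IsSelfSimilarHypersurface gN c rbar lam gQ ψ X ν Γ f k α :=
    ⟨hc, hlam_smooth, hlam_pos, hlam_deriv, hlam, hψ, hX, hν, hΓ, hf, hk, hkΓ, hα, heq⟩
  obtain ⟨Φ, hΦ⟩ := exists_primitive hlam_smooth.continuousOn
  have hρ : ∀ (x₀ : M), ∀ z ∈ (extChartAt (𝓡 n) x₀).target,
      fderiv ℝ (radiusInChart ψ X x₀) z = 0 := fun x₀ z hz =>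
    h.fderiv_radiusInChart hn hΦ (h.testFunction_eq hΦ) hz
  obtain ⟨r₀, hr₀, hr⟩ := h.exists_radius_eq hρ
  refine ⟨r₀, hr₀, Subset.antisymm ?_ ?_⟩
  · rintro _ ⟨x, rfl⟩
    exact ⟨ψ.symm (X x), ⟨hr x, mem_univ _⟩, ψ.right_inv (h.mem_target x)⟩
  · rintro _ ⟨⟨r, q⟩, ⟨hr', -⟩, rfl⟩
    obtain ⟨x, hx⟩ := h.surjective_fibre hρ q
    have h1 : ψ.symm (X x) = (r, q) := Prod.ext ((hr x).trans hr'.symm) hx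
    exact ⟨x, by rw [← h1, ψ.right_inv (h.mem_target x)]⟩
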